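/- Let $L$ be a smooth 6-manifold with an $SU(3)$-structure: a Riemannian metric $g$, a $g$-orthogonal almost complex structure $J$ with fundamental form $\omega=g(J\cdot,\cdot)$, and a complex volume form $\Psi=\psi_++i\psi_-$ of type $(3,0)$ with $\frac34 i\,\Psi\wedge\bar\Psi=\omega^3$. Let $*_6$ be the Hodge star of $g$ and the volume form $\frac16\omega^3$. Let $\pi_0,\sigma_0\in C^\infty(L)$, $\pi_1,\nu_1\in\Omega^1(L)$, $\pi_2,\sigma_2\in\Omega^2_8(L)=\{\beta\in\Omega^2(L) : J\beta=\beta,\ \beta\wedge\omega^2=0\}$ and $\nu_3\in\Omega^3_{12}(L)=\{\gamma\in\Omega^3(L) : \gamma\wedge\omega=0,\ \gamma\wedge\psi_\pm=0\}$ be its torsion forms, i.e. $$d\omega=-\tfrac32\sigma_0\psi_++\tfrac32\pi_0\psi_-+\nu_1\wedge\omega+\nu_3,$$ $$d\psi_+=\pi_0\omega^2+\pi_1\wedge\psi_+-\pi_2\wedge\omega,\qquad d\psi_-=\sigma_0\omega^2+\pi_1\wedge\psi_--\sigma_2\wedge\omega.$$ Let $I_f\subset\mathbb R$ be an open interval with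 coordinate $t$, and let $f,\alpha,\beta:I_f\to\mathbb R$ be smooth functions with $f$ nowhere zero and $\alpha^2+\beta^2=1$. Then (identifying forms on $L$ with their pullbacks) the 3-form $$\varphi=f^2\,\omega\wedge dt+f^3(\alpha\psi_+-\beta\psi_-)$$ on $M=I_f\times L$ is a $G_2$-structure, i.e. it is smooth and at each point $\varphi=e^{127}+e^{347}+e^{567}+e^{135}-e^{146}-e^{236}-e^{245}$ for some coframe $e^1,\dots,e^7$. Let $*_7$ be the Hodge star of the metric and orientation for which such coframes are orthonormal and positive. The torsion forms of $\varphi$, i.e. the unique $\tau_0\in C^\infty(M)$, $\tau_1\in\Omega^1(M)$, $\tau_2\in\Omega^2_{14}(M)=\{\beta : \beta\wedge *_7\varphi=0\}$ and $\tau_3\in\Omega^3_{27}(M)=\{\gamma : \gamma\wedge\varphi=0,\ \gamma\wedge *_7\varphi=0\}$ with $$d\varphi=\tau_0 *_7\varphi+3\tau_1\wedge\varphi+*_7\tau_3,\qquad d*_7\varphi=4\tau_1\wedge *_7\varphi+\tau_2\wedge\varphi,$$ exist and are given by $$\tau_0=\tfrac{4}{7f}\left(3\pi_0\alpha-3\sigma_0\beta+f\alpha\beta'-f\beta\alpha'\right),$$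 $$\tau_1=\tfrac1{2f}\left(\pi_0\beta+\sigma_0\alpha+2f'\right)dt+\tfrac16\nu_1+\tfrac16\pi_1,$$ $$\begin{aligned}\tau_2={}&-\tfrac23 *_6(\nu_1\wedge\omega^2)\wedge dt+\tfrac13 *_6(\pi_1\wedge\omega^2)\wedge dt-\tfrac13f\beta *_6(\pi_1\wedge\psi_+)-\tfrac13f\alpha *_6(\pi_1\wedge\psi_-)\\&+\tfrac23f\beta *_6(\nu_1\wedge\psi_+)+\tfrac23f\alpha *_6(\nu_1\wedge\psi_-)-f\beta\pi_2-f\alpha\sigma_2,\end{aligned}$$ $$\begin{aligned}\tau_3={}&-\tfrac3{14}f^2\left(\pi_0\alpha^2-\sigma_0\alpha\beta-2f\beta'\right)\psi_++\tfrac3{14}f^2\left(\pi_0\alpha\beta-\sigma_0\beta^2+2f\alpha'\right)\psi_-\\&+\tfrac27f\left(\pi_0\alpha-\sigma_0\beta-2f\alpha\beta'+2f\beta\alpha'\right)\omega\wedge dt-\tfrac12f^2 *_6(\nu_1\wedge\omega)+\tfrac12f^2 *_6(\pi_1\wedge\omega)\\&+\tfrac12f\alpha *_6(\pi_1\wedge\psi_+)\wedge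 dt-\tfrac12f\beta *_6(\pi_1\wedge\psi_-)\wedge dt-\tfrac12f\alpha *_6(\nu_1\wedge\psi_+)\wedge dt\\&+\tfrac12f\beta *_6(\nu_1\wedge\psi_-)\wedge dt+f(\alpha\pi_2-\beta\sigma_2)\wedge dt-f^2 *_6\nu_3.\end{aligned}$$ -/

import Mathlib

open Set Module
open scoped Manifold

noncomputable section

/-! ### Exterior algebra of a real (topological) vector space -/

namespace ExtAlg

variable {V : Type*} [AddCommGroup V] [Module ℝ V] [TopologicalSpace V]

/-- Wedge product of alternating forms: the sum over `(p, q)`-shuffles, so that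
`(α ∧ β) (u, v) = α u * β v - α v * β u` for covectors. The degree `r = p + q` of the result is an
explicit argument. -/
def wedge {p q : ℕ} (r : ℕ) (α : V [⋀^Fin p]→L[ℝ] ℝ) (β : V [⋀^Fin q]→L[ℝ] ℝ)
    (h : p + q = r := by norm_num) : V [⋀^Fin r]→L[ℝ] ℝ :=
  { ((LinearMap.mul' ℝ ℝ).compAlternatingMap
      (α.toAlternatingMap.domCoprod β.toAlternatingMap)).domDomCongr
        (finSumFinEquiv.trans (finCongr h)) with
    cont := by
      change Continuous fun v : Fin r → V => (LinearMap.mul' ℝ ℝ)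
        ((∑ σ, AlternatingMap.domCoprod.summand α.toAlternatingMap β.toAlternatingMap σ)
          fun i => v ((finSumFinEquiv.trans (finCongr h)) i))
      simp only [_root_.sum_apply, map_sum]
      refine continuous_finsetSum _ fun σ _ => ?_
      induction σ using Quotient.inductionOn' with | _ σ
      have key : ∀ v : Fin r → V, (LinearMap.mul' ℝ ℝ)
          ((AlternatingMap.domCoprod.summand α.toAlternatingMap β.toAlternatingMap
            (Quotient.mk'' σ)) fun i => v ((finSumFinEquiv.trans (finCongr h)) i)) =
          ((Equiv.Perm.sign σ : ℤ) : ℝ) *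
            (α (fun i => v ((finSumFinEquiv.trans (finCongr h)) (σ (Sum.inl i)))) *
              β (fun i => v ((finSumFinEquiv.trans (finCongr h)) (σ (Sum.inr i))))) := by
        intro v
        rw [AlternatingMap.domCoprod.summand_mk'']
        change (LinearMap.mul' ℝ ℝ) ((Equiv.Perm.sign σ : ℤ) • (TensorProduct.tmul ℝ
          (α (fun i => v ((finSumFinEquiv.trans (finCongr h)) (σ (Sum.inl i)))))
          (β (fun i => v ((finSumFinEquiv.trans (finCongr h)) (σ (Sum.inr i))))))) = _
        rw [map_zsmul, LinearMap.mul'_apply, zsmul_eq_mul]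
      simp only [key]
      refine continuous_const.mul (Continuous.mul ?_ ?_)
      · exact α.cont.comp (continuous_pi fun i => continuous_apply _)
      · exact β.cont.comp (continuous_pi fun i => continuous_apply _) }

theorem append_update {p q : ℕ} {ι : Type*} [DecidableEq (Fin q)] (u : Fin p → ι) (w : Fin q → ι)
    (i : Fin q) (x : ι) :
    Fin.append u (Function.update w i x) =
      Function.update (Fin.append u w) (Fin.natAdd p i) x := by
  ext k
  induction k using Fin.addCases with
  | left j =>
    rw [Fin.append_left, Function.update_of_ne, Fin.append_left]
    intro h
    have := congrArg Fin.val h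
    simp at this
    omega
  | right j =>
    by_cases hj : j = i
    · subst hj; simp
    · rw [Fin.append_right, Function.update_of_ne hj, Function.update_of_ne, Fin.append_right]
      simpa using hj

/-- Insertion of the vectors `u` in the first slots: `w ↦ η (u₁, …, u_p, w₁, …, w_q)`. -/
def contract {n p q : ℕ} (h : p + q = n) (η : V [⋀^Fin n]→L[ℝ] ℝ) (u : Fin p → V) :
    V [⋀^Fin q]→L[ℝ] ℝ where
  toFun w := η fun k => Fin.append u w (Fin.cast h.symm k)
  map_update_add' := by
    subst h
    intro _ w i x y
    simp only [Fin.cast_eq_self]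
    change η (Fin.append u _) = η (Fin.append u _) + η (Fin.append u _)
    simp only [append_update, η.map_update_add]
  map_update_smul' := by
    subst h
    intro _ w i c x
    simp only [Fin.cast_eq_self]
    change η (Fin.append u _) = c • η (Fin.append u _)
    simp only [append_update, η.map_update_smul]
  map_eq_zero_of_eq' := by
    subst h
    intro w i j hw hij
    refine η.map_eq_zero_of_eq _ (i := Fin.natAdd p i) (j := Fin.natAdd p j) (by simpa using hw) ?_
    simpa using hij
  cont := by
    refine η.cont.comp (continuous_pi fun k => ?_)
    generalize Fin.cast h.symm k = k'
    induction k' using Fin.addCases with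
    | left i => simpa only [Fin.append_left] using continuous_const
    | right i => simpa only [Fin.append_right] using continuous_apply i

/-- The Hodge star `*γ` of a `p`-form, for the metric with orthonormal basis `b` and the
volume form `vol`:
`(*γ)(w) = (1/p!) ∑_{i₁, …, i_p} γ(b_{i₁}, …, b_{i_p}) vol(b_{i₁}, …, b_{i_p}, w)`,
which is the form characterized by `δ ∧ *γ = ⟨δ, γ⟩ vol`. -/
def hodge {n p : ℕ} (b : Fin n → V) (vol : V [⋀^Fin n]→L[ℝ] ℝ) (q : ℕ)
    (γ : V [⋀^Fin p]→L[ℝ] ℝ) (h : p + q = n := by norm_num) : V [⋀^Fin q]→L[ℝ] ℝ :=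
  ((p.factorial : ℝ)⁻¹) • ∑ i : Fin p → Fin n, γ (b ∘ i) • contract h vol (b ∘ i)

/-- A scalar product has orthonormal bases. -/
theorem exists_orthonormal_basis {W : Type*} [AddCommGroup W] [Module ℝ W] {n : ℕ} [NeZero n]
    (hn : finrank ℝ W = n) (g : W → W → ℝ) (symm : ∀ u v, g u v = g v u)
    (pos : ∀ v, v ≠ 0 → 0 < g v v) (add : ∀ u v w, g (u + v) w = g u w + g v w)
    (smul : ∀ (c : ℝ) (u v : W), g (c • u) v = c * g u v) :
    ∃ b : Basis (Fin n) ℝ W, ∀ i j, g (b i) (b j) = if i = j then 1 else 0 := by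
  have h0 : ∀ v, g 0 v = 0 := fun v => by simpa using smul 0 0 v
  let core : InnerProductSpace.Core ℝ W :=
    { inner := g
      conj_inner_symm := fun u v => by simpa using symm v u
      re_inner_nonneg := fun v => by
        by_cases hv : v = 0
        · subst hv; exact (h0 0).ge
        · exact (pos v hv).le
      add_left := add
      smul_left := fun u v c => by simpa using smul c u v
      definite := fun v hv => by
        by_contra h
        exact (pos v h).ne' hv }
  let _ : NormedAddCommGroup W := core.toNormedAddCommGroup
  let _ : InnerProductSpace ℝ W := InnerProductSpace.ofCore core.toCore
  have : FiniteDimensional ℝ W := FiniteDimensional.of_finrank_pos (by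
    rw [hn]; exact Nat.pos_of_ne_zero (NeZero.ne n))
  let b := (stdOrthonormalBasis ℝ W).reindex (finCongr hn)
  exact ⟨b.toBasis, fun i j => by
    rw [b.coe_toBasis]
    exact orthonormal_iff_ite.mp b.orthonormal i j⟩

section Frame

variable [IsTopologicalAddGroup V] [ContinuousSMul ℝ V] [T2Space V] {n : ℕ}

/-- The `i`-th covector of the coframe dual to the basis `b`, as a 1-form. -/
def coframe (b : Basis (Fin n) ℝ V) (i : Fin n) : V [⋀^Fin 1]→L[ℝ] ℝ :=
  ContinuousAlternatingMap.ofSubsingleton ℝ V ℝ (0 : Fin 1)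
    ⟨b.coord i, haveI := b.finiteDimensional_of_finite; (b.coord i).continuous_of_finiteDimensional⟩

/-- The volume form `e¹ ∧ ⋯ ∧ eⁿ` of the basis `b`, i.e. the determinant in the basis `b`. -/
def frameVol (b : Basis (Fin n) ℝ V) : V [⋀^Fin n]→L[ℝ] ℝ :=
  { b.det with
    cont := by
      have := b.finiteDimensional_of_finite
      change Continuous fun v : Fin n → V => (b.toMatrix v).det
      refine Continuous.matrix_det (continuous_matrix fun i j => ?_)
      exact (b.coord i).continuous_of_finiteDimensional.comp (continuous_apply j) }

end Frame

end ExtAlg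

/-- `α ⋏[r] β` is the wedge product, a form of degree `r`. -/
notation:70 α:70 " ⋏[" r "] " β:71 => ExtAlg.wedge r α β

/-! ### Differential forms on manifolds -/

section Forms

variable {E : Type*} [NormedAddCommGroup E] [NormedSpace ℝ E] {H : Type*} [TopologicalSpace H]
  (I : ModelWithCorners ℝ E H) (M : Type*) [TopologicalSpace M] [ChartedSpace H M]

instance TangentSpace.instT2Space (x : M) : T2Space (TangentSpace I x) :=
  inferInstanceAs (T2Space E)

/-- (Not necessarily smooth) differential `p`-forms on the manifold `M`. -/
abbrev DForm (p : ℕ) : Type _ := (x : M) → (TangentSpace I x) [⋀^Fin p]→L[ℝ] ℝ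

variable {I M} {p : ℕ}

namespace DForm

/-- The expression of a form in the chart at `x₀`: its pullback by the inverse of the chart. -/
def inChart (η : DForm I M p) (x₀ : M) : E → E [⋀^Fin p]→L[ℝ] ℝ := fun y =>
  (η ((extChartAt I x₀).symm y)).compContinuousLinearMap
    ((mfderivWithin 𝓘(ℝ, E) I (extChartAt I x₀).symm (range I) y).comp
      (NormedSpace.fromTangentSpace (𝕜 := ℝ) y).symm.toContinuousLinearMap)

/-- A form is smooth if it is smooth in all charts of the atlas centred at points. -/
def IsSmooth (η : DForm I M p) : Prop :=
  ∀ x₀ : M, ContDiffOn ℝ (⊤ : ℕ∞) (η.inChart x₀) (extChartAt I x₀).target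

/-- The exterior derivative, computed at `x` in the chart at `x`. -/
def d (η : DForm I M p) : DForm I M (p + 1) := fun x =>
  (extDerivWithin (η.inChart x) (range I) (extChartAt I x x)).compContinuousLinearMap
    (mvfderiv I (extChartAt I x) x)

end DForm

end Forms

/-! ### SU(3)-structures -/

/-- An SU(3)-structure on a 6-manifold `L`: a Riemannian metric `g`, a compatible almost complex
structure `J` with fundamental form `ω = g(J·, ·)`, and a complex volume form `Ψ = ψ₊ + i ψ₋`
of type `(3, 0)` with `(3/4) i Ψ ∧ Ψ̄ = ω³`. -/
structure SU3Structure (L : Type*) [TopologicalSpace L]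
    [ChartedSpace (EuclideanSpace ℝ (Fin 6)) L] [IsManifold (𝓡 6) (⊤ : ℕ∞) L] where
  g : Bundle.ContMDiffRiemannianMetric (𝓡 6) (⊤ : ℕ∞) (EuclideanSpace ℝ (Fin 6))
    (fun x : L => TangentSpace (𝓡 6) x)
  J : (x : L) → TangentSpace (𝓡 6) x →L[ℝ] TangentSpace (𝓡 6) x
  J_smooth : ContMDiff (𝓡 6)
    ((𝓡 6).prod 𝓘(ℝ, EuclideanSpace ℝ (Fin 6) →L[ℝ] EuclideanSpace ℝ (Fin 6))) (⊤ : ℕ∞)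
    (fun x => Bundle.TotalSpace.mk'
      (EuclideanSpace ℝ (Fin 6) →L[ℝ] EuclideanSpace ℝ (Fin 6))
      (E := fun x : L => TangentSpace (𝓡 6) x →L[ℝ] TangentSpace (𝓡 6) x) x (J x))
  J_sq : ∀ x u, J x (J x u) = -u
  J_isometry : ∀ x u v, g.inner x (J x u) (J x v) = g.inner x u v
  ω : DForm (𝓡 6) L 2
  ψp : DForm (𝓡 6) L 3
  ψm : DForm (𝓡 6) L 3
  ω_smooth : ω.IsSmooth
  ψp_smooth : ψp.IsSmooth
  ψm_smooth : ψm.IsSmooth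
  ω_apply : ∀ x u v, ω x ![u, v] = g.inner x (J x u) v
  /-- real part of `Ψ(Ju, v, w) = i Ψ(u, v, w)` -/
  type_re : ∀ x u v w, ψp x ![J x u, v, w] = -ψm x ![u, v, w]
  /-- imaginary part of `Ψ(Ju, v, w) = i Ψ(u, v, w)` -/
  type_im : ∀ x u v w, ψm x ![J x u, v, w] = ψp x ![u, v, w]
  /-- `(3/4) i Ψ ∧ Ψ̄ = ω³`, since `Ψ ∧ Ψ̄ = -2i ψ₊ ∧ ψ₋` -/
  normalization : ∀ x, (3 / 2 : ℝ) • (ψp x ⋏[6] ψm x) = (ω x ⋏[4] ω x) ⋏[6] ω x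

namespace SU3Structure

variable {L : Type*} [TopologicalSpace L] [ChartedSpace (EuclideanSpace ℝ (Fin 6)) L]
  [IsManifold (𝓡 6) (⊤ : ℕ∞) L] (S : SU3Structure L)

/-- `ω² = ω ∧ ω`. -/
def ωsq : DForm (𝓡 6) L 4 := fun x => S.ω x ⋏[4] S.ω x

/-- The volume form `ω³ / 6`. -/
def vol : DForm (𝓡 6) L 6 := fun x => (1 / 6 : ℝ) • (S.ωsq x ⋏[6] S.ω x)

theorem exists_orthonormal (x : L) : ∃ b : Basis (Fin 6) ℝ (TangentSpace (𝓡 6) x),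
    ∀ i j, S.g.inner x (b i) (b j) = if i = j then 1 else 0 := by
  have hfr : finrank ℝ (TangentSpace (𝓡 6) x) = 6 :=
    (finrank_euclideanSpace (𝕜 := ℝ) (ι := Fin 6)).trans (Fintype.card_fin 6)
  exact ExtAlg.exists_orthonormal_basis hfr (fun u v => S.g.inner x u v) (S.g.symm x) (S.g.pos x)
    (by simp) (by simp)

/-- The Hodge star of the metric `g` and the volume form `ω³ / 6` (it does not depend on the
choice of the orthonormal basis). -/
def star {p : ℕ} (q : ℕ) {x : L} (γ : (TangentSpace (𝓡 6) x) [⋀^Fin p]→L[ℝ] ℝ)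
    (h : p + q = 6 := by norm_num) : (TangentSpace (𝓡 6) x) [⋀^Fin q]→L[ℝ] ℝ :=
  ExtAlg.hodge (S.exists_orthonormal x).choose (S.vol x) q γ h

/-- The space `Ω²₈`: `Jβ = β` and `β ∧ ω² = 0`. -/
def MemΩ28 (β : DForm (𝓡 6) L 2) : Prop :=
  ∀ x, (∀ u v, β x ![S.J x u, S.J x v] = β x ![u, v]) ∧ β x ⋏[6] S.ωsq x = 0

/-- The space `Ω³₁₂`: `γ ∧ ω = 0` and `γ ∧ ψ₊ = γ ∧ ψ₋ = 0`. -/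
def MemΩ312 (γ : DForm (𝓡 6) L 3) : Prop :=
  ∀ x, γ x ⋏[5] S.ω x = 0 ∧ γ x ⋏[6] S.ψp x = 0 ∧ γ x ⋏[6] S.ψm x = 0

/-- `π₀, σ₀, π₁, ν₁, π₂, σ₂, ν₃` are the torsion forms of the SU(3)-structure. -/
structure IsTorsion (π₀ σ₀ : L → ℝ) (π₁ ν₁ : DForm (𝓡 6) L 1) (π₂ σ₂ : DForm (𝓡 6) L 2)
    (ν₃ : DForm (𝓡 6) L 3) : Prop where
  smooth_π₀ : ContMDiff (𝓡 6) 𝓘(ℝ, ℝ) (⊤ : ℕ∞) π₀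
  smooth_σ₀ : ContMDiff (𝓡 6) 𝓘(ℝ, ℝ) (⊤ : ℕ∞) σ₀
  smooth_π₁ : π₁.IsSmooth
  smooth_ν₁ : ν₁.IsSmooth
  smooth_π₂ : π₂.IsSmooth
  smooth_σ₂ : σ₂.IsSmooth
  smooth_ν₃ : ν₃.IsSmooth
  mem_π₂ : S.MemΩ28 π₂
  mem_σ₂ : S.MemΩ28 σ₂
  mem_ν₃ : S.MemΩ312 ν₃
  d_ω : ∀ x, S.ω.d x = (-(3 / 2) * σ₀ x) • S.ψp x + (3 / 2 * π₀ x) • S.ψm x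
    + ν₁ x ⋏[3] S.ω x + ν₃ x
  d_ψp : ∀ x, S.ψp.d x = π₀ x • S.ωsq x + π₁ x ⋏[4] S.ψp x - π₂ x ⋏[4] S.ω x
  d_ψm : ∀ x, S.ψm.d x = σ₀ x • S.ωsq x + π₁ x ⋏[4] S.ψm x - σ₂ x ⋏[4] S.ω x

end SU3Structure

/-! ### G₂-structures -/

namespace G2

section Linear

variable {V : Type*} [AddCommGroup V] [Module ℝ V] [TopologicalSpace V]
  [IsTopologicalAddGroup V] [ContinuousSMul ℝ V] [T2Space V]

/-- `e^{ijk} = eⁱ ∧ eʲ ∧ eᵏ`, with indices starting at `0`. -/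
def e3 (b : Basis (Fin 7) ℝ V) (i j k : Fin 7) : V [⋀^Fin 3]→L[ℝ] ℝ :=
  (ExtAlg.coframe b i ⋏[2] ExtAlg.coframe b j) ⋏[3] ExtAlg.coframe b k

/-- The basis `b` is adapted to the 3-form `φ`: in the dual coframe `e¹, …, e⁷`,
`φ = e¹²⁷ + e³⁴⁷ + e⁵⁶⁷ + e¹³⁵ - e¹⁴⁶ - e²³⁶ - e²⁴⁵`. -/
def IsAdapted (φ : V [⋀^Fin 3]→L[ℝ] ℝ) (b : Basis (Fin 7) ℝ V) : Prop :=
  φ = e3 b 0 1 6 + e3 b 2 3 6 + e3 b 4 5 6 + e3 b 0 2 4 - e3 b 0 3 5 - e3 b 1 2 5 - e3 b 1 3 4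

open Classical in
/-- The Hodge star of the metric `g_φ` and the orientation induced by a 3-form `φ` that admits
adapted bases: they are the ones for which adapted bases are orthonormal and positive (this does
not depend on the adapted basis). -/
def star (φ : V [⋀^Fin 3]→L[ℝ] ℝ) {p : ℕ} (q : ℕ) (γ : V [⋀^Fin p]→L[ℝ] ℝ)
    (h : p + q = 7 := by norm_num) : V [⋀^Fin q]→L[ℝ] ℝ :=
  if hφ : ∃ b, IsAdapted φ b then ExtAlg.hodge hφ.choose (ExtAlg.frameVol hφ.choose) q γ h else 0

end Linear

variable {E : Type*} [NormedAddCommGroup E] [NormedSpace ℝ E] {H : Type*} [TopologicalSpace H]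
  {I : ModelWithCorners ℝ E H} {M : Type*} [TopologicalSpace M] [ChartedSpace H M]

/-- A `G₂`-structure: a smooth 3-form that has the canonical expression in some basis of each
tangent space. -/
structure IsG2Structure (φ : DForm I M 3) : Prop where
  smooth : φ.IsSmooth
  adapted : ∀ x, ∃ b, IsAdapted (φ x) b

/-- The 4-form `*φ`. -/
def starForm (φ : DForm I M 3) : DForm I M 4 := fun x => star (φ x) 4 (φ x)

/-- `τ₀, τ₁, τ₂, τ₃` are the torsion forms of the `G₂`-structure `φ`; the conditions `mem_τ₂` and
`mem_τ₃` say that `τ₂ ∈ Ω²₁₄` and `τ₃ ∈ Ω³₂₇`. -/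
structure IsTorsion (φ : DForm I M 3) (τ₀ : M → ℝ) (τ₁ : DForm I M 1) (τ₂ : DForm I M 2)
    (τ₃ : DForm I M 3) : Prop where
  smooth_τ₀ : ContMDiff I 𝓘(ℝ, ℝ) (⊤ : ℕ∞) τ₀
  smooth_τ₁ : τ₁.IsSmooth
  smooth_τ₂ : τ₂.IsSmooth
  smooth_τ₃ : τ₃.IsSmooth
  mem_τ₂ : ∀ x, τ₂ x ⋏[6] starForm φ x = 0
  mem_τ₃ : ∀ x, τ₃ x ⋏[6] φ x = 0 ∧ τ₃ x ⋏[7] starForm φ x = 0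
  d_φ : ∀ x, φ.d x = τ₀ x • starForm φ x + (3 : ℝ) • (τ₁ x ⋏[4] φ x) + star (φ x) 4 (τ₃ x)
  d_starφ : ∀ x, (starForm φ).d x =
    (4 : ℝ) • (τ₁ x ⋏[5] starForm φ x) + τ₂ x ⋏[5] φ x

end G2

/-! ### Warped products -/

namespace Warped

variable {L : Type*} [TopologicalSpace L] [ChartedSpace (EuclideanSpace ℝ (Fin 6)) L]
  {U : TopologicalSpace.Opens ℝ}

/-- The model with corners of `I_f × L`, for an open subset `I_f` of the line. -/
abbrev model : ModelWithCorners ℝ (ℝ × EuclideanSpace ℝ (Fin 6))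
    (ModelProd ℝ (EuclideanSpace ℝ (Fin 6))) := 𝓘(ℝ, ℝ).prod (𝓡 6)

/-- The 1-form `dt` on `I_f × L`. -/
def dt : DForm model (U × L) 1 := fun m =>
  ContinuousAlternatingMap.ofSubsingleton ℝ _ ℝ (0 : Fin 1)
    (mvfderiv model (fun m : U × L => (m.1 : ℝ)) m)

/-- Pullback to `I_f × L`, at the point `m = (t, x)`, of an alternating form at `x ∈ L`. -/
def pull (m : U × L) {p : ℕ} (γ : (TangentSpace (𝓡 6) m.2) [⋀^Fin p]→L[ℝ] ℝ) :
    (TangentSpace model m) [⋀^Fin p]→L[ℝ] ℝ :=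
  γ.compContinuousLinearMap (mfderiv model (𝓡 6) (Prod.snd : U × L → L) m)

/-- The form `φ = f² ω ∧ dt + f³ (α ψ₊ - β ψ₋)` on `I_f × L`. -/
def form [IsManifold (𝓡 6) (⊤ : ℕ∞) L] (S : SU3Structure L) (f α β : ℝ → ℝ) : DForm model (U × L) 3 :=
  fun m =>
    f m.1 ^ 2 • (pull m (S.ω m.2) ⋏[3] dt m)
      + f m.1 ^ 3 • (α m.1 • pull m (S.ψp m.2) - β m.1 • pull m (S.ψm m.2))

end Warped

end

noncomputable section

set_option linter.unusedSimpArgs false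

namespace ExtAlg

variable {V : Type*} [AddCommGroup V] [Module ℝ V] [TopologicalSpace V]

/-! ### The wedge product as a sum over permutations -/

/-! At a fixed point the warping can be absorbed into the SU(3)-structure. Put ω̃ = f²ω and Ψ̃ =
f³(α + iβ)Ψ. Then φ = ω̃ ∧ dt + Re Ψ̃, and f²g, J, ω̃, Ψ̃ again satisfy the axioms of an
SU(3)-structure on the tangent space (`IsHermitian.warp`, `IsHermitian.warp_normalization`). A
unitary frame therefore brings ω̃ and Ψ̃ to standard form (`IsHermitian.exists_frame`). Lifted to
the product and completed by ∂_t, it is adapted to φ, and it shows that *φ = ½ω̃² + Im Ψ̃ ∧ dt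
(`isG2Frame_cylinder`, `starForm_form`).

Let m = f'/f, and let k = αβ' − βα' be the angular speed of α + iβ. The t-derivative of Re Ψ̃ is 3m
Re Ψ̃ − k Im Ψ̃ and that of ½ω̃² is 2m ω̃². The derivatives along L are the SU(3) structure
equations with π₀ and σ₀ replaced by (απ₀ − βσ₀)/f and (βπ₀ + ασ₀)/f (`d_form_warped`,
`d_dual_warped`). What remains are identities between alternating forms on one vector space:
`d_cylinderForm_eq`, `d_cylinderDual_eq` and the membership statements for τ₂ and τ₃. They are
verified component by component in the adapted frame. There a wedge product is a sum over shuffles,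
a Hodge star is a signed complementary component, and the conditions on π₂, σ₂, ν₃ are linear
relations among components. `torsionTwo_warped` and `torsionThree_warped` translate the answer back
to the unscaled structure.

Uniqueness is also linear algebra: the 5-form equation determines τ₁ and τ₂, after which the 4-form
equation determines τ₀ and τ₃ (`IsG2Frame.torsion_unique`).

Both Hodge stars are defined through chosen bases, so independence of the choice is needed. For the
G₂ star, two adapted bases must differ by an element of SO(7); this follows because φ ∧ ι_uφ ∧ ι_vφ
recovers the metric times the volume form (`IsAdapted.toMatrix`). Smoothness of the star on L comes
from a formula through the inverse Gram matrix in a fixed frame (`contDiffOn_hodge`). -/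

theorem factorial_mul_wedge_apply {p q r : ℕ} (h : p + q = r) (α : V [⋀^Fin p]→L[ℝ] ℝ)
    (β : V [⋀^Fin q]→L[ℝ] ℝ) (v : Fin r → V) :
    (p.factorial * q.factorial : ℝ) * wedge r α β h v =
      ∑ σ : Equiv.Perm (Fin r), ((Equiv.Perm.sign σ : ℤ) : ℝ) *
        (α (fun i => v (σ (Fin.cast h (Fin.castAdd q i)))) *
          β (fun i => v (σ (Fin.cast h (Fin.natAdd p i))))) := by
  subst h
  have h := congrArg (fun F => (LinearMap.mul' ℝ ℝ) (F fun i => v (finSumFinEquiv i)))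
    (MultilinearMap.domCoprod_alternization_eq α.toAlternatingMap β.toAlternatingMap)
  have h1 : (p.factorial * q.factorial : ℝ) * wedge (p + q) α β rfl v =
      (LinearMap.mul' ℝ ℝ) ((((Fintype.card (Fin p)).factorial * (Fintype.card (Fin q)).factorial) •
        α.toAlternatingMap.domCoprod β.toAlternatingMap) fun i => v (finSumFinEquiv i)) := by
    rw [AlternatingMap.smul_apply, map_nsmul, nsmul_eq_mul]
    simp only [Fintype.card_fin, Nat.cast_mul]
    rfl
  rw [h1, ← h, MultilinearMap.alternatization_apply, map_sum,
    ← (Equiv.permCongr (finSumFinEquiv (m := p) (n := q))).sum_comp]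
  refine Finset.sum_congr rfl fun σ _ => ?_
  rw [Equiv.Perm.sign_permCongr, Units.smul_def, map_zsmul, zsmul_eq_mul]
  simp [MultilinearMap.domDomCongr_apply, MultilinearMap.domCoprod_apply, Equiv.permCongr_apply]

/-- Sorts the permutations by the position k that is sent to 0: the cycle moves k to the front, and
the other factor fixes 0 and permutes the rest. In the wedge product, k is the slot that receives
the first vector. Bijectivity is injectivity plus a count of (n+1)·n! elements. -/
theorem sum_perm_fin_succ {n : ℕ} {A : Type*} [AddCommMonoid A] (F : Equiv.Perm (Fin (n + 1)) → A) :
    ∑ σ, F σ = ∑ k : Fin (n + 1), ∑ e : Equiv.Perm (Fin n),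
      F (Equiv.Perm.decomposeFin.symm (0, e) * k.cycleRange) := by
  rw [← Fintype.sum_prod_type']
  symm
  refine Function.Bijective.sum_comp (e := fun x : Fin (n + 1) × Equiv.Perm (Fin n) =>
    Equiv.Perm.decomposeFin.symm (0, x.2) * x.1.cycleRange) ?_ F
  rw [Fintype.bijective_iff_injective_and_card]
  refine ⟨?_, ?_⟩
  · rintro ⟨k, e⟩ ⟨l, d⟩ h
    simp only at h
    have hk : k = l := by
      have := congrArg (fun σ : Equiv.Perm (Fin (n + 1)) => σ⁻¹ 0) h
      simp only [mul_inv_rev, Equiv.Perm.coe_mul, Function.comp_apply] at this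
      have h0 : ∀ e : Equiv.Perm (Fin n), (Equiv.Perm.decomposeFin.symm (0, e))⁻¹ 0 = 0 := by
        intro e
        rw [Equiv.Perm.inv_eq_iff_eq]
        simp
      rw [h0, h0] at this
      have h1 : ∀ k : Fin (n + 1), (k.cycleRange)⁻¹ 0 = k := fun k => k.cycleRange_symm_zero
      rwa [h1, h1] at this
    subst hk
    have := Equiv.Perm.decomposeFin.symm.injective (mul_right_cancel h)
    simpa using this
  · simp [Fintype.card_perm, Nat.factorial_succ]

/-- Insertion of a vector in the first slot of a form. -/
def interior {n : ℕ} (a : V) (α : V [⋀^Fin (n + 1)]→L[ℝ] ℝ) : V [⋀^Fin n]→L[ℝ] ℝ :=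
  { α.toAlternatingMap.curryLeft a with
    cont := α.cont.comp (Continuous.finCons continuous_const continuous_id) }

theorem interior_apply {n : ℕ} (a : V) (α : V [⋀^Fin (n + 1)]→L[ℝ] ℝ) (v : Fin n → V) :
    interior a α v = α (Matrix.vecCons a v) := rfl

theorem sign_decomposeFin_mul_cycleRange {n : ℕ} (e : Equiv.Perm (Fin n)) (k : Fin (n + 1)) :
    ((Equiv.Perm.sign (Equiv.Perm.decomposeFin.symm (0, e) * k.cycleRange) : ℤ) : ℝ) =
      (-1) ^ (k : ℕ) * ((Equiv.Perm.sign e : ℤ) : ℝ) := by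
  rw [Equiv.Perm.sign_mul, Fin.sign_cycleRange, Equiv.Perm.decomposeFin.symm_sign]
  simp [mul_comm]

theorem cons_decomposeFin_mul_cycleRange {n : ℕ} {X : Type*} (a : X) (w : Fin n → X)
    (e : Equiv.Perm (Fin n)) (k j : Fin (n + 1)) :
    (Fin.cons a w : Fin (n + 1) → X) ((Equiv.Perm.decomposeFin.symm (0, e) * k.cycleRange) j) =
      (k.insertNth a (w ∘ e) : Fin (n + 1) → X) j := by
  rw [← Fin.cons_apply_cycleRange, Equiv.Perm.mul_apply]
  generalize k.cycleRange j = i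
  cases i using Fin.cases <;> simp

/-- This and the next three lemmas record how inserting a vector at slot i interacts with cutting
the slots into the first block (for α) and the last block (for β). The block that contains i sees
the insertion; the other block does not. -/
theorem insertNth_castAdd_castAdd {p q r : ℕ} {X : Type*} (h : p + 1 + q = r + 1) (h' : p + q = r)
    (i j : Fin (p + 1)) (a : X) (u : Fin r → X) :
    (Fin.cast h (Fin.castAdd q i)).insertNth (α := fun _ => X) a u (Fin.cast h (Fin.castAdd q j)) =
      i.insertNth (α := fun _ => X) a (fun k => u (Fin.cast h' (Fin.castAdd q k))) j := by
  induction j using Fin.succAboveCases i with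
  | x => simp
  | p k =>
    rw [Fin.insertNth_apply_succAbove]
    have : Fin.cast h (Fin.castAdd q (i.succAbove k)) =
        (Fin.cast h (Fin.castAdd q i)).succAbove (Fin.cast h' (Fin.castAdd q k)) := by
      ext
      simp only [Fin.succAbove, Fin.lt_def, Fin.val_cast, Fin.val_castAdd, Fin.val_castSucc]
      split_ifs <;> simp
    rw [this, Fin.insertNth_apply_succAbove]

theorem insertNth_castAdd_natAdd {p q r : ℕ} {X : Type*} (h : p + 1 + q = r + 1) (h' : p + q = r)
    (i : Fin (p + 1)) (j : Fin q) (a : X) (u : Fin r → X) :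
    (Fin.cast h (Fin.castAdd q i)).insertNth (α := fun _ => X) a u
      (Fin.cast h (Fin.natAdd (p + 1) j)) = u (Fin.cast h' (Fin.natAdd p j)) := by
  have : Fin.cast h (Fin.natAdd (p + 1) j) =
      (Fin.cast h (Fin.castAdd q i)).succAbove (Fin.cast h' (Fin.natAdd p j)) := by
    ext
    simp only [Fin.succAbove, Fin.lt_def, Fin.val_cast, Fin.val_castAdd, Fin.val_castSucc,
      Fin.val_natAdd]
    have := i.2
    split_ifs
    · omega
    · simp; omega
  rw [this, Fin.insertNth_apply_succAbove]

theorem insertNth_natAdd_castAdd {p q r : ℕ} {X : Type*} (h : p + (q + 1) = r + 1) (h' : p + q = r)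
    (i : Fin (q + 1)) (j : Fin p) (a : X) (u : Fin r → X) :
    (Fin.cast h (Fin.natAdd p i)).insertNth (α := fun _ => X) a u
      (Fin.cast h (Fin.castAdd (q + 1) j)) = u (Fin.cast h' (Fin.castAdd q j)) := by
  have : Fin.cast h (Fin.castAdd (q + 1) j) =
      (Fin.cast h (Fin.natAdd p i)).succAbove (Fin.cast h' (Fin.castAdd q j)) := by
    ext
    simp only [Fin.succAbove, Fin.lt_def, Fin.val_cast, Fin.val_castAdd, Fin.val_castSucc,
      Fin.val_natAdd]
    have := j.2
    split_ifs
    · simp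
    · omega
  rw [this, Fin.insertNth_apply_succAbove]

theorem insertNth_natAdd_natAdd {p q r : ℕ} {X : Type*} (h : p + (q + 1) = r + 1) (h' : p + q = r)
    (i j : Fin (q + 1)) (a : X) (u : Fin r → X) :
    (Fin.cast h (Fin.natAdd p i)).insertNth (α := fun _ => X) a u
      (Fin.cast h (Fin.natAdd p j)) =
      i.insertNth (α := fun _ => X) a (fun k => u (Fin.cast h' (Fin.natAdd p k))) j := by
  induction j using Fin.succAboveCases i with
  | x => simp
  | p k =>
    rw [Fin.insertNth_apply_succAbove]
    have : Fin.cast h (Fin.natAdd p (i.succAbove k)) =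
        (Fin.cast h (Fin.natAdd p i)).succAbove (Fin.cast h' (Fin.natAdd p k)) := by
      ext
      simp only [Fin.succAbove, Fin.lt_def, Fin.val_cast, Fin.val_natAdd, Fin.val_castSucc]
      split_ifs <;> simp <;> omega
    rw [this, Fin.insertNth_apply_succAbove]

theorem apply_insertNth {n : ℕ} (α : V [⋀^Fin (n + 1)]→L[ℝ] ℝ) (i : Fin (n + 1)) (a : V)
    (u : Fin n → V) :
    α (i.insertNth (α := fun _ => V) a u) = (-1) ^ (i : ℕ) * interior a α u := by
  have := α.toAlternatingMap.map_insertNth i a u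
  rw [zsmul_eq_mul] at this
  push_cast at this
  exact this

/-- Insertion of a vector is an antiderivation of the wedge product. -/
theorem wedge_vecCons {p q r : ℕ} (α : V [⋀^Fin (p + 1)]→L[ℝ] ℝ) (β : V [⋀^Fin (q + 1)]→L[ℝ] ℝ)
    (h : p + 1 + (q + 1) = r + 1) (a : V) (w : Fin r → V) :
    wedge (r + 1) α β h (Matrix.vecCons a w) =
      wedge r (interior a α) β (by omega) w +
      (-1) ^ (p + 1) * wedge r α (interior a β) (by omega) w := by
  have hpos : ((p + 1).factorial * (q + 1).factorial : ℝ) ≠ 0 := by positivity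
  refine mul_left_cancel₀ hpos ?_
  refine (factorial_mul_wedge_apply h α β (Fin.cons a w)).trans ?_
  rw [sum_perm_fin_succ]
  simp only [sign_decomposeFin_mul_cycleRange, cons_decomposeFin_mul_cycleRange]
  have h1 := factorial_mul_wedge_apply (show p + (q + 1) = r by omega) (interior a α) β w
  have h2 := factorial_mul_wedge_apply (show p + 1 + q = r by omega) α (interior a β) w
  -- The slot of `a` lies either among those of α or among those of β; the two cases give the two
  -- terms of the antiderivation rule.
  rw [← (finCongr h).sum_comp, Fin.sum_univ_add]
  simp only [finCongr_apply, insertNth_castAdd_natAdd h (show p + (q + 1) = r by omega),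
    insertNth_natAdd_castAdd h (show p + 1 + q = r by omega),
    insertNth_castAdd_castAdd h (show p + (q + 1) = r by omega),
    insertNth_natAdd_natAdd h (show p + 1 + q = r by omega)]
  -- The sign of the cycle cancels the sign of moving `a` to the front of α, so all p + 1 slots
  -- contribute equally and turn p! into (p+1)!.
  have e1 : ∀ i : Fin (p + 1), ∑ e : Equiv.Perm (Fin r),
      (-1 : ℝ) ^ ((Fin.cast h (Fin.castAdd (q + 1) i)) : ℕ) * ((Equiv.Perm.sign e : ℤ) : ℝ) *
        (α (fun j => i.insertNth (α := fun _ => V) a (fun k =>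
          (w ∘ e) (Fin.cast (by omega) (Fin.castAdd (q + 1) k))) j) *
        β fun j => (w ∘ e) (Fin.cast (by omega) (Fin.natAdd p j))) =
      p.factorial * (q + 1).factorial * wedge r (interior a α) β (by omega) w := by
    intro i
    rw [h1]
    refine Finset.sum_congr rfl fun e _ => ?_
    have := apply_insertNth α i a fun k =>
          (w ∘ e) (Fin.cast (show p + (q + 1) = r by omega) (Fin.castAdd (q + 1) k))
    refine (congrArg (fun x => _ * (x * _)) this).trans ?_
    have hs : ((-1 : ℝ) ^ (i : ℕ)) * (-1) ^ (i : ℕ) = 1 := by rw [← mul_pow]; simp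
    simp only [Fin.val_cast, Fin.val_castAdd, Function.comp_apply]
    linear_combination (((Equiv.Perm.sign e : ℤ) : ℝ) * (interior a α (fun k =>
          w (e (Fin.cast (show p + (q + 1) = r by omega) (Fin.castAdd (q + 1) k)))) *
        β fun j => w (e (Fin.cast (by omega) (Fin.natAdd p j))))) * hs
  -- The slot now has number p + 1 + i, so after the same cancellation a factor (-1)^(p+1) survives.
  have e2 : ∀ i : Fin (q + 1), ∑ e : Equiv.Perm (Fin r),
      (-1 : ℝ) ^ ((Fin.cast h (Fin.natAdd (p + 1) i)) : ℕ) * ((Equiv.Perm.sign e : ℤ) : ℝ) *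
        (α (fun j => (w ∘ e) (Fin.cast (by omega) (Fin.castAdd q j))) *
        β (fun j => i.insertNth (α := fun _ => V) a (fun k =>
          (w ∘ e) (Fin.cast (by omega) (Fin.natAdd (p + 1) k))) j)) =
      (-1) ^ (p + 1) * ((p + 1).factorial * q.factorial *
        wedge r α (interior a β) (by omega) w) := by
    intro i
    rw [h2, Finset.mul_sum]
    refine Finset.sum_congr rfl fun e _ => ?_
    have := apply_insertNth β i a fun k =>
          (w ∘ e) (Fin.cast (show p + 1 + q = r by omega) (Fin.natAdd (p + 1) k))
    refine (congrArg (fun x => _ * (_ * x)) this).trans ?_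
    have hs : ((-1 : ℝ) ^ (i : ℕ)) * (-1) ^ (i : ℕ) = 1 := by rw [← mul_pow]; simp
    simp only [Fin.val_cast, Fin.val_natAdd, Function.comp_apply, pow_add _ (p + 1)]
    linear_combination ((-1) ^ (p + 1) * ((Equiv.Perm.sign e : ℤ) : ℝ) * (α (fun k =>
          w (e (Fin.cast (show p + 1 + q = r by omega) (Fin.castAdd q k)))) *
        interior a β fun j => w (e (Fin.cast (by omega) (Fin.natAdd (p + 1) j))))) * hs
  refine (congrArg₂ (· + ·) (Finset.sum_congr rfl fun i _ => e1 i)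
    (Finset.sum_congr rfl fun i _ => e2 i)).trans ?_
  simp only [Finset.sum_const, Finset.card_univ, Fintype.card_fin, nsmul_eq_mul,
    Nat.factorial_succ]
  push_cast
  ring

/-- All q! permutations give the same term, because the sign of σ meets the sign produced by β. With
`wedge_zero_right` this ends the recursion of `wedge_vecCons`, which needs positive degrees. -/
theorem wedge_zero_left {q : ℕ} (α : V [⋀^Fin 0]→L[ℝ] ℝ) (β : V [⋀^Fin q]→L[ℝ] ℝ) (h : 0 + q = q)
    (v : Fin q → V) : wedge q α β h v = α ![] * β v := by
  have := factorial_mul_wedge_apply h α β v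
  have e : ∀ σ : Equiv.Perm (Fin q), ((Equiv.Perm.sign σ : ℤ) : ℝ) *
        (α (fun i => v (σ (Fin.cast h (Fin.castAdd q i)))) *
          β (fun i => v (σ (Fin.cast h (Fin.natAdd 0 i))))) = α ![] * β v := by
    intro σ
    have h1 : α (fun i => v (σ (Fin.cast h (Fin.castAdd q i)))) = α ![] := by
      congr 1; ext i; exact i.elim0
    have h2 : β (fun i => v (σ (Fin.cast h (Fin.natAdd 0 i)))) =
        ((Equiv.Perm.sign σ : ℤ) : ℝ) * β v := by
      have h3 := β.toAlternatingMap.map_perm v σ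
      rw [Units.smul_def, zsmul_eq_mul] at h3
      rw [show (fun i => v (σ (Fin.cast h (Fin.natAdd 0 i)))) = v ∘ σ from ?_]
      · exact h3
      · ext i; congr 2; ext; simp
    have h4 : ((Equiv.Perm.sign σ : ℤ) : ℝ) * ((Equiv.Perm.sign σ : ℤ) : ℝ) = 1 := by
      rcases Int.units_eq_one_or (Equiv.Perm.sign σ) with h | h <;> simp [h]
    rw [h1, h2]
    linear_combination (α ![] * β v) * h4
  rw [Finset.sum_congr rfl fun σ _ => e σ] at this
  simp only [Finset.sum_const, Finset.card_univ, Fintype.card_perm, Fintype.card_fin,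
    nsmul_eq_mul, Nat.factorial_zero, Nat.cast_one, one_mul] at this
  exact mul_left_cancel₀ (by positivity) this

theorem wedge_zero_right {p : ℕ} (α : V [⋀^Fin p]→L[ℝ] ℝ) (β : V [⋀^Fin 0]→L[ℝ] ℝ) (h : p + 0 = p)
    (v : Fin p → V) : wedge p α β h v = α v * β ![] := by
  have := factorial_mul_wedge_apply h α β v
  have e : ∀ σ : Equiv.Perm (Fin p), ((Equiv.Perm.sign σ : ℤ) : ℝ) *
        (α (fun i => v (σ (Fin.cast h (Fin.castAdd 0 i)))) *
          β (fun i => v (σ (Fin.cast h (Fin.natAdd p i))))) = α v * β ![] := by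
    intro σ
    have h1 : β (fun i => v (σ (Fin.cast h (Fin.natAdd p i)))) = β ![] := by
      congr 1; ext i; exact i.elim0
    have h2 : α (fun i => v (σ (Fin.cast h (Fin.castAdd 0 i)))) =
        ((Equiv.Perm.sign σ : ℤ) : ℝ) * α v := by
      have h3 := α.toAlternatingMap.map_perm v σ
      rw [Units.smul_def, zsmul_eq_mul] at h3
      exact h3
    have h4 : ((Equiv.Perm.sign σ : ℤ) : ℝ) * ((Equiv.Perm.sign σ : ℤ) : ℝ) = 1 := by
      rcases Int.units_eq_one_or (Equiv.Perm.sign σ) with h | h <;> simp [h]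
    rw [h1, h2]
    linear_combination (α v * β ![]) * h4
  rw [Finset.sum_congr rfl fun σ _ => e σ] at this
  simp only [Finset.sum_const, Finset.card_univ, Fintype.card_perm, Fintype.card_fin,
    nsmul_eq_mul, Nat.factorial_zero, Nat.cast_one, mul_one] at this
  exact mul_left_cancel₀ (by positivity) this

/-- Iterating `wedge_vecCons` down to degree zero yields the shuffle expansions below. They are
stated on literal vectors because all later identities are checked on literal components. -/
theorem wedge_one_one_apply (α β : V [⋀^Fin 1]→L[ℝ] ℝ) (h)
    (a b : V) : wedge 2 α β h ![a, b] =
      α ![a] * β ![b] - α ![b] * β ![a] := by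
  simp only [wedge_vecCons, wedge_zero_left, wedge_zero_right, interior_apply]
  ring

theorem wedge_one_two_apply (α : V [⋀^Fin 1]→L[ℝ] ℝ) (β : V [⋀^Fin 2]→L[ℝ] ℝ) (h)
    (a b c : V) : wedge 3 α β h ![a, b, c] =
      α ![a] * β ![b, c] - α ![b] * β ![a, c] + α ![c] * β ![a, b] := by
  simp only [wedge_vecCons, wedge_zero_left, wedge_zero_right, interior_apply]
  ring

theorem wedge_one_three_apply (α : V [⋀^Fin 1]→L[ℝ] ℝ) (β : V [⋀^Fin 3]→L[ℝ] ℝ) (h)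
    (a b c d : V) : wedge 4 α β h ![a, b, c, d] =
      α ![a] * β ![b, c, d] - α ![b] * β ![a, c, d] + α ![c] * β ![a, b, d]
       - α ![d] * β ![a, b, c] := by
  simp only [wedge_vecCons, wedge_zero_left, wedge_zero_right, interior_apply]
  ring

theorem wedge_one_four_apply (α : V [⋀^Fin 1]→L[ℝ] ℝ) (β : V [⋀^Fin 4]→L[ℝ] ℝ) (h)
    (a b c d e : V) : wedge 5 α β h ![a, b, c, d, e] =
      α ![a] * β ![b, c, d, e] - α ![b] * β ![a, c, d, e] + α ![c] * β ![a, b, d, e]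
       - α ![d] * β ![a, b, c, e] + α ![e] * β ![a, b, c, d] := by
  simp only [wedge_vecCons, wedge_zero_left, wedge_zero_right, interior_apply]
  ring

theorem wedge_two_one_apply (α : V [⋀^Fin 2]→L[ℝ] ℝ) (β : V [⋀^Fin 1]→L[ℝ] ℝ) (h)
    (a b c : V) : wedge 3 α β h ![a, b, c] =
      α ![a, b] * β ![c] - α ![a, c] * β ![b] + α ![b, c] * β ![a] := by
  simp only [wedge_vecCons, wedge_zero_left, wedge_zero_right, interior_apply]
  ring

theorem wedge_two_two_apply (α β : V [⋀^Fin 2]→L[ℝ] ℝ) (h)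
    (a b c d : V) : wedge 4 α β h ![a, b, c, d] =
      α ![a, b] * β ![c, d] - α ![a, c] * β ![b, d] + α ![a, d] * β ![b, c]
       + α ![b, c] * β ![a, d] - α ![b, d] * β ![a, c] + α ![c, d] * β ![a, b] := by
  simp only [wedge_vecCons, wedge_zero_left, wedge_zero_right, interior_apply]
  ring

theorem wedge_two_three_apply (α : V [⋀^Fin 2]→L[ℝ] ℝ) (β : V [⋀^Fin 3]→L[ℝ] ℝ) (h)
    (a b c d e : V) : wedge 5 α β h ![a, b, c, d, e] =
      α ![a, b] * β ![c, d, e] - α ![a, c] * β ![b, d, e] + α ![a, d] * β ![b, c, e]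
       - α ![a, e] * β ![b, c, d] + α ![b, c] * β ![a, d, e] - α ![b, d] * β ![a, c, e]
       + α ![b, e] * β ![a, c, d] + α ![c, d] * β ![a, b, e] - α ![c, e] * β ![a, b, d]
       + α ![d, e] * β ![a, b, c] := by
  simp only [wedge_vecCons, wedge_zero_left, wedge_zero_right, interior_apply]
  ring

theorem wedge_three_one_apply (α : V [⋀^Fin 3]→L[ℝ] ℝ) (β : V [⋀^Fin 1]→L[ℝ] ℝ) (h)
    (a b c d : V) : wedge 4 α β h ![a, b, c, d] =
      α ![a, b, c] * β ![d] - α ![a, b, d] * β ![c] + α ![a, c, d] * β ![b]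
       - α ![b, c, d] * β ![a] := by
  simp only [wedge_vecCons, wedge_zero_left, wedge_zero_right, interior_apply]
  ring

theorem wedge_three_two_apply (α : V [⋀^Fin 3]→L[ℝ] ℝ) (β : V [⋀^Fin 2]→L[ℝ] ℝ) (h)
    (a b c d e : V) : wedge 5 α β h ![a, b, c, d, e] =
      α ![a, b, c] * β ![d, e] - α ![a, b, d] * β ![c, e] + α ![a, b, e] * β ![c, d]
       + α ![a, c, d] * β ![b, e] - α ![a, c, e] * β ![b, d] + α ![a, d, e] * β ![b, c]
       - α ![b, c, d] * β ![a, e] + α ![b, c, e] * β ![a, d] - α ![b, d, e] * β ![a, c]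
       + α ![c, d, e] * β ![a, b] := by
  simp only [wedge_vecCons, wedge_zero_left, wedge_zero_right, interior_apply]
  ring

theorem wedge_four_one_apply (α : V [⋀^Fin 4]→L[ℝ] ℝ) (β : V [⋀^Fin 1]→L[ℝ] ℝ) (h)
    (a b c d e : V) : wedge 5 α β h ![a, b, c, d, e] =
      α ![a, b, c, d] * β ![e] - α ![a, b, c, e] * β ![d] + α ![a, b, d, e] * β ![c]
       - α ![a, c, d, e] * β ![b] + α ![b, c, d, e] * β ![a] := by
  simp only [wedge_vecCons, wedge_zero_left, wedge_zero_right, interior_apply]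
  ring

theorem wedge_two_four_apply (α : V [⋀^Fin 2]→L[ℝ] ℝ) (β : V [⋀^Fin 4]→L[ℝ] ℝ) (h)
    (a b c d e f : V) : wedge 6 α β h ![a, b, c, d, e, f] =
      α ![a, b] * β ![c, d, e, f] - α ![a, c] * β ![b, d, e, f] + α ![a, d] * β ![b, c, e, f]
       - α ![a, e] * β ![b, c, d, f] + α ![a, f] * β ![b, c, d, e] + α ![b, c] * β ![a, d, e, f]
       - α ![b, d] * β ![a, c, e, f] + α ![b, e] * β ![a, c, d, f] - α ![b, f] * β ![a, c, d, e]
       + α ![c, d] * β ![a, b, e, f] - α ![c, e] * β ![a, b, d, f] + α ![c, f] * β ![a, b, d, e]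
       + α ![d, e] * β ![a, b, c, f] - α ![d, f] * β ![a, b, c, e] + α ![e, f] * β ![a, b, c, d] :=
         by
  simp only [wedge_vecCons, wedge_zero_left, wedge_zero_right, interior_apply]
  ring

theorem wedge_four_two_apply (α : V [⋀^Fin 4]→L[ℝ] ℝ) (β : V [⋀^Fin 2]→L[ℝ] ℝ) (h)
    (a b c d e f : V) : wedge 6 α β h ![a, b, c, d, e, f] =
      α ![a, b, c, d] * β ![e, f] - α ![a, b, c, e] * β ![d, f] + α ![a, b, c, f] * β ![d, e]
       + α ![a, b, d, e] * β ![c, f] - α ![a, b, d, f] * β ![c, e] + α ![a, b, e, f] * β ![c, d]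
       - α ![a, c, d, e] * β ![b, f] + α ![a, c, d, f] * β ![b, e] - α ![a, c, e, f] * β ![b, d]
       + α ![a, d, e, f] * β ![b, c] + α ![b, c, d, e] * β ![a, f] - α ![b, c, d, f] * β ![a, e]
       + α ![b, c, e, f] * β ![a, d] - α ![b, d, e, f] * β ![a, c] + α ![c, d, e, f] * β ![a, b] :=
         by
  simp only [wedge_vecCons, wedge_zero_left, wedge_zero_right, interior_apply]
  ring

theorem wedge_three_three_apply (α β : V [⋀^Fin 3]→L[ℝ] ℝ) (h)
    (a b c d e f : V) : wedge 6 α β h ![a, b, c, d, e, f] =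
      α ![a, b, c] * β ![d, e, f] - α ![a, b, d] * β ![c, e, f] + α ![a, b, e] * β ![c, d, f]
       - α ![a, b, f] * β ![c, d, e] + α ![a, c, d] * β ![b, e, f] - α ![a, c, e] * β ![b, d, f]
       + α ![a, c, f] * β ![b, d, e] + α ![a, d, e] * β ![b, c, f] - α ![a, d, f] * β ![b, c, e]
       + α ![a, e, f] * β ![b, c, d] - α ![b, c, d] * β ![a, e, f] + α ![b, c, e] * β ![a, d, f]
       - α ![b, c, f] * β ![a, d, e] - α ![b, d, e] * β ![a, c, f] + α ![b, d, f] * β ![a, c, e]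
       - α ![b, e, f] * β ![a, c, d] + α ![c, d, e] * β ![a, b, f] - α ![c, d, f] * β ![a, b, e]
       + α ![c, e, f] * β ![a, b, d] - α ![d, e, f] * β ![a, b, c] := by
  simp only [wedge_vecCons, wedge_zero_left, wedge_zero_right, interior_apply]
  ring

theorem wedge_three_four_apply (α : V [⋀^Fin 3]→L[ℝ] ℝ) (β : V [⋀^Fin 4]→L[ℝ] ℝ) (h)
    (a b c d e f g : V) : wedge 7 α β h ![a, b, c, d, e, f, g] =
      α ![a, b, c] * β ![d, e, f, g] - α ![a, b, d] * β ![c, e, f, g]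
       + α ![a, b, e] * β ![c, d, f, g] - α ![a, b, f] * β ![c, d, e, g]
       + α ![a, b, g] * β ![c, d, e, f] + α ![a, c, d] * β ![b, e, f, g]
       - α ![a, c, e] * β ![b, d, f, g] + α ![a, c, f] * β ![b, d, e, g]
       - α ![a, c, g] * β ![b, d, e, f] + α ![a, d, e] * β ![b, c, f, g]
       - α ![a, d, f] * β ![b, c, e, g] + α ![a, d, g] * β ![b, c, e, f]
       + α ![a, e, f] * β ![b, c, d, g] - α ![a, e, g] * β ![b, c, d, f]
       + α ![a, f, g] * β ![b, c, d, e] - α ![b, c, d] * β ![a, e, f, g]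
       + α ![b, c, e] * β ![a, d, f, g] - α ![b, c, f] * β ![a, d, e, g]
       + α ![b, c, g] * β ![a, d, e, f] - α ![b, d, e] * β ![a, c, f, g]
       + α ![b, d, f] * β ![a, c, e, g] - α ![b, d, g] * β ![a, c, e, f]
       - α ![b, e, f] * β ![a, c, d, g] + α ![b, e, g] * β ![a, c, d, f]
       - α ![b, f, g] * β ![a, c, d, e] + α ![c, d, e] * β ![a, b, f, g]
       - α ![c, d, f] * β ![a, b, e, g] + α ![c, d, g] * β ![a, b, e, f]
       + α ![c, e, f] * β ![a, b, d, g] - α ![c, e, g] * β ![a, b, d, f]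
       + α ![c, f, g] * β ![a, b, d, e] - α ![d, e, f] * β ![a, b, c, g]
       + α ![d, e, g] * β ![a, b, c, f] - α ![d, f, g] * β ![a, b, c, e]
       + α ![e, f, g] * β ![a, b, c, d] := by
  simp only [wedge_vecCons, wedge_zero_left, wedge_zero_right, interior_apply]
  ring

end ExtAlg

namespace ExtAlg

variable {V : Type*} [AddCommGroup V] [Module ℝ V] [TopologicalSpace V]

/-! ### Components of forms in a basis -/

/-- Two forms are equal if they have the same components in a basis. -/
theorem ext_strictMono {n p : ℕ} (b : Basis (Fin n) ℝ V) {α β : V [⋀^Fin p]→L[ℝ] ℝ}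
    (h : ∀ s : Fin p → Fin n, StrictMono s → α (b ∘ s) = β (b ∘ s)) : α = β := by
  apply ContinuousAlternatingMap.toAlternatingMap_injective
  refine Basis.ext_alternating b fun s hs => ?_
  have hmono : StrictMono (s ∘ Tuple.sort s) :=
    (Tuple.monotone_sort s).strictMono_of_injective (hs.comp (Tuple.sort s).injective)
  have e := h _ hmono
  have h1 := α.toAlternatingMap.map_perm (b ∘ s) (Tuple.sort s)
  have h2 := β.toAlternatingMap.map_perm (b ∘ s) (Tuple.sort s)
  have h3 : (Equiv.Perm.sign (Tuple.sort s)) • α.toAlternatingMap (b ∘ s) =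
      (Equiv.Perm.sign (Tuple.sort s)) • β.toAlternatingMap (b ∘ s) := by
    rw [← h1, ← h2]
    exact e
  exact smul_left_cancel _ h3

/-- The sign of a sequence of distinct indices, by counting inversions. -/
def inversionSign {n : ℕ} (s : Fin n → Fin n) : ℤ :=
  ∏ j, ∏ i ∈ Finset.Iio j, (if s i < s j then 1 else -1)

/-- For an explicit index tuple the inversion product is evaluated by `decide`; all signs in the
Hodge tables are obtained this way. -/
theorem inversionSign_eq {n : ℕ} (σ : Equiv.Perm (Fin n)) :
    inversionSign σ = (Equiv.Perm.sign σ : ℤ) := by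
  rw [Equiv.Perm.sign_eq_prod_prod_Iio, inversionSign]
  push_cast
  refine Finset.prod_congr rfl fun j _ => Finset.prod_congr rfl fun i _ => ?_
  split_ifs <;> simp

theorem hodge_apply {n p q : ℕ} (b : Fin n → V) (vol : V [⋀^Fin n]→L[ℝ] ℝ) (h : p + q = n)
    (γ : V [⋀^Fin p]→L[ℝ] ℝ) (w : Fin q → V) :
    hodge b vol q γ h w = ((p.factorial : ℝ)⁻¹) * ∑ i : Fin p → Fin n,
      γ (b ∘ i) * vol (fun k => Fin.append (b ∘ i) w (Fin.cast h.symm k)) := by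
  simp only [hodge, ContinuousAlternatingMap.smul_apply, ContinuousAlternatingMap.sum_apply,
    smul_eq_mul]
  rfl

theorem append_comp {p q : ℕ} {X Y : Type*} (b : X → Y) (i : Fin p → X) (j : Fin q → X) :
    Fin.append (b ∘ i) (b ∘ j) = b ∘ Fin.append i j := by
  ext k
  cases k using Fin.addCases <;> simp

/-- A component of the Hodge star is, up to sign, the complementary component. -/
theorem hodge_apply_comp {n p q : ℕ} (b : Fin n → V) (vol : V [⋀^Fin n]→L[ℝ] ℝ) (h : p + q = n)
    (γ : V [⋀^Fin p]→L[ℝ] ℝ) (i : Fin p → Fin n) (j : Fin q → Fin n)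
    (hij : Function.Injective (Fin.append i j)) :
    hodge b vol q γ h (b ∘ j) =
      vol (fun k => b (Fin.append i j (Fin.cast h.symm k))) * γ (b ∘ i) := by
  subst h
  rw [hodge_apply]
  simp only [append_comp, Fin.cast_eq_self, Function.comp_apply]
  have hi : Function.Injective i := fun x y hxy => by
    have := @hij (Fin.castAdd q x) (Fin.castAdd q y) (by simpa using hxy)
    simpa using this
  -- Only reorderings of i contribute: if k repeats an index or meets j, then `vol` vanishes. The p!
  -- reorderings give equal terms, since the signs from γ and `vol` cancel, and p! is removed by the
  -- normalisation of the star.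
  have hsum : ∑ k : Fin p → Fin (p + q), γ (b ∘ k) * vol (fun l => b (Fin.append k j l)) =
      ∑ τ : Equiv.Perm (Fin p), vol (fun k => b (Fin.append i j k)) * γ (b ∘ i) := by
    symm
    refine Finset.sum_of_injOn (fun τ : Equiv.Perm (Fin p) => i ∘ τ) ?_ (by simp) ?_ ?_
    · intro τ _ τ' _ hτ
      ext x
      have := hi (congrFun hτ x)
      rw [this]
    · intro k _ hk
      suffices hnot : ¬ Function.Injective (Fin.append k j) by
        rw [Function.not_injective_iff] at hnot
        obtain ⟨x, y, hxy, hne⟩ := hnot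
        have : vol (fun l => b (Fin.append k j l)) = 0 :=
          vol.map_eq_zero_of_eq _ (by simp only [hxy]) hne
        rw [this, mul_zero]
      intro hinj
      apply hk
      have hsurj : Function.Surjective (Fin.append i j) := Finite.surjective_of_injective hij
      have hpre : ∀ x : Fin p, ∃ y : Fin p, i y = k x := by
        intro x
        obtain ⟨z, hz⟩ := hsurj (k x)
        cases z using Fin.addCases with
        | left y => exact ⟨y, by simpa using hz⟩
        | right y =>
          exfalso
          have := @hinj (Fin.castAdd q x) (Fin.natAdd p y) (by simpa using hz.symm)
          have := congrArg Fin.val this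
          simp at this
          omega
      choose τ hτ using hpre
      have hτi : Function.Injective τ := fun x y hxy => by
        have h1 : k x = k y := by rw [← hτ, ← hτ, hxy]
        have := @hinj (Fin.castAdd q x) (Fin.castAdd q y) (by simpa using h1)
        simpa using this
      refine ⟨Equiv.ofBijective τ ⟨hτi, Finite.surjective_of_injective hτi⟩, by simp, funext hτ⟩
    · intro τ _
      have h1 := γ.toAlternatingMap.map_perm (b ∘ i) τ
      -- σ acts as τ on the first p slots and fixes the last q, so it has the sign of τ.
      let σ : Equiv.Perm (Fin (p + q)) :=
        (Equiv.permCongr finSumFinEquiv) (Equiv.Perm.sumCongr τ 1)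
      have h2 := vol.toAlternatingMap.map_perm (fun k => b (Fin.append i j k)) σ
      have h3 : (fun k => b (Fin.append i j k)) ∘ σ = fun l => b (Fin.append (i ∘ τ) j l) := by
        ext l
        simp only [Function.comp_apply]
        congr 1
        cases l using Fin.addCases <;> simp [σ, Equiv.permCongr_apply]
      have h4 : Equiv.Perm.sign σ = Equiv.Perm.sign τ := by simp [σ]
      rw [h3, h4, Units.smul_def, zsmul_eq_mul] at h2
      rw [Units.smul_def, zsmul_eq_mul] at h1
      have h5 : ((Equiv.Perm.sign τ : ℤ) : ℝ) * ((Equiv.Perm.sign τ : ℤ) : ℝ) = 1 := by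
        rcases Int.units_eq_one_or (Equiv.Perm.sign τ) with h | h <;> simp [h]
      change _ = γ.toAlternatingMap ((b ∘ i) ∘ τ) *
        vol.toAlternatingMap (fun l => b (Fin.append (i ∘ τ) j l))
      rw [h1, h2]
      change vol (fun k => b (Fin.append i j k)) * γ (b ∘ i) =
        _ * γ (b ∘ i) * (_ * vol (fun k => b (Fin.append i j k)))
      linear_combination -(vol (fun k => b (Fin.append i j k)) * γ (b ∘ i)) * h5
  rw [hsum]
  simp only [Finset.sum_const, Finset.card_univ, Fintype.card_perm, Fintype.card_fin, nsmul_eq_mul]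
  field_simp

section Frame

variable [IsTopologicalAddGroup V] [ContinuousSMul ℝ V] [T2Space V]

theorem frameVol_apply_comp {n : ℕ} (b : Basis (Fin n) ℝ V) (s : Fin n → Fin n)
    (hs : Function.Injective s) : frameVol b (fun k => b (s k)) = inversionSign s := by
  let σ : Equiv.Perm (Fin n) := Equiv.ofBijective s ⟨hs, Finite.surjective_of_injective hs⟩
  have h := b.det.map_perm b σ
  rw [b.det_self, Units.smul_def, zsmul_eq_mul, mul_one, ← inversionSign_eq] at h
  exact h

/-- Components of the Hodge star in an orthonormal positive basis. -/
theorem hodge_frameVol_apply {n p q : ℕ} (b : Basis (Fin n) ℝ V) (h : p + q = n)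
    (γ : V [⋀^Fin p]→L[ℝ] ℝ) (i : Fin p → Fin n) (j : Fin q → Fin n) (c : ℤ)
    (hij : Function.Injective (Fin.append i j))
    (hc : inversionSign (fun k => Fin.append i j (Fin.cast h.symm k)) = c) :
    hodge b (frameVol b) q γ h (b ∘ j) = c * γ (b ∘ i) := by
  rw [hodge_apply_comp b (frameVol b) h γ i j hij, frameVol_apply_comp, hc]
  exact hij.comp (Fin.cast_injective _)

end Frame

/-- Change of frame in a sum of products of components. -/
theorem sum_mul_apply_comp {W ι κ : Type*} [AddCommGroup W] [Module ℝ W] [Fintype ι] [Fintype κ]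
    {p : ℕ} (F G : MultilinearMap ℝ (fun _ : Fin p => W) ℝ) (A : κ → ι → ℝ) (c : κ → W) (b : ι → W)
    (hb : ∀ i, b i = ∑ k, A k i • c k) :
    ∑ i : Fin p → ι, F (b ∘ i) * G (b ∘ i) =
      ∑ k : Fin p → κ, ∑ l : Fin p → κ, (∏ a, ∑ i, A (k a) i * A (l a) i) *
        (F (c ∘ k) * G (c ∘ l)) := by
  classical
  have expand : ∀ (H : MultilinearMap ℝ (fun _ : Fin p => W) ℝ) (i : Fin p → ι),
      H (b ∘ i) = ∑ k : Fin p → κ, (∏ a, A (k a) (i a)) * H (c ∘ k) := by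
    intro H i
    have : b ∘ i = fun a => ∑ k, A k (i a) • c k := by ext a; simp [hb]
    rw [this, H.map_sum]
    refine Finset.sum_congr rfl fun k _ => ?_
    rw [H.map_smul_univ, smul_eq_mul]
    rfl
  simp_rw [expand, Finset.sum_mul_sum]
  rw [Finset.sum_comm]
  refine Finset.sum_congr rfl fun k _ => ?_
  rw [Finset.sum_comm]
  refine Finset.sum_congr rfl fun l _ => ?_
  -- The product over slots of the entries of A Aᵀ expands into the sum over all i of the products
  -- of entries of A.
  rw [Finset.prod_univ_sum, Fintype.piFinset_univ, Finset.sum_mul]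
  refine Finset.sum_congr rfl fun i _ => ?_
  rw [Finset.prod_mul_distrib]
  ring

theorem update_append_left {p q : ℕ} {X : Type*} [DecidableEq (Fin p)] (u : Fin p → X)
    (w : Fin q → X) (i : Fin p) (z : X) :
    Fin.append (Function.update u i z) w =
      Function.update (Fin.append u w) (Fin.castAdd q i) z := by
  ext k
  cases k using Fin.addCases with
  | left j =>
    by_cases hj : j = i
    · subst hj; simp
    · rw [Fin.append_left, Function.update_of_ne hj, Function.update_of_ne, Fin.append_left]
      simpa using hj
  | right j =>
    rw [Fin.append_right, Function.update_of_ne, Fin.append_right]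
    intro h
    have := congrArg Fin.val h
    simp at this
    omega

/-- The Hodge star in terms of an arbitrary frame `c`, in which `∑ i, A k i * A l i` is the inverse
of the matrix of the metric. -/
theorem hodge_change_frame {κ : Type*} [Fintype κ] {n p q : ℕ} (h : p + q = n)
    (vol : V [⋀^Fin n]→L[ℝ] ℝ) (γ : V [⋀^Fin p]→L[ℝ] ℝ) (A : κ → Fin n → ℝ) (c : κ → V)
    (b : Fin n → V) (hb : ∀ i, b i = ∑ k, A k i • c k) (w : Fin q → V) :
    hodge b vol q γ h w = ((p.factorial : ℝ)⁻¹) * ∑ k : Fin p → κ, ∑ l : Fin p → κ,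
      (∏ a, ∑ i, A (k a) i * A (l a) i) *
        (γ (c ∘ k) * vol (fun m => Fin.append (c ∘ l) w (Fin.cast h.symm m))) := by
  subst h
  rw [hodge_apply]
  let G : MultilinearMap ℝ (fun _ : Fin p => V) ℝ :=
    { toFun := fun u => vol (Fin.append u w)
      map_update_add' := by
        intro _ u i x y
        simp only [update_append_left, vol.map_update_add]
      map_update_smul' := by
        intro _ u i r x
        simp only [update_append_left, vol.map_update_smul] }
  have := sum_mul_apply_comp γ.toMultilinearMap G A c b hb
  exact congrArg (fun x => ((p.factorial : ℝ)⁻¹) * x) this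

/-- The Hodge star does not depend on the orthonormal basis. -/
theorem hodge_eq_of_orthogonal {n p q : ℕ} (h : p + q = n) (vol : V [⋀^Fin n]→L[ℝ] ℝ)
    (γ : V [⋀^Fin p]→L[ℝ] ℝ) (A : Matrix (Fin n) (Fin n) ℝ) (hA : A * A.transpose = 1)
    (b c : Fin n → V) (hb : ∀ i, b i = ∑ k, A k i • c k) :
    hodge b vol q γ h = hodge c vol q γ h := by
  ext w
  have hA' : ∀ k l, ∑ i, A k i * A l i = (1 : Matrix (Fin n) (Fin n) ℝ) k l := by
    intro k l
    rw [← hA]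
    rfl
  have h1 : ∀ k l, ∑ i, (1 : Matrix (Fin n) (Fin n) ℝ) k i * (1 : Matrix (Fin n) (Fin n) ℝ) l i =
      (1 : Matrix (Fin n) (Fin n) ℝ) k l := by
    intro k l
    simp [Matrix.one_apply]
  -- Expressed in the frame c, the star sees the orthonormal frame only through A Aᵀ, which is the
  -- identity for both frames.
  rw [hodge_change_frame h vol γ A c b hb,
    hodge_change_frame h vol γ (1 : Matrix (Fin n) (Fin n) ℝ) c c (by simp [Matrix.one_apply])]
  simp only [hA', h1]

/-- The Hodge star commutes with pullback by an isometry. -/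
theorem hodge_compContinuousLinearMap {W : Type*} [AddCommGroup W] [Module ℝ W]
    [TopologicalSpace W] {n p q : ℕ} (h : p + q = n) (T : W →L[ℝ] V) (b : Fin n → W)
    (vol : V [⋀^Fin n]→L[ℝ] ℝ) (γ : V [⋀^Fin p]→L[ℝ] ℝ) :
    (hodge (T ∘ b) vol q γ h).compContinuousLinearMap T =
      hodge b (vol.compContinuousLinearMap T) q (γ.compContinuousLinearMap T) h := by
  ext w
  rw [ContinuousAlternatingMap.compContinuousLinearMap_apply, hodge_apply, hodge_apply]
  congr 1
  refine Finset.sum_congr rfl fun i _ => ?_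
  rw [ContinuousAlternatingMap.compContinuousLinearMap_apply,
    ContinuousAlternatingMap.compContinuousLinearMap_apply]
  congr 2
  ext k
  simp only [Function.comp_apply]
  generalize Fin.cast h.symm k = k'
  cases k' using Fin.addCases <;> simp

/-- Each of the p summed frame vectors enters once through γ and once through `vol`, hence the
exponent 2p; the q free arguments are not rescaled. -/
theorem hodge_smul_frame {n p q : ℕ} (h : p + q = n) (b : Fin n → V) (r c : ℝ)
    (vol : V [⋀^Fin n]→L[ℝ] ℝ) (γ : V [⋀^Fin p]→L[ℝ] ℝ) :
    hodge (fun i => r • b i) (c • vol) q γ h = (c * r ^ (2 * p)) • hodge b vol q γ h := by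
  subst h
  ext w
  rw [ContinuousAlternatingMap.smul_apply, hodge_apply, hodge_apply, smul_eq_mul,
    mul_left_comm]
  congr 1
  rw [Finset.mul_sum]
  refine Finset.sum_congr rfl fun i _ => ?_
  have h1 : γ ((fun i => r • b i) ∘ i) = r ^ p * γ (b ∘ i) := by
    have := γ.toMultilinearMap.map_smul_univ (fun _ => r) (b ∘ i)
    simp only [Finset.prod_const, Finset.card_univ, Fintype.card_fin, smul_eq_mul] at this
    exact this
  have h2 : vol (Fin.append ((fun i => r • b i) ∘ i) w) = r ^ p * vol (Fin.append (b ∘ i) w) := by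
    have := vol.toMultilinearMap.map_smul_univ (Fin.append (fun _ : Fin p => r) fun _ : Fin q => 1)
      (Fin.append (b ∘ i) w)
    rw [Fin.prod_univ_add] at this
    simp only [Fin.append_left, Fin.append_right, Finset.prod_const, Finset.card_univ,
      Fintype.card_fin, one_pow, mul_one, smul_eq_mul] at this
    refine Eq.trans (congrArg vol (funext fun k => ?_)) this
    cases k using Fin.addCases <;> simp
  rw [h1]
  change _ * (c * vol (Fin.append ((fun i => r • b i) ∘ i) w)) = _ * (_ * vol (Fin.append (b ∘ i)
    w))
  rw [h2, pow_mul']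
  ring

end ExtAlg

namespace ExtAlg

variable {V : Type*} [AddCommGroup V] [Module ℝ V] [TopologicalSpace V]

/-! ### Explicit components in dimensions six and seven -/

theorem comp_vecCons {X Y : Type*} {n : ℕ} (f : X → Y) (a : X) (v : Fin n → X) :
    f ∘ Matrix.vecCons a v = Matrix.vecCons (f a) (f ∘ v) := by
  ext i
  cases i using Fin.cases <;> rfl

theorem comp_vecEmpty {X Y : Type*} (f : X → Y) : f ∘ ![] = ![] := by
  ext i
  exact i.elim0

theorem strictMono_two {n : ℕ} {s : Fin 2 → Fin n} (hs : StrictMono s) :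
    s = ![s 0, s 1] ∧ s 0 < s 1 :=
  ⟨by ext i; fin_cases i <;> rfl, hs (by decide)⟩

theorem strictMono_three {n : ℕ} {s : Fin 3 → Fin n} (hs : StrictMono s) :
    s = ![s 0, s 1, s 2] ∧ s 0 < s 1 ∧ s 1 < s 2 :=
  ⟨by ext i; fin_cases i <;> rfl, hs (by decide), hs (by decide)⟩

theorem strictMono_four {n : ℕ} {s : Fin 4 → Fin n} (hs : StrictMono s) :
    s = ![s 0, s 1, s 2, s 3] ∧ s 0 < s 1 ∧ s 1 < s 2 ∧ s 2 < s 3 :=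
  ⟨by ext i; fin_cases i <;> rfl, hs (by decide), hs (by decide), hs (by decide)⟩

theorem strictMono_five {n : ℕ} {s : Fin 5 → Fin n} (hs : StrictMono s) :
    s = ![s 0, s 1, s 2, s 3, s 4] ∧ s 0 < s 1 ∧ s 1 < s 2 ∧ s 2 < s 3 ∧ s 3 < s 4 :=
  ⟨by ext i; fin_cases i <;> rfl, hs (by decide), hs (by decide), hs (by decide), hs (by decide)⟩

theorem strictMono_six {n : ℕ} {s : Fin 6 → Fin n} (hs : StrictMono s) :
    s = ![s 0, s 1, s 2, s 3, s 4, s 5] ∧ s 0 < s 1 ∧ s 1 < s 2 ∧ s 2 < s 3 ∧ s 3 < s 4 ∧ s 4 < s 5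
      :=
  ⟨by ext i; fin_cases i <;> rfl, hs (by decide), hs (by decide), hs (by decide), hs (by decide),
    hs (by decide)⟩

/-- The enumerations of this kind turn a statement over increasing indices into literal cases. The
cases come in lexicographic order, the order in which later proofs supply them. -/
theorem forall_lt_two {P : Fin 7 → Fin 7 → Prop}
    (_ : P 0 1) (_ : P 0 2) (_ : P 0 3) (_ : P 0 4) (_ : P 0 5) (_ : P 0 6) (_ : P 1 2)
    (_ : P 1 3) (_ : P 1 4) (_ : P 1 5) (_ : P 1 6) (_ : P 2 3) (_ : P 2 4) (_ : P 2 5)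
    (_ : P 2 6) (_ : P 3 4) (_ : P 3 5) (_ : P 3 6) (_ : P 4 5) (_ : P 4 6) (_ : P 5 6) :
    ∀ i j, i < j → P i j := by
  intro i j h1
  fin_cases i <;> (fin_cases j <;> first | assumption | exact absurd h1 (by decide))

theorem ext_seven_two (b : Basis (Fin 7) ℝ V) {α β : V [⋀^Fin 2]→L[ℝ] ℝ}
    (h : ∀ i j, i < j → α ![b i, b j] = β ![b i, b j]) :
    α = β := by
  refine ext_strictMono b fun s hs => ?_
  obtain ⟨e, hlt⟩ := strictMono_two hs
  rw [e]
  simp only [comp_vecCons, comp_vecEmpty]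
  exact h _ _ hlt

theorem forall_lt_three {P : Fin 7 → Fin 7 → Fin 7 → Prop}
    (_ : P 0 1 2) (_ : P 0 1 3) (_ : P 0 1 4) (_ : P 0 1 5) (_ : P 0 1 6) (_ : P 0 2 3)
    (_ : P 0 2 4) (_ : P 0 2 5) (_ : P 0 2 6) (_ : P 0 3 4) (_ : P 0 3 5) (_ : P 0 3 6)
    (_ : P 0 4 5) (_ : P 0 4 6) (_ : P 0 5 6) (_ : P 1 2 3) (_ : P 1 2 4) (_ : P 1 2 5)
    (_ : P 1 2 6) (_ : P 1 3 4) (_ : P 1 3 5) (_ : P 1 3 6) (_ : P 1 4 5) (_ : P 1 4 6)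
    (_ : P 1 5 6) (_ : P 2 3 4) (_ : P 2 3 5) (_ : P 2 3 6) (_ : P 2 4 5) (_ : P 2 4 6)
    (_ : P 2 5 6) (_ : P 3 4 5) (_ : P 3 4 6) (_ : P 3 5 6) (_ : P 4 5 6) :
    ∀ i j k, i < j → j < k → P i j k := by
  intro i j k h1 h2
  fin_cases i <;>
    (fin_cases j <;> first | exact absurd h1 (by decide) |
    (fin_cases k <;> first | assumption | exact absurd h2 (by decide)))

theorem ext_seven_three (b : Basis (Fin 7) ℝ V) {α β : V [⋀^Fin 3]→L[ℝ] ℝ}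
    (h : ∀ i j k, i < j → j < k → α ![b i, b j, b k] = β ![b i, b j, b k]) :
    α = β := by
  refine ext_strictMono b fun s hs => ?_
  obtain ⟨e, hlt⟩ := strictMono_three hs
  rw [e]
  simp only [comp_vecCons, comp_vecEmpty]
  exact h _ _ _ hlt.1 hlt.2

theorem forall_lt_four {P : Fin 7 → Fin 7 → Fin 7 → Fin 7 → Prop}
    (_ : P 0 1 2 3) (_ : P 0 1 2 4) (_ : P 0 1 2 5) (_ : P 0 1 2 6) (_ : P 0 1 3 4)
    (_ : P 0 1 3 5) (_ : P 0 1 3 6) (_ : P 0 1 4 5) (_ : P 0 1 4 6) (_ : P 0 1 5 6)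
    (_ : P 0 2 3 4) (_ : P 0 2 3 5) (_ : P 0 2 3 6) (_ : P 0 2 4 5) (_ : P 0 2 4 6)
    (_ : P 0 2 5 6) (_ : P 0 3 4 5) (_ : P 0 3 4 6) (_ : P 0 3 5 6) (_ : P 0 4 5 6)
    (_ : P 1 2 3 4) (_ : P 1 2 3 5) (_ : P 1 2 3 6) (_ : P 1 2 4 5) (_ : P 1 2 4 6)
    (_ : P 1 2 5 6) (_ : P 1 3 4 5) (_ : P 1 3 4 6) (_ : P 1 3 5 6) (_ : P 1 4 5 6)
    (_ : P 2 3 4 5) (_ : P 2 3 4 6) (_ : P 2 3 5 6) (_ : P 2 4 5 6) (_ : P 3 4 5 6) :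
    ∀ i j k l, i < j → j < k → k < l → P i j k l := by
  intro i j k l h1 h2 h3
  fin_cases i <;>
    (fin_cases j <;> first | exact absurd h1 (by decide) |
    (fin_cases k <;> first | exact absurd h2 (by decide) |
    (fin_cases l <;> first | assumption | exact absurd h3 (by decide))))

theorem ext_seven_four (b : Basis (Fin 7) ℝ V) {α β : V [⋀^Fin 4]→L[ℝ] ℝ}
    (h : ∀ i j k l, i < j → j < k → k < l → α ![b i, b j, b k, b l] = β ![b i, b j, b k, b l]) :
    α = β := by
  refine ext_strictMono b fun s hs => ?_
  obtain ⟨e, hlt⟩ := strictMono_four hs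
  rw [e]
  simp only [comp_vecCons, comp_vecEmpty]
  exact h _ _ _ _ hlt.1 hlt.2.1 hlt.2.2

theorem forall_lt_five {P : Fin 7 → Fin 7 → Fin 7 → Fin 7 → Fin 7 → Prop}
    (_ : P 0 1 2 3 4) (_ : P 0 1 2 3 5) (_ : P 0 1 2 3 6) (_ : P 0 1 2 4 5) (_ : P 0 1 2 4 6)
    (_ : P 0 1 2 5 6) (_ : P 0 1 3 4 5) (_ : P 0 1 3 4 6) (_ : P 0 1 3 5 6) (_ : P 0 1 4 5 6)
    (_ : P 0 2 3 4 5) (_ : P 0 2 3 4 6) (_ : P 0 2 3 5 6) (_ : P 0 2 4 5 6) (_ : P 0 3 4 5 6)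
    (_ : P 1 2 3 4 5) (_ : P 1 2 3 4 6) (_ : P 1 2 3 5 6) (_ : P 1 2 4 5 6) (_ : P 1 3 4 5 6)
    (_ : P 2 3 4 5 6) :
    ∀ i j k l m, i < j → j < k → k < l → l < m → P i j k l m := by
  intro i j k l m h1 h2 h3 h4
  fin_cases i <;>
    (fin_cases j <;> first | exact absurd h1 (by decide) |
    (fin_cases k <;> first | exact absurd h2 (by decide) |
    (fin_cases l <;> first | exact absurd h3 (by decide) |
    (fin_cases m <;> first | assumption | exact absurd h4 (by decide)))))

theorem ext_seven_five (b : Basis (Fin 7) ℝ V) {α β : V [⋀^Fin 5]→L[ℝ] ℝ}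
    (h : ∀ i j k l m, i < j → j < k → k < l → l < m → α ![b i, b j, b k, b l, b m] = β ![b i, b j,
      b k, b l, b m]) :
    α = β := by
  refine ext_strictMono b fun s hs => ?_
  obtain ⟨e, hlt⟩ := strictMono_five hs
  rw [e]
  simp only [comp_vecCons, comp_vecEmpty]
  exact h _ _ _ _ _ hlt.1 hlt.2.1 hlt.2.2.1 hlt.2.2.2

theorem forall_lt_six {P : Fin 7 → Fin 7 → Fin 7 → Fin 7 → Fin 7 → Fin 7 → Prop}
    (_ : P 0 1 2 3 4 5) (_ : P 0 1 2 3 4 6) (_ : P 0 1 2 3 5 6) (_ : P 0 1 2 4 5 6)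
    (_ : P 0 1 3 4 5 6) (_ : P 0 2 3 4 5 6) (_ : P 1 2 3 4 5 6) :
    ∀ i j k l m n, i < j → j < k → k < l → l < m → m < n → P i j k l m n := by
  intro i j k l m n h1 h2 h3 h4 h5
  fin_cases i <;>
    (fin_cases j <;> first | exact absurd h1 (by decide) |
    (fin_cases k <;> first | exact absurd h2 (by decide) |
    (fin_cases l <;> first | exact absurd h3 (by decide) |
    (fin_cases m <;> first | exact absurd h4 (by decide) |
    (fin_cases n <;> first | assumption | exact absurd h5 (by decide))))))

theorem ext_seven_six (b : Basis (Fin 7) ℝ V) {α β : V [⋀^Fin 6]→L[ℝ] ℝ}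
    (h : ∀ i j k l m n, i < j → j < k → k < l → l < m → m < n → α ![b i, b j, b k, b l, b m, b n] =
      β ![b i, b j, b k, b l, b m, b n]) :
    α = β := by
  refine ext_strictMono b fun s hs => ?_
  obtain ⟨e, hlt⟩ := strictMono_six hs
  rw [e]
  simp only [comp_vecCons, comp_vecEmpty]
  exact h _ _ _ _ _ _ hlt.1 hlt.2.1 hlt.2.2.1 hlt.2.2.2.1 hlt.2.2.2.2

section Hodge

variable [IsTopologicalAddGroup V] [ContinuousSMul ℝ V] [T2Space V]

/-- In these tables the sign is that of the permutation listing the complementary indices first,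
because `hodge` inserts the vectors of γ before the free ones. -/
theorem hodge_six_one_apply (b : Basis (Fin 6) ℝ V) (h : 5 + 1 = 6) (γ : V [⋀^Fin 5]→L[ℝ] ℝ) :
    hodge b (frameVol b) 1 γ h ![b 0] = -γ ![b 1, b 2, b 3, b 4, b 5] ∧
    hodge b (frameVol b) 1 γ h ![b 1] = γ ![b 0, b 2, b 3, b 4, b 5] ∧
    hodge b (frameVol b) 1 γ h ![b 2] = -γ ![b 0, b 1, b 3, b 4, b 5] ∧
    hodge b (frameVol b) 1 γ h ![b 3] = γ ![b 0, b 1, b 2, b 4, b 5] ∧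
    hodge b (frameVol b) 1 γ h ![b 4] = -γ ![b 0, b 1, b 2, b 3, b 5] ∧
    hodge b (frameVol b) 1 γ h ![b 5] = γ ![b 0, b 1, b 2, b 3, b 4] := by
  refine ⟨?_, ?_, ?_, ?_, ?_, ?_⟩
  -- The proof `h` of the degree equation sits inside `Fin.cast`; reverting it leaves a closed
  -- proposition for `decide`.
  · simpa only [comp_vecCons, comp_vecEmpty, Int.reduceNeg, Int.cast_neg, Int.cast_one,
      neg_one_mul] using
      hodge_frameVol_apply b h γ ![1, 2, 3, 4, 5] ![0] (-1) (by decide) (by revert h; decide)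
  · simpa only [comp_vecCons, comp_vecEmpty, Int.cast_one, one_mul] using
      hodge_frameVol_apply b h γ ![0, 2, 3, 4, 5] ![1] 1 (by decide) (by revert h; decide)
  · simpa only [comp_vecCons, comp_vecEmpty, Int.reduceNeg, Int.cast_neg, Int.cast_one,
      neg_one_mul] using
      hodge_frameVol_apply b h γ ![0, 1, 3, 4, 5] ![2] (-1) (by decide) (by revert h; decide)
  · simpa only [comp_vecCons, comp_vecEmpty, Int.cast_one, one_mul] using
      hodge_frameVol_apply b h γ ![0, 1, 2, 4, 5] ![3] 1 (by decide) (by revert h; decide)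
  · simpa only [comp_vecCons, comp_vecEmpty, Int.reduceNeg, Int.cast_neg, Int.cast_one,
      neg_one_mul] using
      hodge_frameVol_apply b h γ ![0, 1, 2, 3, 5] ![4] (-1) (by decide) (by revert h; decide)
  · simpa only [comp_vecCons, comp_vecEmpty, Int.cast_one, one_mul] using
      hodge_frameVol_apply b h γ ![0, 1, 2, 3, 4] ![5] 1 (by decide) (by revert h; decide)

theorem hodge_six_two_apply (b : Basis (Fin 6) ℝ V) (h : 4 + 2 = 6) (γ : V [⋀^Fin 4]→L[ℝ] ℝ) :
    hodge b (frameVol b) 2 γ h ![b 0, b 1] = γ ![b 2, b 3, b 4, b 5] ∧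
    hodge b (frameVol b) 2 γ h ![b 0, b 2] = -γ ![b 1, b 3, b 4, b 5] ∧
    hodge b (frameVol b) 2 γ h ![b 0, b 3] = γ ![b 1, b 2, b 4, b 5] ∧
    hodge b (frameVol b) 2 γ h ![b 0, b 4] = -γ ![b 1, b 2, b 3, b 5] ∧
    hodge b (frameVol b) 2 γ h ![b 0, b 5] = γ ![b 1, b 2, b 3, b 4] ∧
    hodge b (frameVol b) 2 γ h ![b 1, b 2] = γ ![b 0, b 3, b 4, b 5] ∧
    hodge b (frameVol b) 2 γ h ![b 1, b 3] = -γ ![b 0, b 2, b 4, b 5] ∧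
    hodge b (frameVol b) 2 γ h ![b 1, b 4] = γ ![b 0, b 2, b 3, b 5] ∧
    hodge b (frameVol b) 2 γ h ![b 1, b 5] = -γ ![b 0, b 2, b 3, b 4] ∧
    hodge b (frameVol b) 2 γ h ![b 2, b 3] = γ ![b 0, b 1, b 4, b 5] ∧
    hodge b (frameVol b) 2 γ h ![b 2, b 4] = -γ ![b 0, b 1, b 3, b 5] ∧
    hodge b (frameVol b) 2 γ h ![b 2, b 5] = γ ![b 0, b 1, b 3, b 4] ∧
    hodge b (frameVol b) 2 γ h ![b 3, b 4] = γ ![b 0, b 1, b 2, b 5] ∧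
    hodge b (frameVol b) 2 γ h ![b 3, b 5] = -γ ![b 0, b 1, b 2, b 4] ∧
    hodge b (frameVol b) 2 γ h ![b 4, b 5] = γ ![b 0, b 1, b 2, b 3] := by
  refine ⟨?_, ?_, ?_, ?_, ?_, ?_, ?_, ?_, ?_, ?_, ?_, ?_, ?_, ?_, ?_⟩
  · simpa only [comp_vecCons, comp_vecEmpty, Int.cast_one, one_mul] using
      hodge_frameVol_apply b h γ ![2, 3, 4, 5] ![0, 1] 1 (by decide) (by revert h; decide)
  · simpa only [comp_vecCons, comp_vecEmpty, Int.reduceNeg, Int.cast_neg, Int.cast_one,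
      neg_one_mul] using
      hodge_frameVol_apply b h γ ![1, 3, 4, 5] ![0, 2] (-1) (by decide) (by revert h; decide)
  · simpa only [comp_vecCons, comp_vecEmpty, Int.cast_one, one_mul] using
      hodge_frameVol_apply b h γ ![1, 2, 4, 5] ![0, 3] 1 (by decide) (by revert h; decide)
  · simpa only [comp_vecCons, comp_vecEmpty, Int.reduceNeg, Int.cast_neg, Int.cast_one,
      neg_one_mul] using
      hodge_frameVol_apply b h γ ![1, 2, 3, 5] ![0, 4] (-1) (by decide) (by revert h; decide)
  · simpa only [comp_vecCons, comp_vecEmpty, Int.cast_one, one_mul] using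
      hodge_frameVol_apply b h γ ![1, 2, 3, 4] ![0, 5] 1 (by decide) (by revert h; decide)
  · simpa only [comp_vecCons, comp_vecEmpty, Int.cast_one, one_mul] using
      hodge_frameVol_apply b h γ ![0, 3, 4, 5] ![1, 2] 1 (by decide) (by revert h; decide)
  · simpa only [comp_vecCons, comp_vecEmpty, Int.reduceNeg, Int.cast_neg, Int.cast_one,
      neg_one_mul] using
      hodge_frameVol_apply b h γ ![0, 2, 4, 5] ![1, 3] (-1) (by decide) (by revert h; decide)
  · simpa only [comp_vecCons, comp_vecEmpty, Int.cast_one, one_mul] using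
      hodge_frameVol_apply b h γ ![0, 2, 3, 5] ![1, 4] 1 (by decide) (by revert h; decide)
  · simpa only [comp_vecCons, comp_vecEmpty, Int.reduceNeg, Int.cast_neg, Int.cast_one,
      neg_one_mul] using
      hodge_frameVol_apply b h γ ![0, 2, 3, 4] ![1, 5] (-1) (by decide) (by revert h; decide)
  · simpa only [comp_vecCons, comp_vecEmpty, Int.cast_one, one_mul] using
      hodge_frameVol_apply b h γ ![0, 1, 4, 5] ![2, 3] 1 (by decide) (by revert h; decide)
  · simpa only [comp_vecCons, comp_vecEmpty, Int.reduceNeg, Int.cast_neg, Int.cast_one,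
      neg_one_mul] using
      hodge_frameVol_apply b h γ ![0, 1, 3, 5] ![2, 4] (-1) (by decide) (by revert h; decide)
  · simpa only [comp_vecCons, comp_vecEmpty, Int.cast_one, one_mul] using
      hodge_frameVol_apply b h γ ![0, 1, 3, 4] ![2, 5] 1 (by decide) (by revert h; decide)
  · simpa only [comp_vecCons, comp_vecEmpty, Int.cast_one, one_mul] using
      hodge_frameVol_apply b h γ ![0, 1, 2, 5] ![3, 4] 1 (by decide) (by revert h; decide)
  · simpa only [comp_vecCons, comp_vecEmpty, Int.reduceNeg, Int.cast_neg, Int.cast_one,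
      neg_one_mul] using
      hodge_frameVol_apply b h γ ![0, 1, 2, 4] ![3, 5] (-1) (by decide) (by revert h; decide)
  · simpa only [comp_vecCons, comp_vecEmpty, Int.cast_one, one_mul] using
      hodge_frameVol_apply b h γ ![0, 1, 2, 3] ![4, 5] 1 (by decide) (by revert h; decide)

theorem hodge_six_three_apply (b : Basis (Fin 6) ℝ V) (h : 3 + 3 = 6) (γ : V [⋀^Fin 3]→L[ℝ] ℝ) :
    hodge b (frameVol b) 3 γ h ![b 0, b 1, b 2] = -γ ![b 3, b 4, b 5] ∧
    hodge b (frameVol b) 3 γ h ![b 0, b 1, b 3] = γ ![b 2, b 4, b 5] ∧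
    hodge b (frameVol b) 3 γ h ![b 0, b 1, b 4] = -γ ![b 2, b 3, b 5] ∧
    hodge b (frameVol b) 3 γ h ![b 0, b 1, b 5] = γ ![b 2, b 3, b 4] ∧
    hodge b (frameVol b) 3 γ h ![b 0, b 2, b 3] = -γ ![b 1, b 4, b 5] ∧
    hodge b (frameVol b) 3 γ h ![b 0, b 2, b 4] = γ ![b 1, b 3, b 5] ∧
    hodge b (frameVol b) 3 γ h ![b 0, b 2, b 5] = -γ ![b 1, b 3, b 4] ∧
    hodge b (frameVol b) 3 γ h ![b 0, b 3, b 4] = -γ ![b 1, b 2, b 5] ∧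
    hodge b (frameVol b) 3 γ h ![b 0, b 3, b 5] = γ ![b 1, b 2, b 4] ∧
    hodge b (frameVol b) 3 γ h ![b 0, b 4, b 5] = -γ ![b 1, b 2, b 3] ∧
    hodge b (frameVol b) 3 γ h ![b 1, b 2, b 3] = γ ![b 0, b 4, b 5] ∧
    hodge b (frameVol b) 3 γ h ![b 1, b 2, b 4] = -γ ![b 0, b 3, b 5] ∧
    hodge b (frameVol b) 3 γ h ![b 1, b 2, b 5] = γ ![b 0, b 3, b 4] ∧
    hodge b (frameVol b) 3 γ h ![b 1, b 3, b 4] = γ ![b 0, b 2, b 5] ∧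
    hodge b (frameVol b) 3 γ h ![b 1, b 3, b 5] = -γ ![b 0, b 2, b 4] ∧
    hodge b (frameVol b) 3 γ h ![b 1, b 4, b 5] = γ ![b 0, b 2, b 3] ∧
    hodge b (frameVol b) 3 γ h ![b 2, b 3, b 4] = -γ ![b 0, b 1, b 5] ∧
    hodge b (frameVol b) 3 γ h ![b 2, b 3, b 5] = γ ![b 0, b 1, b 4] ∧
    hodge b (frameVol b) 3 γ h ![b 2, b 4, b 5] = -γ ![b 0, b 1, b 3] ∧
    hodge b (frameVol b) 3 γ h ![b 3, b 4, b 5] = γ ![b 0, b 1, b 2] := by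
  refine ⟨?_, ?_, ?_, ?_, ?_, ?_, ?_, ?_, ?_, ?_, ?_, ?_, ?_, ?_, ?_, ?_, ?_, ?_, ?_, ?_⟩
  · simpa only [comp_vecCons, comp_vecEmpty, Int.reduceNeg, Int.cast_neg, Int.cast_one,
      neg_one_mul] using
      hodge_frameVol_apply b h γ ![3, 4, 5] ![0, 1, 2] (-1) (by decide) (by revert h; decide)
  · simpa only [comp_vecCons, comp_vecEmpty, Int.cast_one, one_mul] using
      hodge_frameVol_apply b h γ ![2, 4, 5] ![0, 1, 3] 1 (by decide) (by revert h; decide)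
  · simpa only [comp_vecCons, comp_vecEmpty, Int.reduceNeg, Int.cast_neg, Int.cast_one,
      neg_one_mul] using
      hodge_frameVol_apply b h γ ![2, 3, 5] ![0, 1, 4] (-1) (by decide) (by revert h; decide)
  · simpa only [comp_vecCons, comp_vecEmpty, Int.cast_one, one_mul] using
      hodge_frameVol_apply b h γ ![2, 3, 4] ![0, 1, 5] 1 (by decide) (by revert h; decide)
  · simpa only [comp_vecCons, comp_vecEmpty, Int.reduceNeg, Int.cast_neg, Int.cast_one,
      neg_one_mul] using
      hodge_frameVol_apply b h γ ![1, 4, 5] ![0, 2, 3] (-1) (by decide) (by revert h; decide)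
  · simpa only [comp_vecCons, comp_vecEmpty, Int.cast_one, one_mul] using
      hodge_frameVol_apply b h γ ![1, 3, 5] ![0, 2, 4] 1 (by decide) (by revert h; decide)
  · simpa only [comp_vecCons, comp_vecEmpty, Int.reduceNeg, Int.cast_neg, Int.cast_one,
      neg_one_mul] using
      hodge_frameVol_apply b h γ ![1, 3, 4] ![0, 2, 5] (-1) (by decide) (by revert h; decide)
  · simpa only [comp_vecCons, comp_vecEmpty, Int.reduceNeg, Int.cast_neg, Int.cast_one,
      neg_one_mul] using
      hodge_frameVol_apply b h γ ![1, 2, 5] ![0, 3, 4] (-1) (by decide) (by revert h; decide)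
  · simpa only [comp_vecCons, comp_vecEmpty, Int.cast_one, one_mul] using
      hodge_frameVol_apply b h γ ![1, 2, 4] ![0, 3, 5] 1 (by decide) (by revert h; decide)
  · simpa only [comp_vecCons, comp_vecEmpty, Int.reduceNeg, Int.cast_neg, Int.cast_one,
      neg_one_mul] using
      hodge_frameVol_apply b h γ ![1, 2, 3] ![0, 4, 5] (-1) (by decide) (by revert h; decide)
  · simpa only [comp_vecCons, comp_vecEmpty, Int.cast_one, one_mul] using
      hodge_frameVol_apply b h γ ![0, 4, 5] ![1, 2, 3] 1 (by decide) (by revert h; decide)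
  · simpa only [comp_vecCons, comp_vecEmpty, Int.reduceNeg, Int.cast_neg, Int.cast_one,
      neg_one_mul] using
      hodge_frameVol_apply b h γ ![0, 3, 5] ![1, 2, 4] (-1) (by decide) (by revert h; decide)
  · simpa only [comp_vecCons, comp_vecEmpty, Int.cast_one, one_mul] using
      hodge_frameVol_apply b h γ ![0, 3, 4] ![1, 2, 5] 1 (by decide) (by revert h; decide)
  · simpa only [comp_vecCons, comp_vecEmpty, Int.cast_one, one_mul] using
      hodge_frameVol_apply b h γ ![0, 2, 5] ![1, 3, 4] 1 (by decide) (by revert h; decide)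
  · simpa only [comp_vecCons, comp_vecEmpty, Int.reduceNeg, Int.cast_neg, Int.cast_one,
      neg_one_mul] using
      hodge_frameVol_apply b h γ ![0, 2, 4] ![1, 3, 5] (-1) (by decide) (by revert h; decide)
  · simpa only [comp_vecCons, comp_vecEmpty, Int.cast_one, one_mul] using
      hodge_frameVol_apply b h γ ![0, 2, 3] ![1, 4, 5] 1 (by decide) (by revert h; decide)
  · simpa only [comp_vecCons, comp_vecEmpty, Int.reduceNeg, Int.cast_neg, Int.cast_one,
      neg_one_mul] using
      hodge_frameVol_apply b h γ ![0, 1, 5] ![2, 3, 4] (-1) (by decide) (by revert h; decide)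
  · simpa only [comp_vecCons, comp_vecEmpty, Int.cast_one, one_mul] using
      hodge_frameVol_apply b h γ ![0, 1, 4] ![2, 3, 5] 1 (by decide) (by revert h; decide)
  · simpa only [comp_vecCons, comp_vecEmpty, Int.reduceNeg, Int.cast_neg, Int.cast_one,
      neg_one_mul] using
      hodge_frameVol_apply b h γ ![0, 1, 3] ![2, 4, 5] (-1) (by decide) (by revert h; decide)
  · simpa only [comp_vecCons, comp_vecEmpty, Int.cast_one, one_mul] using
      hodge_frameVol_apply b h γ ![0, 1, 2] ![3, 4, 5] 1 (by decide) (by revert h; decide)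

theorem hodge_seven_four_apply (b : Basis (Fin 7) ℝ V) (h : 3 + 4 = 7) (γ : V [⋀^Fin 3]→L[ℝ] ℝ) :
    hodge b (frameVol b) 4 γ h ![b 0, b 1, b 2, b 3] = γ ![b 4, b 5, b 6] ∧
    hodge b (frameVol b) 4 γ h ![b 0, b 1, b 2, b 4] = -γ ![b 3, b 5, b 6] ∧
    hodge b (frameVol b) 4 γ h ![b 0, b 1, b 2, b 5] = γ ![b 3, b 4, b 6] ∧
    hodge b (frameVol b) 4 γ h ![b 0, b 1, b 2, b 6] = -γ ![b 3, b 4, b 5] ∧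
    hodge b (frameVol b) 4 γ h ![b 0, b 1, b 3, b 4] = γ ![b 2, b 5, b 6] ∧
    hodge b (frameVol b) 4 γ h ![b 0, b 1, b 3, b 5] = -γ ![b 2, b 4, b 6] ∧
    hodge b (frameVol b) 4 γ h ![b 0, b 1, b 3, b 6] = γ ![b 2, b 4, b 5] ∧
    hodge b (frameVol b) 4 γ h ![b 0, b 1, b 4, b 5] = γ ![b 2, b 3, b 6] ∧
    hodge b (frameVol b) 4 γ h ![b 0, b 1, b 4, b 6] = -γ ![b 2, b 3, b 5] ∧
    hodge b (frameVol b) 4 γ h ![b 0, b 1, b 5, b 6] = γ ![b 2, b 3, b 4] ∧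
    hodge b (frameVol b) 4 γ h ![b 0, b 2, b 3, b 4] = -γ ![b 1, b 5, b 6] ∧
    hodge b (frameVol b) 4 γ h ![b 0, b 2, b 3, b 5] = γ ![b 1, b 4, b 6] ∧
    hodge b (frameVol b) 4 γ h ![b 0, b 2, b 3, b 6] = -γ ![b 1, b 4, b 5] ∧
    hodge b (frameVol b) 4 γ h ![b 0, b 2, b 4, b 5] = -γ ![b 1, b 3, b 6] ∧
    hodge b (frameVol b) 4 γ h ![b 0, b 2, b 4, b 6] = γ ![b 1, b 3, b 5] ∧
    hodge b (frameVol b) 4 γ h ![b 0, b 2, b 5, b 6] = -γ ![b 1, b 3, b 4] ∧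
    hodge b (frameVol b) 4 γ h ![b 0, b 3, b 4, b 5] = γ ![b 1, b 2, b 6] ∧
    hodge b (frameVol b) 4 γ h ![b 0, b 3, b 4, b 6] = -γ ![b 1, b 2, b 5] ∧
    hodge b (frameVol b) 4 γ h ![b 0, b 3, b 5, b 6] = γ ![b 1, b 2, b 4] ∧
    hodge b (frameVol b) 4 γ h ![b 0, b 4, b 5, b 6] = -γ ![b 1, b 2, b 3] ∧
    hodge b (frameVol b) 4 γ h ![b 1, b 2, b 3, b 4] = γ ![b 0, b 5, b 6] ∧
    hodge b (frameVol b) 4 γ h ![b 1, b 2, b 3, b 5] = -γ ![b 0, b 4, b 6] ∧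
    hodge b (frameVol b) 4 γ h ![b 1, b 2, b 3, b 6] = γ ![b 0, b 4, b 5] ∧
    hodge b (frameVol b) 4 γ h ![b 1, b 2, b 4, b 5] = γ ![b 0, b 3, b 6] ∧
    hodge b (frameVol b) 4 γ h ![b 1, b 2, b 4, b 6] = -γ ![b 0, b 3, b 5] ∧
    hodge b (frameVol b) 4 γ h ![b 1, b 2, b 5, b 6] = γ ![b 0, b 3, b 4] ∧
    hodge b (frameVol b) 4 γ h ![b 1, b 3, b 4, b 5] = -γ ![b 0, b 2, b 6] ∧
    hodge b (frameVol b) 4 γ h ![b 1, b 3, b 4, b 6] = γ ![b 0, b 2, b 5] ∧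
    hodge b (frameVol b) 4 γ h ![b 1, b 3, b 5, b 6] = -γ ![b 0, b 2, b 4] ∧
    hodge b (frameVol b) 4 γ h ![b 1, b 4, b 5, b 6] = γ ![b 0, b 2, b 3] ∧
    hodge b (frameVol b) 4 γ h ![b 2, b 3, b 4, b 5] = γ ![b 0, b 1, b 6] ∧
    hodge b (frameVol b) 4 γ h ![b 2, b 3, b 4, b 6] = -γ ![b 0, b 1, b 5] ∧
    hodge b (frameVol b) 4 γ h ![b 2, b 3, b 5, b 6] = γ ![b 0, b 1, b 4] ∧
    hodge b (frameVol b) 4 γ h ![b 2, b 4, b 5, b 6] = -γ ![b 0, b 1, b 3] ∧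
    hodge b (frameVol b) 4 γ h ![b 3, b 4, b 5, b 6] = γ ![b 0, b 1, b 2] := by
  refine ⟨?_, ?_, ?_, ?_, ?_, ?_, ?_, ?_, ?_, ?_, ?_, ?_, ?_, ?_, ?_, ?_, ?_, ?_, ?_, ?_, ?_, ?_,
    ?_, ?_,
    ?_, ?_, ?_, ?_, ?_, ?_, ?_, ?_, ?_, ?_, ?_⟩
  · simpa only [comp_vecCons, comp_vecEmpty, Int.cast_one, one_mul] using
      hodge_frameVol_apply b h γ ![4, 5, 6] ![0, 1, 2, 3] 1 (by decide) (by revert h; decide)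
  · simpa only [comp_vecCons, comp_vecEmpty, Int.reduceNeg, Int.cast_neg, Int.cast_one,
      neg_one_mul] using
      hodge_frameVol_apply b h γ ![3, 5, 6] ![0, 1, 2, 4] (-1) (by decide) (by revert h; decide)
  · simpa only [comp_vecCons, comp_vecEmpty, Int.cast_one, one_mul] using
      hodge_frameVol_apply b h γ ![3, 4, 6] ![0, 1, 2, 5] 1 (by decide) (by revert h; decide)
  · simpa only [comp_vecCons, comp_vecEmpty, Int.reduceNeg, Int.cast_neg, Int.cast_one,
      neg_one_mul] using
      hodge_frameVol_apply b h γ ![3, 4, 5] ![0, 1, 2, 6] (-1) (by decide) (by revert h; decide)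
  · simpa only [comp_vecCons, comp_vecEmpty, Int.cast_one, one_mul] using
      hodge_frameVol_apply b h γ ![2, 5, 6] ![0, 1, 3, 4] 1 (by decide) (by revert h; decide)
  · simpa only [comp_vecCons, comp_vecEmpty, Int.reduceNeg, Int.cast_neg, Int.cast_one,
      neg_one_mul] using
      hodge_frameVol_apply b h γ ![2, 4, 6] ![0, 1, 3, 5] (-1) (by decide) (by revert h; decide)
  · simpa only [comp_vecCons, comp_vecEmpty, Int.cast_one, one_mul] using
      hodge_frameVol_apply b h γ ![2, 4, 5] ![0, 1, 3, 6] 1 (by decide) (by revert h; decide)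
  · simpa only [comp_vecCons, comp_vecEmpty, Int.cast_one, one_mul] using
      hodge_frameVol_apply b h γ ![2, 3, 6] ![0, 1, 4, 5] 1 (by decide) (by revert h; decide)
  · simpa only [comp_vecCons, comp_vecEmpty, Int.reduceNeg, Int.cast_neg, Int.cast_one,
      neg_one_mul] using
      hodge_frameVol_apply b h γ ![2, 3, 5] ![0, 1, 4, 6] (-1) (by decide) (by revert h; decide)
  · simpa only [comp_vecCons, comp_vecEmpty, Int.cast_one, one_mul] using
      hodge_frameVol_apply b h γ ![2, 3, 4] ![0, 1, 5, 6] 1 (by decide) (by revert h; decide)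
  · simpa only [comp_vecCons, comp_vecEmpty, Int.reduceNeg, Int.cast_neg, Int.cast_one,
      neg_one_mul] using
      hodge_frameVol_apply b h γ ![1, 5, 6] ![0, 2, 3, 4] (-1) (by decide) (by revert h; decide)
  · simpa only [comp_vecCons, comp_vecEmpty, Int.cast_one, one_mul] using
      hodge_frameVol_apply b h γ ![1, 4, 6] ![0, 2, 3, 5] 1 (by decide) (by revert h; decide)
  · simpa only [comp_vecCons, comp_vecEmpty, Int.reduceNeg, Int.cast_neg, Int.cast_one,
      neg_one_mul] using
      hodge_frameVol_apply b h γ ![1, 4, 5] ![0, 2, 3, 6] (-1) (by decide) (by revert h; decide)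
  · simpa only [comp_vecCons, comp_vecEmpty, Int.reduceNeg, Int.cast_neg, Int.cast_one,
      neg_one_mul] using
      hodge_frameVol_apply b h γ ![1, 3, 6] ![0, 2, 4, 5] (-1) (by decide) (by revert h; decide)
  · simpa only [comp_vecCons, comp_vecEmpty, Int.cast_one, one_mul] using
      hodge_frameVol_apply b h γ ![1, 3, 5] ![0, 2, 4, 6] 1 (by decide) (by revert h; decide)
  · simpa only [comp_vecCons, comp_vecEmpty, Int.reduceNeg, Int.cast_neg, Int.cast_one,
      neg_one_mul] using
      hodge_frameVol_apply b h γ ![1, 3, 4] ![0, 2, 5, 6] (-1) (by decide) (by revert h; decide)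
  · simpa only [comp_vecCons, comp_vecEmpty, Int.cast_one, one_mul] using
      hodge_frameVol_apply b h γ ![1, 2, 6] ![0, 3, 4, 5] 1 (by decide) (by revert h; decide)
  · simpa only [comp_vecCons, comp_vecEmpty, Int.reduceNeg, Int.cast_neg, Int.cast_one,
      neg_one_mul] using
      hodge_frameVol_apply b h γ ![1, 2, 5] ![0, 3, 4, 6] (-1) (by decide) (by revert h; decide)
  · simpa only [comp_vecCons, comp_vecEmpty, Int.cast_one, one_mul] using
      hodge_frameVol_apply b h γ ![1, 2, 4] ![0, 3, 5, 6] 1 (by decide) (by revert h; decide)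
  · simpa only [comp_vecCons, comp_vecEmpty, Int.reduceNeg, Int.cast_neg, Int.cast_one,
      neg_one_mul] using
      hodge_frameVol_apply b h γ ![1, 2, 3] ![0, 4, 5, 6] (-1) (by decide) (by revert h; decide)
  · simpa only [comp_vecCons, comp_vecEmpty, Int.cast_one, one_mul] using
      hodge_frameVol_apply b h γ ![0, 5, 6] ![1, 2, 3, 4] 1 (by decide) (by revert h; decide)
  · simpa only [comp_vecCons, comp_vecEmpty, Int.reduceNeg, Int.cast_neg, Int.cast_one,
      neg_one_mul] using
      hodge_frameVol_apply b h γ ![0, 4, 6] ![1, 2, 3, 5] (-1) (by decide) (by revert h; decide)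
  · simpa only [comp_vecCons, comp_vecEmpty, Int.cast_one, one_mul] using
      hodge_frameVol_apply b h γ ![0, 4, 5] ![1, 2, 3, 6] 1 (by decide) (by revert h; decide)
  · simpa only [comp_vecCons, comp_vecEmpty, Int.cast_one, one_mul] using
      hodge_frameVol_apply b h γ ![0, 3, 6] ![1, 2, 4, 5] 1 (by decide) (by revert h; decide)
  · simpa only [comp_vecCons, comp_vecEmpty, Int.reduceNeg, Int.cast_neg, Int.cast_one,
      neg_one_mul] using
      hodge_frameVol_apply b h γ ![0, 3, 5] ![1, 2, 4, 6] (-1) (by decide) (by revert h; decide)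
  · simpa only [comp_vecCons, comp_vecEmpty, Int.cast_one, one_mul] using
      hodge_frameVol_apply b h γ ![0, 3, 4] ![1, 2, 5, 6] 1 (by decide) (by revert h; decide)
  · simpa only [comp_vecCons, comp_vecEmpty, Int.reduceNeg, Int.cast_neg, Int.cast_one,
      neg_one_mul] using
      hodge_frameVol_apply b h γ ![0, 2, 6] ![1, 3, 4, 5] (-1) (by decide) (by revert h; decide)
  · simpa only [comp_vecCons, comp_vecEmpty, Int.cast_one, one_mul] using
      hodge_frameVol_apply b h γ ![0, 2, 5] ![1, 3, 4, 6] 1 (by decide) (by revert h; decide)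
  · simpa only [comp_vecCons, comp_vecEmpty, Int.reduceNeg, Int.cast_neg, Int.cast_one,
      neg_one_mul] using
      hodge_frameVol_apply b h γ ![0, 2, 4] ![1, 3, 5, 6] (-1) (by decide) (by revert h; decide)
  · simpa only [comp_vecCons, comp_vecEmpty, Int.cast_one, one_mul] using
      hodge_frameVol_apply b h γ ![0, 2, 3] ![1, 4, 5, 6] 1 (by decide) (by revert h; decide)
  · simpa only [comp_vecCons, comp_vecEmpty, Int.cast_one, one_mul] using
      hodge_frameVol_apply b h γ ![0, 1, 6] ![2, 3, 4, 5] 1 (by decide) (by revert h; decide)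
  · simpa only [comp_vecCons, comp_vecEmpty, Int.reduceNeg, Int.cast_neg, Int.cast_one,
      neg_one_mul] using
      hodge_frameVol_apply b h γ ![0, 1, 5] ![2, 3, 4, 6] (-1) (by decide) (by revert h; decide)
  · simpa only [comp_vecCons, comp_vecEmpty, Int.cast_one, one_mul] using
      hodge_frameVol_apply b h γ ![0, 1, 4] ![2, 3, 5, 6] 1 (by decide) (by revert h; decide)
  · simpa only [comp_vecCons, comp_vecEmpty, Int.reduceNeg, Int.cast_neg, Int.cast_one,
      neg_one_mul] using
      hodge_frameVol_apply b h γ ![0, 1, 3] ![2, 4, 5, 6] (-1) (by decide) (by revert h; decide)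
  · simpa only [comp_vecCons, comp_vecEmpty, Int.cast_one, one_mul] using
      hodge_frameVol_apply b h γ ![0, 1, 2] ![3, 4, 5, 6] 1 (by decide) (by revert h; decide)

end Hodge

end ExtAlg

/-! ### Pointwise G₂ algebra on the cylinder over an SU(3) vector space -/

namespace ExtAlg

variable {V W : Type*} [AddCommGroup V] [Module ℝ V] [TopologicalSpace V]
  [AddCommGroup W] [Module ℝ W] [TopologicalSpace W]

/-- The frame `c` is adapted to `(ω, Ψ = P + i Q)`: in the dual coframe,
`ω = e¹² + e³⁴ + e⁵⁶` and `Ψ = (e¹ + i e²) ∧ (e³ + i e⁴) ∧ (e⁵ + i e⁶)`. -/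
structure IsSU3Frame (ω : W [⋀^Fin 2]→L[ℝ] ℝ) (P Q : W [⋀^Fin 3]→L[ℝ] ℝ) (c : Fin 6 → W) :
    Prop where
  two :
    ω ![c 0, c 1] = 1 ∧ ω ![c 0, c 2] = 0 ∧ ω ![c 0, c 3] = 0 ∧ ω ![c 0, c 4] = 0 ∧
    ω ![c 0, c 5] = 0 ∧ ω ![c 1, c 2] = 0 ∧ ω ![c 1, c 3] = 0 ∧ ω ![c 1, c 4] = 0 ∧
    ω ![c 1, c 5] = 0 ∧ ω ![c 2, c 3] = 1 ∧ ω ![c 2, c 4] = 0 ∧ ω ![c 2, c 5] = 0 ∧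
    ω ![c 3, c 4] = 0 ∧ ω ![c 3, c 5] = 0 ∧ ω ![c 4, c 5] = 1
  re :
    P ![c 0, c 1, c 2] = 0 ∧ P ![c 0, c 1, c 3] = 0 ∧ P ![c 0, c 1, c 4] = 0 ∧
    P ![c 0, c 1, c 5] = 0 ∧ P ![c 0, c 2, c 3] = 0 ∧ P ![c 0, c 2, c 4] = 1 ∧
    P ![c 0, c 2, c 5] = 0 ∧ P ![c 0, c 3, c 4] = 0 ∧ P ![c 0, c 3, c 5] = -1 ∧
    P ![c 0, c 4, c 5] = 0 ∧ P ![c 1, c 2, c 3] = 0 ∧ P ![c 1, c 2, c 4] = 0 ∧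
    P ![c 1, c 2, c 5] = -1 ∧ P ![c 1, c 3, c 4] = -1 ∧ P ![c 1, c 3, c 5] = 0 ∧
    P ![c 1, c 4, c 5] = 0 ∧ P ![c 2, c 3, c 4] = 0 ∧ P ![c 2, c 3, c 5] = 0 ∧
    P ![c 2, c 4, c 5] = 0 ∧ P ![c 3, c 4, c 5] = 0
  im :
    Q ![c 0, c 1, c 2] = 0 ∧ Q ![c 0, c 1, c 3] = 0 ∧ Q ![c 0, c 1, c 4] = 0 ∧
    Q ![c 0, c 1, c 5] = 0 ∧ Q ![c 0, c 2, c 3] = 0 ∧ Q ![c 0, c 2, c 4] = 0 ∧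
    Q ![c 0, c 2, c 5] = 1 ∧ Q ![c 0, c 3, c 4] = 1 ∧ Q ![c 0, c 3, c 5] = 0 ∧
    Q ![c 0, c 4, c 5] = 0 ∧ Q ![c 1, c 2, c 3] = 0 ∧ Q ![c 1, c 2, c 4] = 1 ∧
    Q ![c 1, c 2, c 5] = 0 ∧ Q ![c 1, c 3, c 4] = 0 ∧ Q ![c 1, c 3, c 5] = -1 ∧
    Q ![c 1, c 4, c 5] = 0 ∧ Q ![c 2, c 3, c 4] = 0 ∧ Q ![c 2, c 3, c 5] = 0 ∧
    Q ![c 2, c 4, c 5] = 0 ∧ Q ![c 3, c 4, c 5] = 0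

/-- These vanishing rules dispose of the components of pulled-back forms along the last vector of
the lifted frame, which T sends to zero. -/
theorem apply_vecCons_zero {n : ℕ} (η : V [⋀^Fin (n + 1)]→L[ℝ] ℝ) (v : Fin n → V) :
    η (Matrix.vecCons 0 v) = 0 := η.map_coord_zero (i := 0) rfl

theorem apply_pair_zero (η : V [⋀^Fin 2]→L[ℝ] ℝ) (u : V) : η ![u, 0] = 0 :=
  η.map_coord_zero (i := 1) rfl

theorem apply_triple_zero (η : V [⋀^Fin 3]→L[ℝ] ℝ) (u v : V) : η ![u, v, 0] = 0 :=
  η.map_coord_zero (i := 2) rfl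

theorem apply_quadruple_zero (η : V [⋀^Fin 4]→L[ℝ] ℝ) (u v w : V) : η ![u, v, w, 0] = 0 :=
  η.map_coord_zero (i := 3) rfl

theorem pull_one_apply (T : V →L[ℝ] W) (η : W [⋀^Fin 1]→L[ℝ] ℝ) (u : V) :
    η.compContinuousLinearMap T ![u] = η ![T u] := by
  rw [ContinuousAlternatingMap.compContinuousLinearMap_apply, comp_vecCons, comp_vecEmpty]

theorem pull_two_apply (T : V →L[ℝ] W) (η : W [⋀^Fin 2]→L[ℝ] ℝ) (u v : V) :
    η.compContinuousLinearMap T ![u, v] = η ![T u, T v] := by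
  rw [ContinuousAlternatingMap.compContinuousLinearMap_apply]
  simp only [comp_vecCons, comp_vecEmpty]

theorem pull_three_apply (T : V →L[ℝ] W) (η : W [⋀^Fin 3]→L[ℝ] ℝ) (u v w : V) :
    η.compContinuousLinearMap T ![u, v, w] = η ![T u, T v, T w] := by
  rw [ContinuousAlternatingMap.compContinuousLinearMap_apply]
  simp only [comp_vecCons, comp_vecEmpty]

theorem pull_four_apply (T : V →L[ℝ] W) (η : W [⋀^Fin 4]→L[ℝ] ℝ) (u v w x : V) :
    η.compContinuousLinearMap T ![u, v, w, x] = η ![T u, T v, T w, T x] := by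
  rw [ContinuousAlternatingMap.compContinuousLinearMap_apply]
  simp only [comp_vecCons, comp_vecEmpty]

theorem pull_five_apply (T : V →L[ℝ] W) (η : W [⋀^Fin 5]→L[ℝ] ℝ) (u v w x y : V) :
    η.compContinuousLinearMap T ![u, v, w, x, y] = η ![T u, T v, T w, T x, T y] := by
  rw [ContinuousAlternatingMap.compContinuousLinearMap_apply]
  simp only [comp_vecCons, comp_vecEmpty]

/-- A basis of `V` whose last vector spans the kernel of `T`, compatible with a basis of `W`. -/
structure IsLift (T : V →L[ℝ] W) (θ : V [⋀^Fin 1]→L[ℝ] ℝ) (c : Fin 6 → W) (b : Fin 7 → V) :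
    Prop where
  map_zero' : T (b 0) = c 0
  map_one' : T (b 1) = c 1
  map_two' : T (b 2) = c 2
  map_three' : T (b 3) = c 3
  map_four' : T (b 4) = c 4
  map_five' : T (b 5) = c 5
  map_six' : T (b 6) = 0
  coord : θ ![b 0] = 0 ∧ θ ![b 1] = 0 ∧ θ ![b 2] = 0 ∧ θ ![b 3] = 0 ∧ θ ![b 4] = 0 ∧ θ ![b 5] = 0 ∧
    θ ![b 6] = 1

/-- Components of a primitive `(1, 1)`-form in an adapted frame. -/
structure IsPrimitiveTwo (β : W [⋀^Fin 2]→L[ℝ] ℝ) (c : Fin 6 → W) : Prop where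
  c13 : β ![c 1, c 3] = β ![c 0, c 2]
  c12 : β ![c 1, c 2] = -β ![c 0, c 3]
  c15 : β ![c 1, c 5] = β ![c 0, c 4]
  c14 : β ![c 1, c 4] = -β ![c 0, c 5]
  c35 : β ![c 3, c 5] = β ![c 2, c 4]
  c34 : β ![c 3, c 4] = -β ![c 2, c 5]
  c45 : β ![c 4, c 5] = -β ![c 0, c 1] - β ![c 2, c 3]

/-- Components of a primitive form of type `(2, 1) + (1, 2)` in an adapted frame. -/
structure IsPrimitiveThree (γ : W [⋀^Fin 3]→L[ℝ] ℝ) (c : Fin 6 → W) : Prop where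
  c045 : γ ![c 0, c 4, c 5] = -γ ![c 0, c 2, c 3]
  c145 : γ ![c 1, c 4, c 5] = -γ ![c 1, c 2, c 3]
  c245 : γ ![c 2, c 4, c 5] = -γ ![c 0, c 1, c 2]
  c345 : γ ![c 3, c 4, c 5] = -γ ![c 0, c 1, c 3]
  c234 : γ ![c 2, c 3, c 4] = -γ ![c 0, c 1, c 4]
  c235 : γ ![c 2, c 3, c 5] = -γ ![c 0, c 1, c 5]
  c135 : γ ![c 1, c 3, c 5] =
    γ ![c 0, c 2, c 5] + γ ![c 0, c 3, c 4] + γ ![c 1, c 2, c 4]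
  c024 : γ ![c 0, c 2, c 4] =
    γ ![c 0, c 3, c 5] + γ ![c 1, c 2, c 5] + γ ![c 1, c 3, c 4]

/-- The 5-form equation gives six relations, one for each omitted frame vector, and the two 6-form
equations give one each. These eight relations cut the 20 components down to 12. -/
theorem IsSU3Frame.isPrimitiveThree {ω : W [⋀^Fin 2]→L[ℝ] ℝ} {P Q γ : W [⋀^Fin 3]→L[ℝ] ℝ}
    {c : Fin 6 → W} (hF : IsSU3Frame ω P Q c) (hω : γ ⋏[5] ω = 0) (hP : γ ⋏[6] P = 0)
    (hQ : γ ⋏[6] Q = 0) : IsPrimitiveThree γ c := by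
  have five : ∀ x y z u v, (γ ⋏[5] ω) ![c x, c y, c z, c u, c v] = 0 := by simp [hω]
  have h1 := five 0 2 3 4 5
  have h2 := five 1 2 3 4 5
  have h3 := five 0 1 2 4 5
  have h4 := five 0 1 3 4 5
  have h5 := five 0 1 2 3 4
  have h6 := five 0 1 2 3 5
  have h7 : (γ ⋏[6] P) ![c 0, c 1, c 2, c 3, c 4, c 5] = 0 := by simp [hP]
  have h8 : (γ ⋏[6] Q) ![c 0, c 1, c 2, c 3, c 4, c 5] = 0 := by simp [hQ]
  simp only [wedge_three_two_apply, wedge_three_three_apply] at h1 h2 h3 h4 h5 h6 h7 h8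
  simp only [hF.two, hF.re, hF.im] at h1 h2 h3 h4 h5 h6 h7 h8
  constructor <;> linarith

/-- The 3-form `ω ∧ θ + P`. -/
def cylinderForm (T : V →L[ℝ] W) (θ : V [⋀^Fin 1]→L[ℝ] ℝ) (ω : W [⋀^Fin 2]→L[ℝ] ℝ)
    (P : W [⋀^Fin 3]→L[ℝ] ℝ) : V [⋀^Fin 3]→L[ℝ] ℝ :=
  ω.compContinuousLinearMap T ⋏[3] θ + P.compContinuousLinearMap T

/-- The 4-form `ω² / 2 + Q ∧ θ`. -/
def cylinderDual (T : V →L[ℝ] W) (θ : V [⋀^Fin 1]→L[ℝ] ℝ) (ω : W [⋀^Fin 2]→L[ℝ] ℝ)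
    (Q : W [⋀^Fin 3]→L[ℝ] ℝ) : V [⋀^Fin 4]→L[ℝ] ℝ :=
  (1 / 2 : ℝ) • (ω ⋏[4] ω).compContinuousLinearMap T + Q.compContinuousLinearMap T ⋏[4] θ

/-- The torsion form of degree 1 of the cylinder. -/
def torsionOne (T : V →L[ℝ] W) (θ : V [⋀^Fin 1]→L[ℝ] ℝ) (s m : ℝ) (ν π : W [⋀^Fin 1]→L[ℝ] ℝ) :
    V [⋀^Fin 1]→L[ℝ] ℝ :=
  (1 / 2 * (s + 2 * m)) • θ + (1 / 6 : ℝ) • ν.compContinuousLinearMap T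
    + (1 / 6 : ℝ) • π.compContinuousLinearMap T

/-- The basis `b` is adapted to the 3-form `φ` and its dual 4-form `Φ`. -/
structure IsG2Frame (φ : V [⋀^Fin 3]→L[ℝ] ℝ) (Φ : V [⋀^Fin 4]→L[ℝ] ℝ) (b : Fin 7 → V) : Prop where
  three :
    φ ![b 0, b 1, b 2] = 0 ∧ φ ![b 0, b 1, b 3] = 0 ∧ φ ![b 0, b 1, b 4] = 0 ∧
    φ ![b 0, b 1, b 5] = 0 ∧ φ ![b 0, b 1, b 6] = 1 ∧ φ ![b 0, b 2, b 3] = 0 ∧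
    φ ![b 0, b 2, b 4] = 1 ∧ φ ![b 0, b 2, b 5] = 0 ∧ φ ![b 0, b 2, b 6] = 0 ∧
    φ ![b 0, b 3, b 4] = 0 ∧ φ ![b 0, b 3, b 5] = -1 ∧ φ ![b 0, b 3, b 6] = 0 ∧
    φ ![b 0, b 4, b 5] = 0 ∧ φ ![b 0, b 4, b 6] = 0 ∧ φ ![b 0, b 5, b 6] = 0 ∧
    φ ![b 1, b 2, b 3] = 0 ∧ φ ![b 1, b 2, b 4] = 0 ∧ φ ![b 1, b 2, b 5] = -1 ∧
    φ ![b 1, b 2, b 6] = 0 ∧ φ ![b 1, b 3, b 4] = -1 ∧ φ ![b 1, b 3, b 5] = 0 ∧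
    φ ![b 1, b 3, b 6] = 0 ∧ φ ![b 1, b 4, b 5] = 0 ∧ φ ![b 1, b 4, b 6] = 0 ∧
    φ ![b 1, b 5, b 6] = 0 ∧ φ ![b 2, b 3, b 4] = 0 ∧ φ ![b 2, b 3, b 5] = 0 ∧
    φ ![b 2, b 3, b 6] = 1 ∧ φ ![b 2, b 4, b 5] = 0 ∧ φ ![b 2, b 4, b 6] = 0 ∧
    φ ![b 2, b 5, b 6] = 0 ∧ φ ![b 3, b 4, b 5] = 0 ∧ φ ![b 3, b 4, b 6] = 0 ∧
    φ ![b 3, b 5, b 6] = 0 ∧ φ ![b 4, b 5, b 6] = 1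
  four :
    Φ ![b 0, b 1, b 2, b 3] = 1 ∧ Φ ![b 0, b 1, b 2, b 4] = 0 ∧ Φ ![b 0, b 1, b 2, b 5] = 0 ∧
    Φ ![b 0, b 1, b 2, b 6] = 0 ∧ Φ ![b 0, b 1, b 3, b 4] = 0 ∧ Φ ![b 0, b 1, b 3, b 5] = 0 ∧
    Φ ![b 0, b 1, b 3, b 6] = 0 ∧ Φ ![b 0, b 1, b 4, b 5] = 1 ∧ Φ ![b 0, b 1, b 4, b 6] = 0 ∧
    Φ ![b 0, b 1, b 5, b 6] = 0 ∧ Φ ![b 0, b 2, b 3, b 4] = 0 ∧ Φ ![b 0, b 2, b 3, b 5] = 0 ∧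
    Φ ![b 0, b 2, b 3, b 6] = 0 ∧ Φ ![b 0, b 2, b 4, b 5] = 0 ∧ Φ ![b 0, b 2, b 4, b 6] = 0 ∧
    Φ ![b 0, b 2, b 5, b 6] = 1 ∧ Φ ![b 0, b 3, b 4, b 5] = 0 ∧ Φ ![b 0, b 3, b 4, b 6] = 1 ∧
    Φ ![b 0, b 3, b 5, b 6] = 0 ∧ Φ ![b 0, b 4, b 5, b 6] = 0 ∧ Φ ![b 1, b 2, b 3, b 4] = 0 ∧
    Φ ![b 1, b 2, b 3, b 5] = 0 ∧ Φ ![b 1, b 2, b 3, b 6] = 0 ∧ Φ ![b 1, b 2, b 4, b 5] = 0 ∧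
    Φ ![b 1, b 2, b 4, b 6] = 1 ∧ Φ ![b 1, b 2, b 5, b 6] = 0 ∧ Φ ![b 1, b 3, b 4, b 5] = 0 ∧
    Φ ![b 1, b 3, b 4, b 6] = 0 ∧ Φ ![b 1, b 3, b 5, b 6] = -1 ∧ Φ ![b 1, b 4, b 5, b 6] = 0 ∧
    Φ ![b 2, b 3, b 4, b 5] = 1 ∧ Φ ![b 2, b 3, b 4, b 6] = 0 ∧ Φ ![b 2, b 3, b 5, b 6] = 0 ∧
    Φ ![b 2, b 4, b 5, b 6] = 0 ∧ Φ ![b 3, b 4, b 5, b 6] = 0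

/-- In the lifted coframe θ is the seventh covector and pulled-back forms involve only the first
six, so the standard expressions of ω and Ψ turn into the model 3-form and its dual. -/
theorem isG2Frame_cylinder {ω : W [⋀^Fin 2]→L[ℝ] ℝ} {P Q : W [⋀^Fin 3]→L[ℝ] ℝ} {c : Fin 6 → W}
    {b : Fin 7 → V} {T : V →L[ℝ] W} {θ : V [⋀^Fin 1]→L[ℝ] ℝ} (hF : IsSU3Frame ω P Q c)
    (hT : IsLift T θ c b) : IsG2Frame (cylinderForm T θ ω P) (cylinderDual T θ ω Q) b where
  three := by
    refine ⟨?_, ?_, ?_, ?_, ?_, ?_, ?_, ?_, ?_, ?_, ?_, ?_, ?_, ?_, ?_, ?_, ?_, ?_, ?_, ?_, ?_,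
      ?_, ?_, ?_, ?_, ?_, ?_, ?_, ?_, ?_, ?_, ?_, ?_, ?_, ?_⟩
    all_goals
      simp only [cylinderForm, ContinuousAlternatingMap.add_apply, wedge_two_one_apply,
        pull_two_apply, pull_three_apply, hT.map_zero', hT.map_one', hT.map_two', hT.map_three',
        hT.map_four', hT.map_five', hT.map_six', hT.coord, apply_pair_zero, apply_triple_zero,
        hF.two, hF.re, mul_zero, zero_mul, add_zero, zero_add, sub_zero, mul_one, sub_self]
  four := by
    refine ⟨?_, ?_, ?_, ?_, ?_, ?_, ?_, ?_, ?_, ?_, ?_, ?_, ?_, ?_, ?_, ?_, ?_, ?_, ?_, ?_, ?_,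
      ?_, ?_, ?_, ?_, ?_, ?_, ?_, ?_, ?_, ?_, ?_, ?_, ?_, ?_⟩
    all_goals
      simp only [cylinderDual, ContinuousAlternatingMap.add_apply, wedge_three_one_apply,
        ContinuousAlternatingMap.smul_apply, wedge_two_two_apply, pull_three_apply, pull_four_apply,
        hT.map_zero', hT.map_one', hT.map_two', hT.map_three', hT.map_four', hT.map_five',
        hT.map_six', hT.coord, apply_triple_zero, apply_quadruple_zero, hF.two, hF.im, smul_eq_mul]
      norm_num

theorem ext_seven_seven (b : Basis (Fin 7) ℝ V) {α β : V [⋀^Fin 7]→L[ℝ] ℝ}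
    (h : α ![b 0, b 1, b 2, b 3, b 4, b 5, b 6] = β ![b 0, b 1, b 2, b 3, b 4, b 5, b 6]) :
    α = β := by
  refine ext_strictMono b fun s hs => ?_
  have e : s = id := hs.eq_id
  have e' : (id : Fin 7 → Fin 7) = ![0, 1, 2, 3, 4, 5, 6] := by decide
  rw [e, e']
  simpa only [comp_vecCons, comp_vecEmpty] using h

theorem torsionOne_apply {T : V →L[ℝ] W} {θ : V [⋀^Fin 1]→L[ℝ] ℝ} (s m : ℝ)
    (ν π : W [⋀^Fin 1]→L[ℝ] ℝ) (u : V) :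
    torsionOne T θ s m ν π ![u] =
      1 / 2 * (s + 2 * m) * θ ![u] + 1 / 6 * ν ![T u] + 1 / 6 * π ![T u] := by
  simp only [torsionOne, ContinuousAlternatingMap.add_apply, ContinuousAlternatingMap.smul_apply,
    pull_one_apply, pull_two_apply, pull_three_apply, pull_four_apply, pull_five_apply, smul_eq_mul]

/-- Stated for arbitrary A, B, C, so that the Hodge stars in `torsionTwo` stay opaque during the
expansion. -/
theorem pull_sub_wedge_sub_apply {T : V →L[ℝ] W} {θ : V [⋀^Fin 1]→L[ℝ] ℝ}
    (A : W [⋀^Fin 1]→L[ℝ] ℝ) (B C : W [⋀^Fin 2]→L[ℝ] ℝ) (u v : V) :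
    (B.compContinuousLinearMap T - A.compContinuousLinearMap T ⋏[2] θ
      - C.compContinuousLinearMap T) ![u, v] =
      B ![T u, T v] - (A ![T u] * θ ![v] - A ![T v] * θ ![u]) - C ![T u, T v] := by
  simp only [ContinuousAlternatingMap.sub_apply]
  rw [wedge_one_one_apply]
  simp only [pull_one_apply, pull_two_apply, pull_three_apply, pull_four_apply, pull_five_apply]

section Frame

variable [IsTopologicalAddGroup W] [ContinuousSMul ℝ W] [T2Space W]

/-- The torsion form of degree 2 of the cylinder. -/
def torsionTwo (T : V →L[ℝ] W) (θ : V [⋀^Fin 1]→L[ℝ] ℝ) (c : Basis (Fin 6) ℝ W)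
    (ω : W [⋀^Fin 2]→L[ℝ] ℝ) (Q : W [⋀^Fin 3]→L[ℝ] ℝ) (κ : W [⋀^Fin 1]→L[ℝ] ℝ)
    (σ₂ : W [⋀^Fin 2]→L[ℝ] ℝ) : V [⋀^Fin 2]→L[ℝ] ℝ :=
  (hodge c (frameVol c) 2 (κ ⋏[4] Q)).compContinuousLinearMap T
    - (hodge c (frameVol c) 1 (κ ⋏[5] (ω ⋏[4] ω))).compContinuousLinearMap T ⋏[2] θ
    - σ₂.compContinuousLinearMap T

/-- The torsion form of degree 3 of the cylinder. -/
def torsionThree (T : V →L[ℝ] W) (θ : V [⋀^Fin 1]→L[ℝ] ℝ) (c : Basis (Fin 6) ℝ W) (r : ℝ)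
    (ω : W [⋀^Fin 2]→L[ℝ] ℝ) (P : W [⋀^Fin 3]→L[ℝ] ℝ) (μ : W [⋀^Fin 1]→L[ℝ] ℝ)
    (π₂ : W [⋀^Fin 2]→L[ℝ] ℝ) (ν₃ : W [⋀^Fin 3]→L[ℝ] ℝ) : V [⋀^Fin 3]→L[ℝ] ℝ :=
  (-(3 / 14) * r) • P.compContinuousLinearMap T
    + (2 / 7 * r) • (ω.compContinuousLinearMap T ⋏[3] θ)
    + (hodge c (frameVol c) 3 (μ ⋏[3] ω)).compContinuousLinearMap T
    + (hodge c (frameVol c) 2 (μ ⋏[4] P)).compContinuousLinearMap T ⋏[3] θ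
    + π₂.compContinuousLinearMap T ⋏[3] θ
    - (hodge c (frameVol c) 3 ν₃).compContinuousLinearMap T

variable {ω : W [⋀^Fin 2]→L[ℝ] ℝ} {P Q : W [⋀^Fin 3]→L[ℝ] ℝ} {c : Basis (Fin 6) ℝ W}
  {b : Basis (Fin 7) ℝ V} {T : V →L[ℝ] W} {θ : V [⋀^Fin 1]→L[ℝ] ℝ}

theorem torsionTwo_apply (κ : W [⋀^Fin 1]→L[ℝ] ℝ) (σ₂ : W [⋀^Fin 2]→L[ℝ] ℝ) (u v : V) :
    torsionTwo T θ c ω Q κ σ₂ ![u, v] =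
      (hodge c (frameVol c) 2 (κ ⋏[4] Q)) ![T u, T v]
      - ((hodge c (frameVol c) 1 (κ ⋏[5] (ω ⋏[4] ω))) ![T u] * θ ![v]
        - (hodge c (frameVol c) 1 (κ ⋏[5] (ω ⋏[4] ω))) ![T v] * θ ![u])
      - σ₂ ![T u, T v] := by
  rw [torsionTwo]
  generalize (hodge c (frameVol c) 1 (κ ⋏[5] (ω ⋏[4] ω))) = A
  generalize (hodge c (frameVol c) 2 (κ ⋏[4] Q)) = B
  exact pull_sub_wedge_sub_apply A B σ₂ u v

theorem torsionThree_apply (r : ℝ) (μ : W [⋀^Fin 1]→L[ℝ] ℝ) (π₂ : W [⋀^Fin 2]→L[ℝ] ℝ)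
    (ν₃ : W [⋀^Fin 3]→L[ℝ] ℝ) (u v w : V) :
    torsionThree T θ c r ω P μ π₂ ν₃ ![u, v, w] =
      -(3 / 14) * r * P ![T u, T v, T w]
      + (2 / 7 * r) * (ω ![T u, T v] * θ ![w] - ω ![T u, T w] * θ ![v] + ω ![T v, T w] * θ ![u])
      + (hodge c (frameVol c) 3 (μ ⋏[3] ω)) ![T u, T v, T w]
      + ((hodge c (frameVol c) 2 (μ ⋏[4] P)) ![T u, T v] * θ ![w]
        - (hodge c (frameVol c) 2 (μ ⋏[4] P)) ![T u, T w] * θ ![v]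
        + (hodge c (frameVol c) 2 (μ ⋏[4] P)) ![T v, T w] * θ ![u])
      + (π₂ ![T u, T v] * θ ![w] - π₂ ![T u, T w] * θ ![v] + π₂ ![T v, T w] * θ ![u])
      - (hodge c (frameVol c) 3 ν₃) ![T u, T v, T w] := by
  rw [torsionThree]
  simp only [ContinuousAlternatingMap.add_apply, ContinuousAlternatingMap.sub_apply,
    ContinuousAlternatingMap.smul_apply]
  simp only [wedge_two_one_apply]
  simp only [pull_one_apply, pull_two_apply, pull_three_apply, pull_four_apply, pull_five_apply,
    smul_eq_mul]

/-- `*(κ ∧ ω²)` is twice the composition of `κ` with the complex structure, up to sign. -/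
theorem IsSU3Frame.hodge_wedge_sq (hF : IsSU3Frame ω P Q c) (κ : W [⋀^Fin 1]→L[ℝ] ℝ) (h) :
    hodge c (frameVol c) 1 (κ ⋏[5] (ω ⋏[4] ω)) h ![c 0] = -(2 * κ ![c 1]) ∧
    hodge c (frameVol c) 1 (κ ⋏[5] (ω ⋏[4] ω)) h ![c 1] = 2 * κ ![c 0] ∧
    hodge c (frameVol c) 1 (κ ⋏[5] (ω ⋏[4] ω)) h ![c 2] = -(2 * κ ![c 3]) ∧
    hodge c (frameVol c) 1 (κ ⋏[5] (ω ⋏[4] ω)) h ![c 3] = 2 * κ ![c 2] ∧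
    hodge c (frameVol c) 1 (κ ⋏[5] (ω ⋏[4] ω)) h ![c 4] = -(2 * κ ![c 5]) ∧
    hodge c (frameVol c) 1 (κ ⋏[5] (ω ⋏[4] ω)) h ![c 5] = 2 * κ ![c 4] := by
  refine ⟨?_, ?_, ?_, ?_, ?_, ?_⟩
  all_goals
    simp only [hodge_six_one_apply, wedge_one_four_apply, wedge_two_two_apply]
    simp only [hF.two]
    ring

/-- A primitive (1,1)-form is annihilated by ω² and by Im Ψ, and *(κ ∧ Q), being of type (2,0) +
(0,2), by ω². The two remaining terms, *(κ ∧ Q) ∧ Q ∧ θ and −½ *(κ ∧ ω²) ∧ θ ∧ ω², cancel; this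
fixes the relative coefficient of the κ-terms. -/
theorem torsionTwo_wedge_cylinderDual (hF : IsSU3Frame ω P Q c) (hT : IsLift T θ c b)
    (κ : W [⋀^Fin 1]→L[ℝ] ℝ) {σ₂ : W [⋀^Fin 2]→L[ℝ] ℝ} (h2 : IsPrimitiveTwo σ₂ c) :
    torsionTwo T θ c ω Q κ σ₂ ⋏[6] cylinderDual T θ ω Q = 0 := by
  refine ext_seven_six b (forall_lt_six ?_ ?_ ?_ ?_ ?_ ?_ ?_)
  all_goals
    simp only [ContinuousAlternatingMap.coe_zero, Pi.zero_apply, wedge_two_four_apply,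
      (isG2Frame_cylinder hF hT).four, mul_zero, zero_mul, add_zero, zero_add, sub_zero,
      smul_eq_mul, mul_one]
    simp only [torsionTwo_apply, ContinuousAlternatingMap.sub_apply,
      pull_one_apply, pull_two_apply, pull_three_apply, pull_four_apply, pull_five_apply,
      wedge_one_one_apply, hT.map_zero', hT.map_one', hT.map_two',
      hT.map_three', hT.map_four', hT.map_five', hT.map_six', hT.coord, mul_zero, zero_mul,
      add_zero, zero_add, sub_zero, smul_eq_mul, mul_one, apply_vecCons_zero,
      apply_pair_zero, hF.hodge_wedge_sq, hodge_six_two_apply, h2.c13, h2.c12, h2.c15, h2.c14,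
      h2.c35, h2.c34, h2.c45]
    simp only [mul_zero, zero_mul, add_zero, zero_add, sub_zero, smul_eq_mul, mul_one,
      wedge_one_three_apply, hF.im]
    linarith

/-- The two μ-terms cancel against each other, and every other product vanishes separately: ω ∧ P =
0 and P ∧ P = 0, and π₂ and *ν₃ are primitive of the types that P and ω annihilate. -/
theorem torsionThree_wedge_cylinderForm (hF : IsSU3Frame ω P Q c) (hT : IsLift T θ c b) (r : ℝ)
    (μ : W [⋀^Fin 1]→L[ℝ] ℝ) {π₂ : W [⋀^Fin 2]→L[ℝ] ℝ} (h2 : IsPrimitiveTwo π₂ c)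
    {ν₃ : W [⋀^Fin 3]→L[ℝ] ℝ} (h3 : IsPrimitiveThree ν₃ c) :
    torsionThree T θ c r ω P μ π₂ ν₃ ⋏[6] cylinderForm T θ ω P = 0 := by
  refine ext_seven_six b (forall_lt_six ?_ ?_ ?_ ?_ ?_ ?_ ?_)
  all_goals
    simp only [ContinuousAlternatingMap.coe_zero, Pi.zero_apply, wedge_three_three_apply,
      (isG2Frame_cylinder hF hT).three, mul_zero, zero_mul, add_zero, zero_add, sub_zero,
      smul_eq_mul, mul_one]
    simp only [torsionThree_apply, ContinuousAlternatingMap.add_apply,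
      ContinuousAlternatingMap.smul_apply, ContinuousAlternatingMap.sub_apply,
      pull_one_apply, pull_two_apply, pull_three_apply, pull_four_apply, pull_five_apply,
      wedge_two_one_apply, hT.map_zero', hT.map_one', hT.map_two',
      hT.map_three', hT.map_four', hT.map_five', hT.map_six', hT.coord, mul_zero, zero_mul,
      add_zero, zero_add, sub_zero, smul_eq_mul, mul_one,
      apply_pair_zero, apply_triple_zero, hodge_six_three_apply, hodge_six_two_apply, h2.c13,
      h2.c12, h2.c15, h2.c14, h2.c35, h2.c34, h2.c45, h3.c045, h3.c145, h3.c245, h3.c345, h3.c234,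
      h3.c235, h3.c135, h3.c024]
    simp only [mul_zero, zero_mul, add_zero, zero_add, sub_zero, smul_eq_mul, mul_one,
      wedge_one_two_apply, wedge_one_three_apply, hF.two, hF.re]
    linarith

/-- The ratio of −3/14 to 2/7 is dictated here: with P ∧ Q = 4 vol and ω³ = 6 vol, the terms −(3/14)
P ∧ Q ∧ θ and (2/7)·½ ω³ ∧ θ add up to zero. -/
theorem torsionThree_wedge_cylinderDual (hF : IsSU3Frame ω P Q c) (hT : IsLift T θ c b) (r : ℝ)
    (μ : W [⋀^Fin 1]→L[ℝ] ℝ) {π₂ : W [⋀^Fin 2]→L[ℝ] ℝ} (h2 : IsPrimitiveTwo π₂ c)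
    {ν₃ : W [⋀^Fin 3]→L[ℝ] ℝ} (h3 : IsPrimitiveThree ν₃ c) :
    torsionThree T θ c r ω P μ π₂ ν₃ ⋏[7] cylinderDual T θ ω Q = 0 := by
  refine ext_seven_seven b ?_
  simp only [ContinuousAlternatingMap.coe_zero, Pi.zero_apply, wedge_three_four_apply,
    (isG2Frame_cylinder hF hT).four, mul_zero, zero_mul, add_zero, zero_add, sub_zero, smul_eq_mul,
    mul_one]
  simp only [torsionThree_apply, ContinuousAlternatingMap.add_apply,
    ContinuousAlternatingMap.smul_apply, ContinuousAlternatingMap.sub_apply,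
    pull_one_apply, pull_two_apply, pull_three_apply, pull_four_apply, pull_five_apply,
    wedge_two_one_apply, hT.map_zero', hT.map_one', hT.map_two',
    hT.map_three', hT.map_four', hT.map_five', hT.map_six', hT.coord, mul_zero, zero_mul, add_zero,
    zero_add, sub_zero, smul_eq_mul, mul_one, apply_pair_zero,
    apply_triple_zero, hodge_six_three_apply, hodge_six_two_apply, h2.c13, h2.c12, h2.c15, h2.c14,
    h2.c35, h2.c34, h2.c45, h3.c045, h3.c145, h3.c245, h3.c345, h3.c234, h3.c235, h3.c135, h3.c024]
  simp only [mul_zero, zero_mul, add_zero, zero_add, sub_zero, smul_eq_mul, mul_one,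
    wedge_one_two_apply, wedge_one_three_apply, hF.two, hF.re]
  linarith

set_option maxHeartbeats 4000000 in
/-- The structure equation for the exterior derivative of `*φ` on the cylinder. -/
theorem d_cylinderDual_eq (hF : IsSU3Frame ω P Q c) (hT : IsLift T θ c b) (a s m : ℝ)
    {ν π κ : W [⋀^Fin 1]→L[ℝ] ℝ} (hκ : κ = (1 / 3 : ℝ) • ((2 : ℝ) • ν - π))
    {σ₂ : W [⋀^Fin 2]→L[ℝ] ℝ} (h2 : IsPrimitiveTwo σ₂ c)
    {ν₃ : W [⋀^Fin 3]→L[ℝ] ℝ} (h3 : IsPrimitiveThree ν₃ c) :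
    (((-(3 / 2) * s) • P + (3 / 2 * a) • Q + ν ⋏[3] ω + ν₃) ⋏[5] ω).compContinuousLinearMap T
      + (2 * m) • (θ ⋏[5] (ω ⋏[4] ω).compContinuousLinearMap T)
      + (s • (ω ⋏[4] ω) + π ⋏[4] Q - σ₂ ⋏[4] ω).compContinuousLinearMap T ⋏[5] θ =
    (4 : ℝ) • (torsionOne T θ s m ν π ⋏[5] cylinderDual T θ ω Q)
      + torsionTwo T θ c ω Q κ σ₂ ⋏[5] cylinderForm T θ ω P := by
  refine ext_seven_five b (forall_lt_five ?_ ?_ ?_ ?_ ?_ ?_ ?_ ?_ ?_ ?_ ?_ ?_ ?_ ?_ ?_ ?_ ?_ ?_ ?_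
    ?_ ?_)
  all_goals
    -- The model forms are evaluated first: most of their components vanish, so few components of
    -- the torsion forms have to be expanded. Each case then ends as an identity linear in monomials
    -- of the components.
    simp only [ContinuousAlternatingMap.add_apply,
      ContinuousAlternatingMap.smul_apply, ContinuousAlternatingMap.sub_apply, mul_zero, zero_mul,
      add_zero, zero_add, sub_zero, smul_eq_mul, mul_one,
      wedge_two_three_apply (torsionTwo T θ c ω Q κ σ₂),
      wedge_one_four_apply (torsionOne T θ s m ν π), (isG2Frame_cylinder hF hT).three,
      (isG2Frame_cylinder hF hT).four]
    simp only [torsionOne_apply, torsionTwo_apply, ContinuousAlternatingMap.add_apply,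
      ContinuousAlternatingMap.smul_apply, ContinuousAlternatingMap.sub_apply,
      pull_one_apply, pull_two_apply, pull_three_apply, pull_four_apply, pull_five_apply,
      wedge_one_one_apply,
      wedge_one_four_apply θ, wedge_three_two_apply, wedge_four_one_apply, hT.map_zero',
      hT.map_one', hT.map_two', hT.map_three', hT.map_four',
      hT.map_five', hT.map_six', hT.coord, mul_zero, zero_mul, add_zero, zero_add, sub_zero,
      smul_eq_mul, mul_one, apply_vecCons_zero, apply_pair_zero, apply_triple_zero,
      apply_quadruple_zero, hF.hodge_wedge_sq, hodge_six_two_apply, h2.c13, h2.c12, h2.c15,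
      h2.c14, h2.c35, h2.c34, h2.c45, h3.c045, h3.c145, h3.c245, h3.c345, h3.c234, h3.c235,
      h3.c135, h3.c024]
    simp only [mul_zero, zero_mul, add_zero, zero_add, sub_zero, smul_eq_mul, mul_one,
      wedge_one_two_apply, wedge_one_three_apply, wedge_one_four_apply, wedge_two_two_apply,
      hF.two, hF.re, hF.im, hκ, ContinuousAlternatingMap.smul_apply,
      ContinuousAlternatingMap.sub_apply, h2.c13, h2.c12, h2.c15,
      h2.c14, h2.c35, h2.c34, h2.c45]
    linarith

set_option maxHeartbeats 4000000 in
/-- The structure equation for the exterior derivative of `φ` on the cylinder. -/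
theorem d_cylinderForm_eq [IsTopologicalAddGroup V] [ContinuousSMul ℝ V] [T2Space V]
    (hF : IsSU3Frame ω P Q c) (hT : IsLift T θ c b) (a s k m : ℝ)
    {ν π μ : W [⋀^Fin 1]→L[ℝ] ℝ} (hμ : μ = (1 / 2 : ℝ) • (π - ν)) {π₂ : W [⋀^Fin 2]→L[ℝ] ℝ}
    (h2 : IsPrimitiveTwo π₂ c) (ν₃ : W [⋀^Fin 3]→L[ℝ] ℝ) :
    ((-(3 / 2) * s) • P + (3 / 2 * a) • Q + ν ⋏[3] ω + ν₃).compContinuousLinearMap T ⋏[4] θ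
      + (3 * m) • (θ ⋏[4] P.compContinuousLinearMap T)
      - k • (θ ⋏[4] Q.compContinuousLinearMap T)
      + (a • (ω ⋏[4] ω) + π ⋏[4] P - π₂ ⋏[4] ω).compContinuousLinearMap T =
    (4 / 7 * (3 * a + k)) • cylinderDual T θ ω Q
      + (3 : ℝ) • (torsionOne T θ s m ν π ⋏[4] cylinderForm T θ ω P)
      + hodge b (frameVol b) 4 (torsionThree T θ c (a - 2 * k) ω P μ π₂ ν₃) := by
  refine ext_seven_four b (forall_lt_four ?_ ?_ ?_ ?_ ?_ ?_ ?_ ?_ ?_ ?_ ?_ ?_ ?_ ?_ ?_ ?_ ?_ ?_ ?_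
    ?_ ?_ ?_ ?_ ?_ ?_ ?_ ?_ ?_ ?_ ?_ ?_ ?_ ?_ ?_ ?_)
  all_goals
    -- The order of evaluation is the same. No relations on ν₃ are needed: it occurs on the left as
    -- ν₃ ∧ θ, which is also the 7-dimensional star of −*ν₃.
    simp only [ContinuousAlternatingMap.add_apply,
      ContinuousAlternatingMap.smul_apply, ContinuousAlternatingMap.sub_apply, mul_zero, zero_mul,
      add_zero, zero_add, sub_zero, smul_eq_mul, mul_one,
      wedge_one_three_apply (torsionOne T θ s m ν π), (isG2Frame_cylinder hF hT).three,
      (isG2Frame_cylinder hF hT).four, hodge_seven_four_apply]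
    simp only [torsionOne_apply, torsionThree_apply, ContinuousAlternatingMap.add_apply,
      ContinuousAlternatingMap.smul_apply, ContinuousAlternatingMap.sub_apply,
      pull_one_apply, pull_two_apply, pull_three_apply, pull_four_apply, pull_five_apply,
      wedge_one_three_apply θ,
      wedge_two_one_apply, wedge_three_one_apply, hT.map_zero',
      hT.map_one', hT.map_two', hT.map_three', hT.map_four', hT.map_five', hT.map_six', hT.coord,
      mul_zero, zero_mul, add_zero, zero_add, sub_zero, smul_eq_mul, mul_one,
      apply_vecCons_zero, apply_pair_zero, apply_triple_zero, apply_quadruple_zero,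
      hodge_six_three_apply, hodge_six_two_apply, h2.c13, h2.c12, h2.c15, h2.c14, h2.c35, h2.c34,
      h2.c45]
    simp only [mul_zero, zero_mul, add_zero, zero_add, sub_zero, smul_eq_mul, mul_one,
      wedge_one_two_apply, wedge_one_three_apply, wedge_two_two_apply, hF.two, hF.re, hF.im,
      hμ, ContinuousAlternatingMap.smul_apply, ContinuousAlternatingMap.sub_apply, h2.c13, h2.c12,
      h2.c15, h2.c14, h2.c35, h2.c34, h2.c45]
    linarith

end Frame

end ExtAlg

/-! ### Adapted frames of an SU(3) vector space -/

namespace ExtAlg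

variable {W : Type*} [AddCommGroup W] [Module ℝ W] [TopologicalSpace W]

theorem apply_pair_swap (η : W [⋀^Fin 2]→L[ℝ] ℝ) (u v : W) : η ![v, u] = -η ![u, v] := by
  refine Eq.trans (congrArg η ?_) (η.toAlternatingMap.map_swap ![u, v] (i := 0) (j := 1) (by
    decide))
  ext i; fin_cases i <;> rfl

theorem apply_triple_swap_left (η : W [⋀^Fin 3]→L[ℝ] ℝ) (u v w : W) :
    η ![v, u, w] = -η ![u, v, w] := by
  refine Eq.trans (congrArg η ?_) (η.toAlternatingMap.map_swap ![u, v, w] (i := 0) (j := 1) (by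
    decide))
  ext i; fin_cases i <;> rfl

theorem apply_triple_swap_right (η : W [⋀^Fin 3]→L[ℝ] ℝ) (u v w : W) :
    η ![u, w, v] = -η ![u, v, w] := by
  refine Eq.trans (congrArg η ?_) (η.toAlternatingMap.map_swap ![u, v, w] (i := 1) (j := 2) (by
    decide))
  ext i; fin_cases i <;> rfl

theorem apply_triple_self_left (η : W [⋀^Fin 3]→L[ℝ] ℝ) (u v : W) : η ![u, u, v] = 0 :=
  η.map_eq_zero_of_eq _ (i := 0) (j := 1) rfl (by decide)

theorem apply_triple_self_right (η : W [⋀^Fin 3]→L[ℝ] ℝ) (u v : W) : η ![v, u, u] = 0 :=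
  η.map_eq_zero_of_eq _ (i := 1) (j := 2) rfl (by decide)

theorem apply_pair_neg_left (η : W [⋀^Fin 2]→L[ℝ] ℝ) (u v : W) : η ![-u, v] = -η ![u, v] := by
  have h := η.map_update_smul ![u, v] 0 (-1) u
  have key : ∀ y, Function.update ![u, v] 0 y = ![y, v] := fun y => by
    ext i; fin_cases i <;> rfl
  simpa only [key, neg_smul, one_smul] using h

theorem apply_pair_neg_right (η : W [⋀^Fin 2]→L[ℝ] ℝ) (u v : W) : η ![u, -v] = -η ![u, v] := by
  rw [apply_pair_swap, apply_pair_neg_left, apply_pair_swap η u v, neg_neg]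

theorem apply_triple_sub_smul (η : W [⋀^Fin 3]→L[ℝ] ℝ) (u v w x : W) (p q : ℝ) :
    η ![u, v, p • w - q • x] = p * η ![u, v, w] - q * η ![u, v, x] := by
  have h := η.map_update_sub ![u, v, w] 2 (p • w) (q • x)
  have h1 := η.map_update_smul ![u, v, w] 2 p w
  have h2 := η.map_update_smul ![u, v, w] 2 q x
  have key : ∀ y, Function.update ![u, v, w] 2 y = ![u, v, y] := fun y => by
    ext i; fin_cases i <;> rfl
  simp only [key] at h h1 h2
  rw [h, h1, h2, smul_eq_mul, smul_eq_mul]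

/-- A unit vector orthogonal to fewer than `dim W` given vectors. -/
theorem exists_unit_orthogonal {n : ℕ} (g : W →L[ℝ] W →L[ℝ] ℝ) (pos : ∀ v, v ≠ 0 → 0 < g v v)
    (hn : n < finrank ℝ W) (s : Fin n → W) : ∃ v, g v v = 1 ∧ ∀ i, g (s i) v = 0 := by
  have : FiniteDimensional ℝ W := FiniteDimensional.of_finrank_pos (by omega)
  -- Fewer than dim W linear functionals have a common nonzero zero, which is then normalised.
  let A : W →ₗ[ℝ] (Fin n → ℝ) := LinearMap.pi fun i => (g (s i)).toLinearMap
  have hA : LinearMap.ker A ≠ ⊥ := LinearMap.ker_ne_bot_of_finrank_lt (by simpa using hn)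
  obtain ⟨v, hv, hv0⟩ := (Submodule.ne_bot_iff _).1 hA
  have hv' : ∀ i, g (s i) v = 0 := fun i => congrFun (LinearMap.mem_ker.1 hv) i
  have hp := pos v hv0
  refine ⟨(Real.sqrt (g v v))⁻¹ • v, ?_, fun i => by simp [hv' i]⟩
  simp only [map_smul, smul_apply, smul_eq_mul]
  rw [← mul_assoc, ← mul_inv, Real.mul_self_sqrt hp.le, inv_mul_cancel₀ hp.ne']

/-- A hermitian vector space together with a form of type `(3, 0)`, in real terms. -/
structure IsHermitian (g : W →L[ℝ] W →L[ℝ] ℝ) (J : W →L[ℝ] W) (ω : W [⋀^Fin 2]→L[ℝ] ℝ)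
    (P Q : W [⋀^Fin 3]→L[ℝ] ℝ) : Prop where
  symm : ∀ u v, g u v = g v u
  pos : ∀ v, v ≠ 0 → 0 < g v v
  J_sq : ∀ u, J (J u) = -u
  isometry : ∀ u v, g (J u) (J v) = g u v
  ω_apply : ∀ u v, ω ![u, v] = g (J u) v
  type_re : ∀ u v w, P ![J u, v, w] = -Q ![u, v, w]
  type_im : ∀ u v w, Q ![J u, v, w] = P ![u, v, w]

/-- The complex frame spanned by three vectors. -/
def complexFrame (J : W →L[ℝ] W) (x y z : W) : Fin 6 → W := ![x, J x, y, J y, z, J z]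

namespace IsHermitian

variable {g : W →L[ℝ] W →L[ℝ] ℝ} {J : W →L[ℝ] W} {ω : W [⋀^Fin 2]→L[ℝ] ℝ}
  {P Q : W [⋀^Fin 3]→L[ℝ] ℝ}

theorem g_J_left (H : IsHermitian g J ω P Q) (u v : W) : g (J u) v = -g u (J v) := by
  rw [← H.isometry (J u) v, H.J_sq]; simp

theorem g_J_self (H : IsHermitian g J ω P Q) (u : W) : g u (J u) = 0 := by
  have := H.g_J_left u u
  rw [H.symm] at this
  linarith

theorem g_self_J (H : IsHermitian g J ω P Q) (u : W) : g (J u) u = 0 := by rw [H.symm, H.g_J_self]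

/-- Complex linearity of Ψ is assumed in the first slot only; alternation carries it to the other
two. -/
theorem re_mid (H : IsHermitian g J ω P Q) (u v w : W) : P ![u, J v, w] = -Q ![u, v, w] := by
  rw [apply_triple_swap_left, H.type_re, apply_triple_swap_left Q u v, neg_neg]

theorem re_right (H : IsHermitian g J ω P Q) (u v w : W) : P ![u, v, J w] = -Q ![u, v, w] := by
  rw [apply_triple_swap_right, H.re_mid, apply_triple_swap_right Q u v, neg_neg]

theorem im_mid (H : IsHermitian g J ω P Q) (u v w : W) : Q ![u, J v, w] = P ![u, v, w] := by
  rw [apply_triple_swap_left, H.type_im, apply_triple_swap_left P u v, neg_neg]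

theorem im_right (H : IsHermitian g J ω P Q) (u v w : W) : Q ![u, v, J w] = P ![u, v, w] := by
  rw [apply_triple_swap_right, H.im_mid, apply_triple_swap_right P u v, neg_neg]

/-- `x, y, z` is a unitary basis. -/
structure _root_.ExtAlg.IsUnitary (g : W →L[ℝ] W →L[ℝ] ℝ) (J : W →L[ℝ] W) (x y z : W) : Prop where
  xx : g x x = 1
  yy : g y y = 1
  zz : g z z = 1
  xy : g x y = 0
  Jxy : g (J x) y = 0
  xz : g x z = 0
  Jxz : g (J x) z = 0
  yz : g y z = 0
  Jyz : g (J y) z = 0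

theorem orthonormal (H : IsHermitian g J ω P Q) {x y z : W} (h : IsUnitary g J x y z) (i j : Fin 6)
    :
    g (complexFrame J x y z i) (complexFrame J x y z j) = if i = j then 1 else 0 := by
  obtain ⟨h1, h2, h3, h4, h5, h6, h7, h8, h9⟩ := h
  have h4' : g y x = 0 := by rw [H.symm, h4]
  have h6' : g z x = 0 := by rw [H.symm, h6]
  have h8' : g z y = 0 := by rw [H.symm, h8]
  have a1 : g x (J y) = 0 := by linarith [H.g_J_left x y]
  have a2 : g x (J z) = 0 := by linarith [H.g_J_left x z]
  have a3 : g y (J z) = 0 := by linarith [H.g_J_left y z]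
  have a4 : g y (J x) = 0 := by rw [H.symm, h5]
  have a5 : g z (J x) = 0 := by rw [H.symm, h7]
  have a6 : g z (J y) = 0 := by rw [H.symm, h9]
  have a7 : g (J y) x = 0 := by rw [H.symm, a1]
  have a8 : g (J z) x = 0 := by rw [H.symm, a2]
  have a9 : g (J z) y = 0 := by rw [H.symm, a3]
  fin_cases i <;> fin_cases j <;>
    simp [complexFrame, H.isometry, H.g_J_self, H.g_self_J, *]

/-- Complex Gram–Schmidt: being orthogonal to v and to Jv amounts to hermitian orthogonality, and
the real spans already used have dimension at most 0, 2 and 4. -/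
theorem exists_unitary (H : IsHermitian g J ω P Q) (hW : finrank ℝ W = 6) : ∃ x y z, IsUnitary g J
    x y z := by
  obtain ⟨x, hx, -⟩ := exists_unit_orthogonal g H.pos (by rw [hW]; norm_num : 0 < _) ![]
  obtain ⟨y, hy, hxy⟩ := exists_unit_orthogonal g H.pos (by rw [hW]; norm_num : 2 < _) ![x, J x]
  obtain ⟨z, hz, hxz⟩ :=
    exists_unit_orthogonal g H.pos (by rw [hW]; norm_num : 4 < _) ![x, J x, y, J y]
  exact ⟨x, y, z, hx, hy, hz, hxy 0, hxy 1, hxz 0, hxz 1, hxz 2, hxz 3⟩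

/-- A unitary basis as a real basis. -/
theorem exists_basis (H : IsHermitian g J ω P Q) (hW : finrank ℝ W = 6) {x y z : W} (h : IsUnitary
    g J x y z) :
    ∃ c : Basis (Fin 6) ℝ W, ⇑c = complexFrame J x y z := by
  have hli : LinearIndependent ℝ (complexFrame J x y z) := by
    rw [Fintype.linearIndependent_iff]
    intro a ha i
    have := congrArg (g (complexFrame J x y z i)) ha
    simpa [map_sum, H.orthonormal h] using this
  exact ⟨basisOfLinearIndependentOfCardEqFinrank hli (by simp [hW]), by simp⟩

theorem frame_two (H : IsHermitian g J ω P Q) {x y z : W} (h : IsUnitary g J x y z) :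
    let c := complexFrame J x y z
    ω ![c 0, c 1] = 1 ∧ ω ![c 0, c 2] = 0 ∧ ω ![c 0, c 3] = 0 ∧ ω ![c 0, c 4] = 0 ∧
    ω ![c 0, c 5] = 0 ∧ ω ![c 1, c 2] = 0 ∧ ω ![c 1, c 3] = 0 ∧ ω ![c 1, c 4] = 0 ∧
    ω ![c 1, c 5] = 0 ∧ ω ![c 2, c 3] = 1 ∧ ω ![c 2, c 4] = 0 ∧ ω ![c 2, c 5] = 0 ∧
    ω ![c 3, c 4] = 0 ∧ ω ![c 3, c 5] = 0 ∧ ω ![c 4, c 5] = 1 := by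
  intro c
  have key : ∀ i j : Fin 6, g (c i) (c j) = if i = j then 1 else 0 := H.orthonormal h
  have J0 : J (c 0) = c 1 := rfl
  have J1 : J (c 1) = -c 0 := H.J_sq x
  have J2 : J (c 2) = c 3 := rfl
  have J3 : J (c 3) = -c 2 := H.J_sq y
  have J4 : J (c 4) = c 5 := rfl
  simp [H.ω_apply, J0, J1, J2, J3, J4, key]

/-- On a unitary frame ω³ takes the value 6, and type (3,0) makes P ∧ Q equal to 4|Ψ(x, y, z)|². The
factor 3/2 therefore normalises Ψ(x, y, z) to modulus one. -/
theorem normSq_eq_one (H : IsHermitian g J ω P Q) {x y z : W} (h : IsUnitary g J x y z)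
    (hn : (3 / 2 : ℝ) • (P ⋏[6] Q) = (ω ⋏[4] ω) ⋏[6] ω) :
    P ![x, y, z] ^ 2 + Q ![x, y, z] ^ 2 = 1 := by
  obtain ⟨w0, w1, w2, w3, w4, w5, w6, w7, w8, w9, w10, w11, w12, w13, w14⟩ := H.frame_two h
  have := congrArg (fun η => η ![x, J x, y, J y, z, J z]) hn
  simp only [complexFrame, Matrix.cons_val] at w0 w1 w2 w3 w4 w5 w6 w7 w8 w9 w10 w11 w12 w13 w14
  simp only [ContinuousAlternatingMap.smul_apply, wedge_three_three_apply, wedge_four_two_apply,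
    wedge_two_two_apply, H.type_re, H.type_im, H.re_mid, H.re_right, H.im_mid, H.im_right,
    apply_triple_self_left, apply_triple_self_right, w0, w1, w2, w3, w4, w5, w6, w7, w8, w9, w10,
    w11, w12, w13, w14, smul_eq_mul] at this
  linarith

/-- By complex trilinearity and alternation, the single value Ψ(x, y, z) determines all twenty
components. -/
theorem isSU3Frame (H : IsHermitian g J ω P Q) {x y z : W} (h : IsUnitary g J x y z) (hP : P ![x,
    y, z] = 1)
    (hQ : Q ![x, y, z] = 0) : IsSU3Frame ω P Q (complexFrame J x y z) := by
  refine ⟨H.frame_two h, ?_, ?_⟩ <;>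
  simp [complexFrame, H.type_re, H.type_im, H.re_mid, H.re_right, H.im_mid, H.im_right,
    apply_triple_self_left, apply_triple_self_right, hP, hQ]

/-- An `SU(3)`-structure on a vector space has adapted frames. -/
theorem exists_frame (H : IsHermitian g J ω P Q) (hW : finrank ℝ W = 6)
    (hn : (3 / 2 : ℝ) • (P ⋏[6] Q) = (ω ⋏[4] ω) ⋏[6] ω) :
    ∃ c : Basis (Fin 6) ℝ W, IsSU3Frame ω P Q c ∧
      (∀ i j, g (c i) (c j) = if i = j then 1 else 0) ∧
      J (c 0) = c 1 ∧ J (c 2) = c 3 ∧ J (c 4) = c 5 := by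
  obtain ⟨x, y, z, h⟩ := H.exists_unitary hW
  have h1 := H.normSq_eq_one h hn
  set p := P ![x, y, z]
  set q := Q ![x, y, z]
  -- Multiplying z by the unit complex number p − iq, the conjugate of Ψ(x, y, z), makes the new
  -- value |p + iq|² = 1.
  have hz : IsUnitary g J x y (p • z - q • J z) := by
    have a1 : g x (J z) = 0 := by linarith [H.g_J_left x z, h.Jxz]
    have a2 : g y (J z) = 0 := by linarith [H.g_J_left y z, h.Jyz]
    refine ⟨h.xx, h.yy, ?_, h.xy, h.Jxy, ?_, ?_, ?_, ?_⟩ <;>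
      simp [h.zz, h.xz, h.Jxz, h.yz, h.Jyz, a1, a2, H.isometry, H.g_J_self, H.g_self_J]
    linarith
  have hF := H.isSU3Frame hz (by rw [apply_triple_sub_smul, H.re_right]; linarith)
    (by rw [apply_triple_sub_smul, H.im_right]; simp only [p, q]; ring)
  obtain ⟨c, hc⟩ := H.exists_basis hW hz
  refine ⟨c, hc ▸ hF, fun i j => ?_, ?_, ?_, ?_⟩
  · rw [hc, H.orthonormal hz]
  all_goals rw [hc]; rfl

theorem ω_pow_three_apply {c : Fin 6 → W} (hF : IsSU3Frame ω P Q c) :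
    ((ω ⋏[4] ω) ⋏[6] ω) ![c 0, c 1, c 2, c 3, c 4, c 5] = 6 := by
  obtain ⟨w0, w1, w2, w3, w4, w5, w6, w7, w8, w9, w10, w11, w12, w13, w14⟩ := hF.two
  simp only [wedge_four_two_apply, wedge_two_two_apply, w0, w1, w2, w3, w4, w5, w6, w7, w8, w9,
    w10, w11, w12, w13, w14]
  norm_num

/-- J-invariance supplies the six off-diagonal relations; the wedge with ω² is a multiple of the
trace β₀₁ + β₂₃ + β₄₅ and supplies the seventh. -/
theorem isPrimitiveTwo (H : IsHermitian g J ω P Q) {c : Fin 6 → W} (hF : IsSU3Frame ω P Q c) (h0 :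
    J (c 0) = c 1)
    (h2 : J (c 2) = c 3) (h4 : J (c 4) = c 5) {β : W [⋀^Fin 2]→L[ℝ] ℝ}
    (hJ : ∀ u v, β ![J u, J v] = β ![u, v]) (hβ : β ⋏[6] (ω ⋏[4] ω) = 0) :
    IsPrimitiveTwo β c := by
  obtain ⟨w0, w1, w2, w3, w4, w5, w6, w7, w8, w9, w10, w11, w12, w13, w14⟩ := hF.two
  have h3 : J (c 3) = -c 2 := by rw [← h2, H.J_sq]
  have h5 : J (c 5) = -c 4 := by rw [← h4, H.J_sq]
  have e1 := hJ (c 0) (c 2)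
  have e2 := hJ (c 0) (c 3)
  have e3 := hJ (c 0) (c 4)
  have e4 := hJ (c 0) (c 5)
  have e5 := hJ (c 2) (c 4)
  have e6 := hJ (c 2) (c 5)
  rw [h0, h2] at e1
  rw [h0, h3, apply_pair_neg_right] at e2
  rw [h0, h4] at e3
  rw [h0, h5, apply_pair_neg_right] at e4
  rw [h2, h4] at e5
  rw [h2, h5, apply_pair_neg_right] at e6
  refine ⟨e1, by linarith, e3, by linarith, e5, by linarith, ?_⟩
  have := congrArg (fun η => η ![c 0, c 1, c 2, c 3, c 4, c 5]) hβ
  simp only [wedge_two_four_apply, wedge_two_two_apply, w0, w1, w2, w3, w4, w5, w6, w7, w8, w9,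
    w10, w11, w12, w13, w14, ContinuousAlternatingMap.coe_zero, Pi.zero_apply] at this
  linarith

end IsHermitian

section Vol

variable [IsTopologicalAddGroup W] [ContinuousSMul ℝ W] [T2Space W]

theorem frameVol_self {n : ℕ} (c : Basis (Fin n) ℝ W) : frameVol c c = 1 := c.det_self

/-- Top-degree forms have one component, since the identity is the only strictly increasing self-map
of `Fin n`. -/
theorem eq_smul_frameVol {n : ℕ} (c : Basis (Fin n) ℝ W) (η : W [⋀^Fin n]→L[ℝ] ℝ) :
    η = η c • frameVol c := by
  refine ext_strictMono c fun s hs => ?_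
  rw [hs.eq_id]
  simp [frameVol_self]

end Vol

end ExtAlg

/-! ### Linearity and naturality of the wedge product and the Hodge star -/

namespace ExtAlg

section Linearity

variable {V W : Type*} [AddCommGroup V] [Module ℝ V] [TopologicalSpace V]
  [AddCommGroup W] [Module ℝ W] [TopologicalSpace W] {n p q r : ℕ}

theorem wedge_apply (h : p + q = r) (α : V [⋀^Fin p]→L[ℝ] ℝ) (β : V [⋀^Fin q]→L[ℝ] ℝ)
    (v : Fin r → V) :
    wedge r α β h v = (p.factorial * q.factorial : ℝ)⁻¹ *
      ∑ σ : Equiv.Perm (Fin r), ((Equiv.Perm.sign σ : ℤ) : ℝ) *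
        (α (fun i => v (σ (Fin.cast h (Fin.castAdd q i)))) *
          β (fun i => v (σ (Fin.cast h (Fin.natAdd p i))))) := by
  rw [← factorial_mul_wedge_apply, inv_mul_cancel_left₀]
  positivity

theorem wedge_add_left (h : p + q = r) (α α' : V [⋀^Fin p]→L[ℝ] ℝ) (β : V [⋀^Fin q]→L[ℝ] ℝ) :
    wedge r (α + α') β h = wedge r α β h + wedge r α' β h := by
  ext v
  simp only [ContinuousAlternatingMap.add_apply, wedge_apply, add_mul, mul_add,
    Finset.sum_add_distrib]

theorem wedge_add_right (h : p + q = r) (α : V [⋀^Fin p]→L[ℝ] ℝ) (β β' : V [⋀^Fin q]→L[ℝ] ℝ) :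
    wedge r α (β + β') h = wedge r α β h + wedge r α β' h := by
  ext v
  simp only [ContinuousAlternatingMap.add_apply, wedge_apply, mul_add, Finset.sum_add_distrib]

theorem wedge_smul_left (h : p + q = r) (c : ℝ) (α : V [⋀^Fin p]→L[ℝ] ℝ)
    (β : V [⋀^Fin q]→L[ℝ] ℝ) : wedge r (c • α) β h = c • wedge r α β h := by
  ext v
  simp only [ContinuousAlternatingMap.smul_apply, wedge_apply, smul_eq_mul, Finset.mul_sum]
  refine Finset.sum_congr rfl fun σ _ => by ring

theorem wedge_smul_right (h : p + q = r) (c : ℝ) (α : V [⋀^Fin p]→L[ℝ] ℝ)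
    (β : V [⋀^Fin q]→L[ℝ] ℝ) : wedge r α (c • β) h = c • wedge r α β h := by
  ext v
  simp only [ContinuousAlternatingMap.smul_apply, wedge_apply, smul_eq_mul, Finset.mul_sum]
  refine Finset.sum_congr rfl fun σ _ => by ring

theorem wedge_sub_left (h : p + q = r) (α α' : V [⋀^Fin p]→L[ℝ] ℝ) (β : V [⋀^Fin q]→L[ℝ] ℝ) :
    wedge r (α - α') β h = wedge r α β h - wedge r α' β h := by
  ext v
  simp only [ContinuousAlternatingMap.sub_apply, wedge_apply, sub_mul, mul_sub,
    Finset.sum_sub_distrib]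

theorem wedge_sub_right (h : p + q = r) (α : V [⋀^Fin p]→L[ℝ] ℝ) (β β' : V [⋀^Fin q]→L[ℝ] ℝ) :
    wedge r α (β - β') h = wedge r α β h - wedge r α β' h := by
  ext v
  simp only [ContinuousAlternatingMap.sub_apply, wedge_apply, mul_sub, Finset.sum_sub_distrib]

theorem wedge_compContinuousLinearMap (h : p + q = r) (T : W →L[ℝ] V) (α : V [⋀^Fin p]→L[ℝ] ℝ)
    (β : V [⋀^Fin q]→L[ℝ] ℝ) :
    (wedge r α β h).compContinuousLinearMap T =
      wedge r (α.compContinuousLinearMap T) (β.compContinuousLinearMap T) h := by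
  ext v
  rw [ContinuousAlternatingMap.compContinuousLinearMap_apply, wedge_apply, wedge_apply]
  rfl

theorem hodge_add (h : p + q = n) (b : Fin n → V) (vol : V [⋀^Fin n]→L[ℝ] ℝ)
    (γ γ' : V [⋀^Fin p]→L[ℝ] ℝ) :
    hodge b vol q (γ + γ') h = hodge b vol q γ h + hodge b vol q γ' h := by
  ext v
  simp only [ContinuousAlternatingMap.add_apply, hodge_apply, mul_add, add_mul,
    Finset.sum_add_distrib]

theorem hodge_smul (h : p + q = n) (b : Fin n → V) (vol : V [⋀^Fin n]→L[ℝ] ℝ) (c : ℝ)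
    (γ : V [⋀^Fin p]→L[ℝ] ℝ) : hodge b vol q (c • γ) h = c • hodge b vol q γ h := by
  ext v
  simp only [ContinuousAlternatingMap.smul_apply, hodge_apply, smul_eq_mul, Finset.mul_sum]
  refine Finset.sum_congr rfl fun σ _ => by ring

theorem hodge_sub (h : p + q = n) (b : Fin n → V) (vol : V [⋀^Fin n]→L[ℝ] ℝ)
    (γ γ' : V [⋀^Fin p]→L[ℝ] ℝ) :
    hodge b vol q (γ - γ') h = hodge b vol q γ h - hodge b vol q γ' h := by
  ext v
  simp only [ContinuousAlternatingMap.sub_apply, hodge_apply, mul_sub, sub_mul,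
    Finset.sum_sub_distrib]

end Linearity

end ExtAlg

/-! ### The metric and orientation determined by a G₂ 3-form -/

namespace G2

open ExtAlg

variable {V : Type*} [AddCommGroup V] [Module ℝ V] [TopologicalSpace V]

/-- The component of `eˡ ∧ eᵐ ∧ eⁿ` on `(i, j, k)`. -/
def tripleSign (l m n i j k : Fin 7) : ℤ :=
  let δ : Fin 7 → Fin 7 → ℤ := fun x y => if x = y then 1 else 0
  (δ l i * δ m j - δ l j * δ m i) * δ n k - (δ l i * δ m k - δ l k * δ m i) * δ n j
    + (δ l j * δ m k - δ l k * δ m j) * δ n i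

/-- The structure constants of the model 3-form. -/
def structureSign (i j k : Fin 7) : ℤ :=
  tripleSign 0 1 6 i j k + tripleSign 2 3 6 i j k + tripleSign 4 5 6 i j k
    + tripleSign 0 2 4 i j k - tripleSign 0 3 5 i j k - tripleSign 1 2 5 i j k
    - tripleSign 1 3 4 i j k

section Adapted

variable [IsTopologicalAddGroup V] [ContinuousSMul ℝ V] [T2Space V]

theorem coframe_apply_basis {n : ℕ} (b : Basis (Fin n) ℝ V) (i j : Fin n) :
    coframe b i ![b j] = if i = j then 1 else 0 := by
  change b.coord i (b j) = _
  simp [Finsupp.single_apply, eq_comm]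

theorem e3_apply_basis (b : Basis (Fin 7) ℝ V) (l m n i j k : Fin 7) :
    e3 b l m n ![b i, b j, b k] = tripleSign l m n i j k := by
  simp only [e3, wedge_two_one_apply, wedge_one_one_apply, coframe_apply_basis, tripleSign]
  push_cast
  ring

theorem IsAdapted.apply {φ : V [⋀^Fin 3]→L[ℝ] ℝ} {b : Basis (Fin 7) ℝ V} (h : IsAdapted φ b)
    (i j k : Fin 7) : φ ![b i, b j, b k] = structureSign i j k := by
  rw [h]
  simp only [ContinuousAlternatingMap.add_apply, ContinuousAlternatingMap.sub_apply,
    e3_apply_basis, structureSign]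
  push_cast
  ring

theorem _root_.ExtAlg.IsG2Frame.isAdapted {φ : V [⋀^Fin 3]→L[ℝ] ℝ} {Φ : V [⋀^Fin 4]→L[ℝ] ℝ}
    {b : Basis (Fin 7) ℝ V} (h : IsG2Frame φ Φ b) : IsAdapted φ b := by
  refine ext_seven_three b (forall_lt_three ?_ ?_ ?_ ?_ ?_ ?_ ?_ ?_ ?_ ?_ ?_ ?_ ?_ ?_ ?_ ?_ ?_ ?_
    ?_ ?_ ?_ ?_ ?_ ?_ ?_ ?_ ?_ ?_ ?_ ?_ ?_ ?_ ?_ ?_ ?_)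
  all_goals
    rw [IsAdapted.apply (b := b) rfl]
    simp only [h.three]
    norm_cast

end Adapted

/-- The 7-form `φ ∧ ι_u φ ∧ ι_v φ`, which is a multiple of `⟨u, v⟩ vol`. -/
def metricForm (φ : V [⋀^Fin 3]→L[ℝ] ℝ) (u v : V) : V [⋀^Fin 7]→L[ℝ] ℝ :=
  φ ⋏[7] (interior u φ ⋏[4] interior v φ)

/-- After substitution of the integer structure constants this is a statement about 49 pairs of
indices, settled by evaluation. -/
theorem metricForm_apply_basis {φ : V [⋀^Fin 3]→L[ℝ] ℝ} {b : Fin 7 → V}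
    (h : ∀ i j k, φ ![b i, b j, b k] = structureSign i j k) (i j : Fin 7) :
    metricForm φ (b i) (b j) ![b 0, b 1, b 2, b 3, b 4, b 5, b 6] = if i = j then 6 else 0 := by
  simp only [metricForm, wedge_three_four_apply, wedge_two_two_apply, interior_apply, h]
  norm_cast
  revert i j
  decide +kernel

theorem metricForm_add_left (φ : V [⋀^Fin 3]→L[ℝ] ℝ) (u u' v : V) :
    metricForm φ (u + u') v = metricForm φ u v + metricForm φ u' v := by
  have : interior (u + u') φ = interior u φ + interior u' φ := by
    ext w; simp [interior_apply, ContinuousAlternatingMap.vecCons_add]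
  rw [metricForm, this, wedge_add_left, wedge_add_right]; rfl

theorem metricForm_smul_left (φ : V [⋀^Fin 3]→L[ℝ] ℝ) (r : ℝ) (u v : V) :
    metricForm φ (r • u) v = r • metricForm φ u v := by
  have : interior (r • u) φ = r • interior u φ := by
    ext w; simp [interior_apply, ContinuousAlternatingMap.vecCons_smul]
  rw [metricForm, this, wedge_smul_left, wedge_smul_right]; rfl

theorem metricForm_add_right (φ : V [⋀^Fin 3]→L[ℝ] ℝ) (u v v' : V) :
    metricForm φ u (v + v') = metricForm φ u v + metricForm φ u v' := by
  have : interior (v + v') φ = interior v φ + interior v' φ := by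
    ext w; simp [interior_apply, ContinuousAlternatingMap.vecCons_add]
  rw [metricForm, this, wedge_add_right, wedge_add_right]; rfl

theorem metricForm_smul_right (φ : V [⋀^Fin 3]→L[ℝ] ℝ) (r : ℝ) (u v : V) :
    metricForm φ u (r • v) = r • metricForm φ u v := by
  have : interior (r • v) φ = r • interior v φ := by
    ext w; simp [interior_apply, ContinuousAlternatingMap.vecCons_smul]
  rw [metricForm, this, wedge_smul_right, wedge_smul_right]; rfl

theorem metricForm_sum {κ : Type*} [Fintype κ] (φ : V [⋀^Fin 3]→L[ℝ] ℝ) (r s : κ → ℝ)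
    (b : κ → V) : metricForm φ (∑ k, r k • b k) (∑ l, s l • b l) =
      ∑ k, ∑ l, (r k * s l) • metricForm φ (b k) (b l) := by
  let B : V →ₗ[ℝ] V →ₗ[ℝ] (V [⋀^Fin 7]→L[ℝ] ℝ) := LinearMap.mk₂ ℝ (metricForm φ)
    (metricForm_add_left φ) (metricForm_smul_left φ) (metricForm_add_right φ)
    (metricForm_smul_right φ)
  change B _ _ = ∑ k, ∑ l, (r k * s l) • B (b k) (b l)
  simp only [map_sum, LinearMap.sum_apply, map_smul, LinearMap.smul_apply, smul_smul,
    Finset.smul_sum]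
  rw [Finset.sum_comm]
  simp only [mul_comm]

section Star

variable [IsTopologicalAddGroup V] [ContinuousSMul ℝ V] [T2Space V]

theorem apply_basis_eq_det_mul {n : ℕ} (b b' : Basis (Fin n) ℝ V) (η : V [⋀^Fin n]→L[ℝ] ℝ) :
    η b' = (b.toMatrix b').det * η b := by
  conv_lhs => rw [eq_smul_frameVol b η]
  rw [ContinuousAlternatingMap.smul_apply, smul_eq_mul, mul_comm]
  rfl

/-- The transition matrix between adapted bases is special orthogonal. -/
theorem IsAdapted.toMatrix {φ : V [⋀^Fin 3]→L[ℝ] ℝ} {b b' : Basis (Fin 7) ℝ V}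
    (h : IsAdapted φ b) (h' : IsAdapted φ b') :
    b.toMatrix b' * (b.toMatrix b').transpose = 1 ∧ (b.toMatrix b').det = 1 := by
  set A := b.toMatrix b' with hA
  have hb : ∀ i, b' i = ∑ k, A k i • b k := fun i => (b.sum_toMatrix_smul_self b' i).symm
  have vec : ∀ c : Basis (Fin 7) ℝ V, (![c 0, c 1, c 2, c 3, c 4, c 5, c 6] : Fin 7 → V) = c := by
    intro c; ext i; fin_cases i <;> rfl
  have h0 : ∀ {c : Basis (Fin 7) ℝ V}, IsAdapted φ c → ∀ k l,
      metricForm φ (c k) (c l) c = if k = l then 6 else 0 := by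
    intro c hc k l
    have h1 := metricForm_apply_basis (b := c) (fun i j k => hc.apply i j k) k l
    have h2 := congrArg (fun v => metricForm φ (c k) (c l) v) (vec c)
    exact h2.symm.trans h1
  -- The metric form has components 6δ in both bases. Passing from b to b' multiplies them by AᵀA
  -- through its two vector arguments and by det A because it is a 7-form.
  have key : A.det • (A.transpose * A) = 1 := by
    ext i j
    have h1 := h0 h' i j
    rw [apply_basis_eq_det_mul b b', hb i, hb j, metricForm_sum] at h1
    simp only [ContinuousAlternatingMap.sum_apply, ContinuousAlternatingMap.smul_apply,
      smul_eq_mul] at h1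
    simp only [h0 h] at h1
    simp only [mul_ite, mul_zero, Finset.sum_ite_eq, Finset.mem_univ, if_true] at h1
    rw [← Finset.sum_mul, ← hA] at h1
    simp only [Matrix.smul_apply, Matrix.mul_apply, Matrix.transpose_apply, smul_eq_mul,
      Matrix.one_apply]
    split_ifs at h1 ⊢ <;> linarith
  have hdet : A.det = 1 := by
    -- In dimension seven the scalar det A contributes (det A)⁷, so (det A)⁹ = 1; the exponent is
    -- odd, which excludes −1.
    have h9 := congrArg Matrix.det key
    rw [Matrix.det_smul, Matrix.det_mul, Matrix.det_transpose, Matrix.det_one, Fintype.card_fin]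
      at h9
    have : A.det ^ 9 = 1 := by rw [← h9]; ring
    have odd : Odd 9 := by decide
    exact odd.strictMono_pow.injective (by simpa using this)
  rw [hdet, one_smul] at key
  exact ⟨mul_eq_one_comm.1 key, hdet⟩

/-- The basis chosen in the definition of `star` differs from b by a matrix in SO(7), which changes
neither the volume form nor the sum over an orthonormal frame. -/
theorem star_eq_hodge {φ : V [⋀^Fin 3]→L[ℝ] ℝ} {b : Basis (Fin 7) ℝ V} (h : IsAdapted φ b)
    {p q : ℕ} (γ : V [⋀^Fin p]→L[ℝ] ℝ) (hpq : p + q = 7) :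
    star φ q γ hpq = hodge b (frameVol b) q γ hpq := by
  have hφ : ∃ b, IsAdapted φ b := ⟨b, h⟩
  rw [star, dif_pos hφ]
  obtain ⟨h1, h2⟩ := h.toMatrix hφ.choose_spec
  have hvol : frameVol hφ.choose = frameVol b := by
    rw [eq_smul_frameVol hφ.choose (frameVol b), apply_basis_eq_det_mul b, h2, frameVol_self,
      one_mul, one_smul]
  rw [hvol]
  exact hodge_eq_of_orthogonal hpq _ γ _ h1 _ _ fun i => (b.sum_toMatrix_smul_self _ i).symm

theorem _root_.ExtAlg.IsG2Frame.star_eq {φ : V [⋀^Fin 3]→L[ℝ] ℝ} {Φ : V [⋀^Fin 4]→L[ℝ] ℝ}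
    {b : Basis (Fin 7) ℝ V} (h : IsG2Frame φ Φ b) (hpq : 3 + 4 = 7) : star φ 4 φ hpq = Φ := by
  rw [star_eq_hodge h.isAdapted]
  refine ext_seven_four b (forall_lt_four ?_ ?_ ?_ ?_ ?_ ?_ ?_ ?_ ?_ ?_ ?_ ?_ ?_ ?_ ?_ ?_ ?_ ?_
    ?_ ?_ ?_ ?_ ?_ ?_ ?_ ?_ ?_ ?_ ?_ ?_ ?_ ?_ ?_ ?_ ?_)
  all_goals simp only [hodge_seven_four_apply, h.three, h.four, neg_zero, neg_neg]

end Star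

end G2

/-! ### Independence of the torsion components at a point -/

namespace G2

open ExtAlg

variable {V : Type*} [AddCommGroup V] [Module ℝ V] [TopologicalSpace V]

/-- `Ω⁵ = Λ¹ ∧ *φ ⊕ Ω²₁₄ ∧ φ`: the decomposition is direct. -/
theorem _root_.ExtAlg.IsG2Frame.eq_zero_of_five {φ : V [⋀^Fin 3]→L[ℝ] ℝ} {Φ : V [⋀^Fin 4]→L[ℝ] ℝ}
    {b : Basis (Fin 7) ℝ V} (h : IsG2Frame φ Φ b) {τ₁ : V [⋀^Fin 1]→L[ℝ] ℝ}
    {τ₂ : V [⋀^Fin 2]→L[ℝ] ℝ} (h2 : τ₂ ⋏[6] Φ = 0)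
    (h5 : (4 : ℝ) • (τ₁ ⋏[5] Φ) + τ₂ ⋏[5] φ = 0) : τ₁ = 0 ∧ τ₂ = 0 := by
  have five : ∀ i j k l m, ((4 : ℝ) • (τ₁ ⋏[5] Φ) + τ₂ ⋏[5] φ) ![b i, b j, b k, b l, b m] = 0 := by
    simp [h5]
  have six : ∀ i j k l m n, (τ₂ ⋏[6] Φ) ![b i, b j, b k, b l, b m, b n] = 0 := by
    simp [h2]
  simp only [ContinuousAlternatingMap.add_apply, ContinuousAlternatingMap.smul_apply,
    wedge_one_four_apply, wedge_two_three_apply, smul_eq_mul] at five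
  simp only [wedge_two_four_apply] at six
  -- The 28 unknowns fall into seven blocks. Block i consists of τ₁(b i) and the values of τ₂ on the
  -- three pairs that complete i to a triple of φ. Three 5-form components and one 6-form component
  -- determine each block.
  have e0 : τ₁ ![b 0] = 0 ∧ τ₂ ![b 1, b 6] = 0 ∧ τ₂ ![b 2, b 4] = 0 ∧ τ₂ ![b 3, b 5] = 0 := by
    have a0 := five 0 2 3 4 5
    have a1 := five 0 1 3 5 6
    have a2 := five 0 1 2 4 6
    have a3 := six 1 2 3 4 5 6
    simp only [h.three, h.four, mul_zero, mul_one, add_zero, zero_add, sub_zero, zero_sub, mul_neg]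
      at a0 a1 a2 a3
    refine ⟨?_, ?_, ?_, ?_⟩ <;> linarith
  have e1 : τ₁ ![b 1] = 0 ∧ τ₂ ![b 0, b 6] = 0 ∧ τ₂ ![b 2, b 5] = 0 ∧ τ₂ ![b 3, b 4] = 0 := by
    have a0 := five 1 2 3 4 5
    have a1 := five 0 1 3 4 6
    have a2 := five 0 1 2 5 6
    have a3 := six 0 2 3 4 5 6
    simp only [h.three, h.four, mul_zero, mul_one, add_zero, zero_add, sub_zero, zero_sub, mul_neg]
      at a0 a1 a2 a3
    refine ⟨?_, ?_, ?_, ?_⟩ <;> linarith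
  have e2 : τ₁ ![b 2] = 0 ∧ τ₂ ![b 0, b 4] = 0 ∧ τ₂ ![b 1, b 5] = 0 ∧ τ₂ ![b 3, b 6] = 0 := by
    have a0 := five 1 2 3 5 6
    have a1 := five 0 2 3 4 6
    have a2 := five 0 1 2 4 5
    have a3 := six 0 1 3 4 5 6
    simp only [h.three, h.four, mul_zero, mul_one, add_zero, zero_add, sub_zero, zero_sub, mul_neg]
      at a0 a1 a2 a3
    refine ⟨?_, ?_, ?_, ?_⟩ <;> linarith
  have e3 : τ₁ ![b 3] = 0 ∧ τ₂ ![b 0, b 5] = 0 ∧ τ₂ ![b 1, b 4] = 0 ∧ τ₂ ![b 2, b 6] = 0 := by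
    have a0 := five 1 2 3 4 6
    have a1 := five 0 2 3 5 6
    have a2 := five 0 1 3 4 5
    have a3 := six 0 1 2 4 5 6
    simp only [h.three, h.four, mul_zero, mul_one, add_zero, zero_add, sub_zero, zero_sub, mul_neg]
      at a0 a1 a2 a3
    refine ⟨?_, ?_, ?_, ?_⟩ <;> linarith
  have e4 : τ₁ ![b 4] = 0 ∧ τ₂ ![b 0, b 2] = 0 ∧ τ₂ ![b 1, b 3] = 0 ∧ τ₂ ![b 5, b 6] = 0 := by
    have a0 := five 1 3 4 5 6
    have a1 := five 0 2 4 5 6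
    have a2 := five 0 1 2 3 4
    have a3 := six 0 1 2 3 5 6
    simp only [h.three, h.four, mul_zero, mul_one, add_zero, zero_add, sub_zero, zero_sub, mul_neg]
      at a0 a1 a2 a3
    refine ⟨?_, ?_, ?_, ?_⟩ <;> linarith
  have e5 : τ₁ ![b 5] = 0 ∧ τ₂ ![b 0, b 3] = 0 ∧ τ₂ ![b 1, b 2] = 0 ∧ τ₂ ![b 4, b 6] = 0 := by
    have a0 := five 1 2 4 5 6
    have a1 := five 0 3 4 5 6
    have a2 := five 0 1 2 3 5
    have a3 := six 0 1 2 3 4 6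
    simp only [h.three, h.four, mul_zero, mul_one, add_zero, zero_add, sub_zero, zero_sub, mul_neg]
      at a0 a1 a2 a3
    refine ⟨?_, ?_, ?_, ?_⟩ <;> linarith
  have e6 : τ₁ ![b 6] = 0 ∧ τ₂ ![b 0, b 1] = 0 ∧ τ₂ ![b 2, b 3] = 0 ∧ τ₂ ![b 4, b 5] = 0 := by
    have a0 := five 2 3 4 5 6
    have a1 := five 0 1 4 5 6
    have a2 := five 0 1 2 3 6
    have a3 := six 0 1 2 3 4 5
    simp only [h.three, h.four, mul_zero, mul_one, add_zero, zero_add, sub_zero, zero_sub, mul_neg]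
      at a0 a1 a2 a3
    refine ⟨?_, ?_, ?_, ?_⟩ <;> linarith
  constructor
  · refine ext_strictMono b fun s _ => ?_
    have hs : b ∘ s = ![b (s 0)] := by ext i; fin_cases i; rfl
    rw [hs]
    generalize s 0 = i
    fin_cases i
    exacts [e0.1, e1.1, e2.1, e3.1, e4.1, e5.1, e6.1]
  · exact ext_seven_two b (forall_lt_two e6.2.1 e4.2.1 e5.2.1 e2.2.1 e3.2.1 e1.2.1 e5.2.2.1
      e4.2.2.1 e3.2.2.1 e2.2.2.1 e0.2.1 e6.2.2.1 e0.2.2.1 e1.2.2.1 e3.2.2.2 e1.2.2.2 e0.2.2.2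
      e2.2.2.2 e6.2.2.2 e5.2.2.2 e4.2.2.2)

/-- `Ω⁴ = ℝ *φ ⊕ Λ¹ ∧ φ ⊕ *Ω³₂₇`: the first and the last summand are independent. -/
theorem _root_.ExtAlg.IsG2Frame.eq_zero_of_four [IsTopologicalAddGroup V] [ContinuousSMul ℝ V]
    [T2Space V] {φ : V [⋀^Fin 3]→L[ℝ] ℝ} {Φ : V [⋀^Fin 4]→L[ℝ] ℝ}
    {b : Basis (Fin 7) ℝ V} (h : IsG2Frame φ Φ b) {τ₀ : ℝ} {τ₃ : V [⋀^Fin 3]→L[ℝ] ℝ}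
    (h3 : τ₃ ⋏[7] Φ = 0) (h34 : 3 + 4 = 7) (h4 : τ₀ • Φ + hodge b (frameVol b) 4 τ₃ h34 = 0) :
    τ₀ = 0 ∧ τ₃ = 0 := by
  have four : ∀ i j k l,
      (τ₀ • Φ + hodge b (frameVol b) 4 τ₃ h34) ![b i, b j, b k, b l] = 0 := by
    simp [h4]
  have seven : (τ₃ ⋏[7] Φ) ![b 0, b 1, b 2, b 3, b 4, b 5, b 6] = 0 := by simp [h3]
  simp only [ContinuousAlternatingMap.add_apply, ContinuousAlternatingMap.smul_apply,
    smul_eq_mul] at four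
  simp only [wedge_three_four_apply, h.four, mul_zero, mul_one, add_zero, zero_add, sub_zero,
    zero_sub, mul_neg] at seven
  have f0 := four 3 4 5 6
  have f1 := four 2 4 5 6
  have f2 := four 2 3 5 6
  have f3 := four 2 3 4 6
  have f4 := four 2 3 4 5
  have f5 := four 1 4 5 6
  have f6 := four 1 3 5 6
  have f7 := four 1 3 4 6
  have f8 := four 1 3 4 5
  have f9 := four 1 2 5 6
  have f10 := four 1 2 4 6
  have f11 := four 1 2 4 5
  have f12 := four 1 2 3 6
  have f13 := four 1 2 3 5
  have f14 := four 1 2 3 4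
  have f15 := four 0 4 5 6
  have f16 := four 0 3 5 6
  have f17 := four 0 3 4 6
  have f18 := four 0 3 4 5
  have f19 := four 0 2 5 6
  have f20 := four 0 2 4 6
  have f21 := four 0 2 4 5
  have f22 := four 0 2 3 6
  have f23 := four 0 2 3 5
  have f24 := four 0 2 3 4
  have f25 := four 0 1 5 6
  have f26 := four 0 1 4 6
  have f27 := four 0 1 4 5
  have f28 := four 0 1 3 6
  have f29 := four 0 1 3 5
  have f30 := four 0 1 3 4
  have f31 := four 0 1 2 6
  have f32 := four 0 1 2 5
  have f33 := four 0 1 2 4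
  have f34 := four 0 1 2 3
  simp only [hodge_seven_four_apply, h.four, mul_zero, mul_one, zero_add, mul_neg]
    at f0 f1 f2 f3 f4 f5 f6 f7 f8 f9 f10 f11 f12 f13 f14 f15 f16 f17 f18 f19
      f20 f21 f22 f23 f24 f25 f26 f27 f28 f29 f30 f31 f32 f33 f34
  -- The seven equations in which Φ has a nonzero component add up, with its signs, to 7τ₀ plus the
  -- single component of τ₃ ∧ Φ, which is zero.
  have h0 : τ₀ = 0 := by
    clear four h3 h4
    linarith only [seven, f4, f6, f10, f17, f19, f27, f34]
  refine ⟨h0, ext_seven_three b (forall_lt_three ?_ ?_ ?_ ?_ ?_ ?_ ?_ ?_ ?_ ?_ ?_ ?_ ?_ ?_ ?_ ?_ ?_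
    ?_ ?_ ?_ ?_ ?_ ?_ ?_ ?_ ?_ ?_ ?_ ?_ ?_ ?_ ?_ ?_ ?_ ?_ )⟩
  all_goals simp only [ContinuousAlternatingMap.coe_zero, Pi.zero_apply]
  · linarith only [f0, h0]
  · linarith only [f1, h0]
  · linarith only [f2, h0]
  · linarith only [f3, h0]
  · linarith only [f4, h0]
  · linarith only [f5, h0]
  · linarith only [f6, h0]
  · linarith only [f7, h0]
  · linarith only [f8, h0]
  · linarith only [f9, h0]
  · linarith only [f10, h0]
  · linarith only [f11, h0]
  · linarith only [f12, h0]
  · linarith only [f13, h0]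
  · linarith only [f14, h0]
  · linarith only [f15, h0]
  · linarith only [f16, h0]
  · linarith only [f17, h0]
  · linarith only [f18, h0]
  · linarith only [f19, h0]
  · linarith only [f20, h0]
  · linarith only [f21, h0]
  · linarith only [f22, h0]
  · linarith only [f23, h0]
  · linarith only [f24, h0]
  · linarith only [f25, h0]
  · linarith only [f26, h0]
  · linarith only [f27, h0]
  · linarith only [f28, h0]
  · linarith only [f29, h0]
  · linarith only [f30, h0]
  · linarith only [f31, h0]
  · linarith only [f32, h0]
  · linarith only [f33, h0]
  · linarith only [f34, h0]

end G2

/-! ### Smooth families of forms and exterior derivatives on a vector space -/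

namespace ExtAlg

section Smooth

variable {E X : Type*} [NormedAddCommGroup E] [NormedSpace ℝ E] [NormedAddCommGroup X]
  [NormedSpace ℝ X] {p q r : ℕ} {n : WithTop ℕ∞} {s : Set X}

theorem contDiffOn_apply {F : X → E [⋀^Fin p]→L[ℝ] ℝ} (hF : ContDiffOn ℝ n F s) (v : Fin p → E) :
    ContDiffOn ℝ n (fun x => F x v) s :=
  (ContinuousAlternatingMap.apply ℝ E ℝ v).contDiff.comp_contDiffOn hF

/-- A family of forms is smooth as soon as its components are. -/
theorem contDiffOn_of_apply [FiniteDimensional ℝ E] {F : X → E [⋀^Fin p]→L[ℝ] ℝ}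
    (hF : ∀ v, ContDiffOn ℝ n (fun x => F x v) s) : ContDiffOn ℝ n F s := by
  let b := finBasis ℝ E
  let ev : (E [⋀^Fin p]→L[ℝ] ℝ) →ₗ[ℝ] ((Fin p → Fin (finrank ℝ E)) → ℝ) :=
    LinearMap.pi fun i => (ContinuousAlternatingMap.apply ℝ E ℝ (b ∘ i)).toLinearMap
  have hev : LinearMap.ker ev = ⊥ := by
    rw [LinearMap.ker_eq_bot']
    intro γ hγ
    refine ext_strictMono b fun i _ => ?_
    exact congrFun hγ i
  obtain ⟨g, hg⟩ := ev.exists_leftInverse_of_injective hev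
  have key : F = fun x => g.toContinuousLinearMap (fun i => F x (b ∘ i)) := by
    ext1 x
    exact (LinearMap.congr_fun hg (F x)).symm
  rw [key]
  exact g.toContinuousLinearMap.contDiff.comp_contDiffOn (contDiffOn_pi.2 fun i => hF _)

theorem contDiffOn_wedge [FiniteDimensional ℝ E] {F : X → E [⋀^Fin p]→L[ℝ] ℝ}
    {G : X → E [⋀^Fin q]→L[ℝ] ℝ} (h : p + q = r) (hF : ContDiffOn ℝ n F s)
    (hG : ContDiffOn ℝ n G s) : ContDiffOn ℝ n (fun x => wedge r (F x) (G x) h) s := by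
  refine contDiffOn_of_apply fun v => ?_
  simp only [wedge_apply]
  exact contDiffOn_const.mul (ContDiffOn.sum fun σ _ => contDiffOn_const.mul
    ((contDiffOn_apply hF _).mul (contDiffOn_apply hG _)))

theorem contDiffOn_comp [FiniteDimensional ℝ E] {E' : Type*} [NormedAddCommGroup E']
    [NormedSpace ℝ E'] {F : X → E' [⋀^Fin p]→L[ℝ] ℝ} (T : E →L[ℝ] E')
    (hF : ContDiffOn ℝ n F s) : ContDiffOn ℝ n (fun x => (F x).compContinuousLinearMap T) s :=
  contDiffOn_of_apply fun v => contDiffOn_apply hF (T ∘ v)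

end Smooth

section ExtDeriv

variable {E : Type*} [NormedAddCommGroup E] [NormedSpace ℝ E] {x : E}

theorem extDeriv_two_apply {F : E → E [⋀^Fin 2]→L[ℝ] ℝ} (hF : DifferentiableAt ℝ F x)
    (a b c : E) : extDeriv F x ![a, b, c] = fderiv ℝ F x a ![b, c] - fderiv ℝ F x b ![a, c]
      + fderiv ℝ F x c ![a, b] := by
  have r0 : Fin.removeNth (0 : Fin 3) ![a, b, c] = ![b, c] := by ext i; fin_cases i <;> rfl
  have r1 : Fin.removeNth (1 : Fin 3) ![a, b, c] = ![a, c] := by ext i; fin_cases i <;> rfl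
  have r2 : Fin.removeNth (2 : Fin 3) ![a, b, c] = ![a, b] := by ext i; fin_cases i <;> rfl
  rw [extDeriv_apply hF]
  refine (Fin.sum_univ_three _).trans ?_
  simp only [r0, r1, r2, fderiv_continuousAlternatingMap_apply_const_apply hF]
  simp
  ring

theorem extDeriv_three_apply {F : E → E [⋀^Fin 3]→L[ℝ] ℝ} (hF : DifferentiableAt ℝ F x)
    (a b c d : E) : extDeriv F x ![a, b, c, d] = fderiv ℝ F x a ![b, c, d]
      - fderiv ℝ F x b ![a, c, d] + fderiv ℝ F x c ![a, b, d] - fderiv ℝ F x d ![a, b, c] := by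
  have r0 : Fin.removeNth (0 : Fin 4) ![a, b, c, d] = ![b, c, d] := by ext i; fin_cases i <;> rfl
  have r1 : Fin.removeNth (1 : Fin 4) ![a, b, c, d] = ![a, c, d] := by ext i; fin_cases i <;> rfl
  have r2 : Fin.removeNth (2 : Fin 4) ![a, b, c, d] = ![a, b, d] := by ext i; fin_cases i <;> rfl
  have r3 : Fin.removeNth (3 : Fin 4) ![a, b, c, d] = ![a, b, c] := by ext i; fin_cases i <;> rfl
  rw [extDeriv_apply hF]
  refine (Fin.sum_univ_four _).trans ?_
  simp only [r0, r1, r2, r3,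
    fderiv_continuousAlternatingMap_apply_const_apply hF]
  simp [pow_succ]
  ring

theorem extDeriv_four_apply {F : E → E [⋀^Fin 4]→L[ℝ] ℝ} (hF : DifferentiableAt ℝ F x)
    (a b c d e : E) : extDeriv F x ![a, b, c, d, e] = fderiv ℝ F x a ![b, c, d, e]
      - fderiv ℝ F x b ![a, c, d, e] + fderiv ℝ F x c ![a, b, d, e]
      - fderiv ℝ F x d ![a, b, c, e] + fderiv ℝ F x e ![a, b, c, d] := by
  have r0 : Fin.removeNth (0 : Fin 5) ![a, b, c, d, e] = ![b, c, d, e] := by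
    ext i; fin_cases i <;> rfl
  have r1 : Fin.removeNth (1 : Fin 5) ![a, b, c, d, e] = ![a, c, d, e] := by
    ext i; fin_cases i <;> rfl
  have r2 : Fin.removeNth (2 : Fin 5) ![a, b, c, d, e] = ![a, b, d, e] := by
    ext i; fin_cases i <;> rfl
  have r3 : Fin.removeNth (3 : Fin 5) ![a, b, c, d, e] = ![a, b, c, e] := by
    ext i; fin_cases i <;> rfl
  have r4 : Fin.removeNth (4 : Fin 5) ![a, b, c, d, e] = ![a, b, c, d] := by
    ext i; fin_cases i <;> rfl
  rw [extDeriv_apply hF]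
  refine (Fin.sum_univ_five _).trans ?_
  simp only [r0, r1, r2, r3, r4,
    fderiv_continuousAlternatingMap_apply_const_apply hF]
  simp [pow_succ]
  ring

/-- Evaluation on tuples of basis vectors is an embedding. Finite dimension makes the wedge product,
as a bilinear map between spaces of forms, automatically continuous. -/
theorem finiteDimensional_forms [FiniteDimensional ℝ E] (p : ℕ) :
    FiniteDimensional ℝ (E [⋀^Fin p]→L[ℝ] ℝ) := by
  let b := finBasis ℝ E
  let ev : (E [⋀^Fin p]→L[ℝ] ℝ) →ₗ[ℝ] ((Fin p → Fin (finrank ℝ E)) → ℝ) :=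
    LinearMap.pi fun i => (ContinuousAlternatingMap.apply ℝ E ℝ (b ∘ i)).toLinearMap
  refine FiniteDimensional.of_injective ev ((injective_iff_map_eq_zero ev).2 fun γ hγ => ?_)
  refine ext_strictMono b fun i _ => ?_
  exact congrFun hγ i

/-- The Leibniz rule for a continuous bilinear map. -/
theorem hasFDerivAt_wedge [FiniteDimensional ℝ E] {p q r : ℕ} (h : p + q = r)
    {F : E → E [⋀^Fin p]→L[ℝ] ℝ} {G : E → E [⋀^Fin q]→L[ℝ] ℝ} (hF : DifferentiableAt ℝ F x)
    (hG : DifferentiableAt ℝ G x) :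
    DifferentiableAt ℝ (fun y => wedge r (F y) (G y) h) x ∧
    ∀ v, fderiv ℝ (fun y => wedge r (F y) (G y) h) x v =
      wedge r (fderiv ℝ F x v) (G x) h + wedge r (F x) (fderiv ℝ G x v) h := by
  have := finiteDimensional_forms (E := E) p
  have := finiteDimensional_forms (E := E) q
  let B : (E [⋀^Fin p]→L[ℝ] ℝ) →ₗ[ℝ] (E [⋀^Fin q]→L[ℝ] ℝ) →ₗ[ℝ] (E [⋀^Fin r]→L[ℝ] ℝ) :=
    LinearMap.mk₂ ℝ (fun α β => wedge r α β h) (fun α α' β => wedge_add_left h α α' β)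
      (fun c α β => wedge_smul_left h c α β) (fun α β β' => wedge_add_right h α β β')
      (fun c α β => wedge_smul_right h c α β)
  let C : (E [⋀^Fin p]→L[ℝ] ℝ) →L[ℝ] (E [⋀^Fin q]→L[ℝ] ℝ) →L[ℝ] (E [⋀^Fin r]→L[ℝ] ℝ) :=
    B.toContinuousBilinearMap
  have key : HasFDerivAt (fun y => wedge r (F y) (G y) h) _ x :=
    C.hasFDerivAt_of_bilinear hF.hasFDerivAt hG.hasFDerivAt
  refine ⟨key.differentiableAt, fun v => ?_⟩
  rw [key.fderiv, add_comm]
  rfl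

theorem ofSubsingleton_apply (ℓ : E →L[ℝ] ℝ) (a : E) :
    ContinuousAlternatingMap.ofSubsingleton ℝ E ℝ (0 : Fin 1) ℓ ![a] = ℓ a := rfl

/-- `d(ω ∧ ω) = 2 dω ∧ ω` for a 2-form. -/
theorem extDeriv_wedge_self [FiniteDimensional ℝ E] {F : E → E [⋀^Fin 2]→L[ℝ] ℝ}
    (hF : DifferentiableAt ℝ F x) :
    extDeriv (fun y => F y ⋏[4] F y) x = (2 : ℝ) • (extDeriv F x ⋏[5] F x) := by
  obtain ⟨h1, h2⟩ := hasFDerivAt_wedge (by norm_num : 2 + 2 = 4) hF hF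
  ext v
  have hv : v = ![v 0, v 1, v 2, v 3, v 4] := by ext i; fin_cases i <;> rfl
  rw [hv, extDeriv_four_apply h1]
  simp only [h2, ContinuousAlternatingMap.smul_apply, ContinuousAlternatingMap.add_apply,
    wedge_three_two_apply, wedge_two_two_apply, extDeriv_two_apply hF, smul_eq_mul]
  ring

theorem extDeriv_smul_three {F : E → E [⋀^Fin 3]→L[ℝ] ℝ} {f : E → ℝ}
    (hf : DifferentiableAt ℝ f x) (hF : DifferentiableAt ℝ F x) :
    extDeriv (fun y => f y • F y) x =
      ContinuousAlternatingMap.ofSubsingleton ℝ E ℝ (0 : Fin 1) (fderiv ℝ f x) ⋏[4] F x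
        + f x • extDeriv F x := by
  ext v
  have hv : v = ![v 0, v 1, v 2, v 3] := by ext i; fin_cases i <;> rfl
  rw [hv, extDeriv_three_apply (hf.fun_smul hF)]
  simp only [fderiv_fun_smul hf hF, ContinuousAlternatingMap.smul_apply,
    ContinuousAlternatingMap.add_apply, wedge_one_three_apply, extDeriv_three_apply hF,
    smul_eq_mul, ofSubsingleton_apply, _root_.add_apply, _root_.smul_apply,
    ContinuousLinearMap.smulRight_apply]
  ring

theorem extDeriv_smul_four {F : E → E [⋀^Fin 4]→L[ℝ] ℝ} {f : E → ℝ}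
    (hf : DifferentiableAt ℝ f x) (hF : DifferentiableAt ℝ F x) :
    extDeriv (fun y => f y • F y) x =
      ContinuousAlternatingMap.ofSubsingleton ℝ E ℝ (0 : Fin 1) (fderiv ℝ f x) ⋏[5] F x
        + f x • extDeriv F x := by
  ext v
  have hv : v = ![v 0, v 1, v 2, v 3, v 4] := by ext i; fin_cases i <;> rfl
  rw [hv, extDeriv_four_apply (hf.fun_smul hF)]
  simp only [fderiv_fun_smul hf hF, ContinuousAlternatingMap.smul_apply,
    ContinuousAlternatingMap.add_apply, wedge_one_four_apply, extDeriv_four_apply hF,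
    smul_eq_mul, ofSubsingleton_apply, _root_.add_apply, _root_.smul_apply,
    ContinuousLinearMap.smulRight_apply]
  ring

theorem extDeriv_two_wedge_const [FiniteDimensional ℝ E] {F : E → E [⋀^Fin 2]→L[ℝ] ℝ}
    (hF : DifferentiableAt ℝ F x) (θ : E [⋀^Fin 1]→L[ℝ] ℝ) :
    extDeriv (fun y => F y ⋏[3] θ) x = extDeriv F x ⋏[4] θ := by
  obtain ⟨h1, h2⟩ := hasFDerivAt_wedge (by norm_num : 2 + 1 = 3) hF (differentiableAt_const θ)
  ext v
  have hv : v = ![v 0, v 1, v 2, v 3] := by ext i; fin_cases i <;> rfl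
  rw [hv, extDeriv_three_apply h1]
  refine Eq.trans ?_ (wedge_three_one_apply (extDeriv F x) θ _ _ _ _ _).symm
  simp only [h2, ContinuousAlternatingMap.add_apply, wedge_two_one_apply,
    extDeriv_two_apply hF, fderiv_fun_const, Pi.zero_apply, _root_.zero_apply,
    ContinuousAlternatingMap.coe_zero]
  ring

theorem extDeriv_three_wedge_const [FiniteDimensional ℝ E] {F : E → E [⋀^Fin 3]→L[ℝ] ℝ}
    (hF : DifferentiableAt ℝ F x) (θ : E [⋀^Fin 1]→L[ℝ] ℝ)
    {D : E [⋀^Fin 4]→L[ℝ] ℝ} (hD : extDeriv F x = D) :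
    extDeriv (fun y => F y ⋏[4] θ) x = D ⋏[5] θ := by
  obtain ⟨h1, h2⟩ := hasFDerivAt_wedge (by norm_num : 3 + 1 = 4) hF (differentiableAt_const θ)
  -- Naming the derivatives G and D gives them the literal degrees 5 and 4, instead of 4 + 1 and 3 +
  -- 1, so that the component formulas apply to them.
  suffices H : ∀ G : E [⋀^Fin 5]→L[ℝ] ℝ, extDeriv (fun y => F y ⋏[4] θ) x = G → G = D ⋏[5] θ from
    H _ rfl
  intro G hG
  have hG' : ∀ a b c d e, G ![a, b, c, d, e] = _ := fun a b c d e =>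
    hG ▸ extDeriv_four_apply h1 a b c d e
  ext v
  have hv : v = ![v 0, v 1, v 2, v 3, v 4] := by ext i; fin_cases i <;> rfl
  rw [hv, hG']
  have hD' : ∀ a b c d, D ![a, b, c, d] = _ := fun a b c d =>
    hD ▸ extDeriv_three_apply hF a b c d
  simp only [h2, ContinuousAlternatingMap.add_apply, wedge_three_one_apply, wedge_four_one_apply,
    hD', fderiv_fun_const, Pi.zero_apply, _root_.zero_apply,
    ContinuousAlternatingMap.coe_zero]
  ring

end ExtDeriv

end ExtAlg

/-! ### Forms on manifolds in charts -/

namespace DForm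

open ExtAlg

variable {E : Type*} [NormedAddCommGroup E] [NormedSpace ℝ E] {H : Type*} [TopologicalSpace H]
  {I : ModelWithCorners ℝ E H} {M : Type*} [TopologicalSpace M] [ChartedSpace H M] {p q r : ℕ}

/-- Tangent spaces at all points are the model space E by definition, so v needs no transport. -/
theorem apply_congr_point (η : DForm I M p) {x x' : M} (h : x = x') (v : Fin p → E) :
    η x v = η x' v := by
  subst h; rfl

theorem inChart_apply (η : DForm I M p) (x₀ : M) (y : E) (v : Fin p → E) :
    η.inChart x₀ y v = η ((extChartAt I x₀).symm y)
      (fun i => mfderivWithin 𝓘(ℝ, E) I (extChartAt I x₀).symm (range I) y (v i)) := rfl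

theorem inChart_wedge (h : p + q = r) (η : DForm I M p) (ξ : DForm I M q) (x₀ : M) (y : E) :
    inChart (fun x => wedge r (η x) (ξ x) h) x₀ y = wedge r (η.inChart x₀ y) (ξ.inChart x₀ y) h :=
  wedge_compContinuousLinearMap h _ _ _

theorem IsSmooth.wedge [FiniteDimensional ℝ E] {η : DForm I M p} {ξ : DForm I M q} (hη :
    η.IsSmooth) (hξ : ξ.IsSmooth)
    (h : p + q = r) : IsSmooth (fun x => wedge r (η x) (ξ x) h) := fun x₀ =>
  (contDiffOn_wedge h (hη x₀) (hξ x₀)).congr fun y _ => inChart_wedge h η ξ x₀ y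

theorem IsSmooth.add {η ξ : DForm I M p} (hη : η.IsSmooth) (hξ : ξ.IsSmooth) :
    IsSmooth (fun x => η x + ξ x) := fun x₀ => (hη x₀).add (hξ x₀)

theorem IsSmooth.sub {η ξ : DForm I M p} (hη : η.IsSmooth) (hξ : ξ.IsSmooth) :
    IsSmooth (fun x => η x - ξ x) := fun x₀ => (hη x₀).sub (hξ x₀)

theorem IsSmooth.smul [IsManifold I (⊤ : ℕ∞) M] {η : DForm I M p} {f : M → ℝ}
    (hf : ContMDiff I 𝓘(ℝ, ℝ) (⊤ : ℕ∞) f) (hη : η.IsSmooth) :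
    IsSmooth (fun x => f x • η x) := fun x₀ => by
  have h1 : ContDiffOn ℝ (⊤ : ℕ∞) (fun y => f ((extChartAt I x₀).symm y))
      (extChartAt I x₀).target :=
    contMDiffOn_iff_contDiffOn.1 (hf.comp_contMDiffOn (contMDiffOn_extChartAt_symm x₀))
  exact h1.smul (hη x₀)

/-- The tangent space at x is trivialised by the chart at x itself, so the derivative of that chart
is the identity at its own base point. -/
theorem inChart_self [IsManifold I 1 M] (η : DForm I M p) (x : M) (v : Fin p → E) :
    η.inChart x (extChartAt I x x) v = η x v := by
  rw [inChart_apply, mfderivWithin_range_extChartAt_symm]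
  exact η.apply_congr_point (extChartAt_to_inv x) v

/-- For the same reason, and because the range of a boundaryless model is everything, the derivative
at x is an unrestricted exterior derivative in E. -/
theorem d_apply [IsManifold I 1 M] [I.Boundaryless] (η : DForm I M p) (x : M) (v : Fin (p + 1) → E)
    :
    η.d x v = extDeriv (η.inChart x) (extChartAt I x x) v := by
  have h : mvfderiv I (extChartAt I x) x = ContinuousLinearMap.id ℝ E := by
    rw [mvfderiv, mfderiv_extChartAt_self]; rfl
  rw [d, I.range_eq_univ, extDerivWithin_univ, h]
  rfl

theorem IsSmooth.differentiableAt [I.Boundaryless] {η : DForm I M p} (hη : η.IsSmooth) (x : M) :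
    DifferentiableAt ℝ (η.inChart x) (extChartAt I x x) :=
  ((hη x).contDiffAt (extChartAt_target_mem_nhds x)).differentiableAt (by simp)

end DForm

/-! ### Product charts and pullback to the product -/

namespace Warped

open ExtAlg

variable {L : Type*} [TopologicalSpace L] [ChartedSpace (EuclideanSpace ℝ (Fin 6)) L]
  {U : TopologicalSpace.Opens ℝ} {p : ℕ}

theorem chart_target {m₀ : U × L} {y : ℝ × EuclideanSpace ℝ (Fin 6)}
    (hy : y ∈ (extChartAt model m₀).target) :
    y.1 ∈ (extChartAt 𝓘(ℝ, ℝ) m₀.1).target ∧ y.2 ∈ (extChartAt (𝓡 6) m₀.2).target := by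
  rw [extChartAt_prod] at hy
  exact hy

theorem chart_symm_fst {m₀ : U × L} {y : ℝ × EuclideanSpace ℝ (Fin 6)}
    (hy : y ∈ (extChartAt model m₀).target) : (((extChartAt model m₀).symm y).1 : ℝ) = y.1 :=
  (extChartAt 𝓘(ℝ, ℝ) m₀.1).right_inv (chart_target hy).1

theorem pull_eq (m : U × L) (γ : (TangentSpace (𝓡 6) m.2) [⋀^Fin p]→L[ℝ] ℝ)
    (v : Fin p → ℝ × EuclideanSpace ℝ (Fin 6)) : pull m γ v = γ (fun i => (v i).2) := by
  rw [pull, mfderiv_snd]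
  rfl

theorem contMDiff_fst_comp {h : ℝ → ℝ} (hh : ContDiffOn ℝ (⊤ : ℕ∞) h U) :
    ContMDiff model 𝓘(ℝ, ℝ) (⊤ : ℕ∞) (fun m : U × L => h m.1) :=
  hh.contMDiffOn.comp_contMDiff (contMDiff_subtype_val.comp contMDiff_fst) fun m => m.1.2

variable [IsManifold (𝓡 6) (⊤ : ℕ∞) L]

/-- Projecting after the inverse product chart is the same as applying the inverse chart of L after
the projection; the chain rule is applied to both composites. -/
theorem mfderivWithin_chart_symm_snd {m₀ : U × L} {y : ℝ × EuclideanSpace ℝ (Fin 6)}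
    (hy : y ∈ (extChartAt model m₀).target) (w : ℝ × EuclideanSpace ℝ (Fin 6)) :
    (mfderivWithin 𝓘(ℝ, ℝ × EuclideanSpace ℝ (Fin 6)) model (extChartAt model m₀).symm
      (range model) y w).2 =
    mfderivWithin 𝓘(ℝ, EuclideanSpace ℝ (Fin 6)) (𝓡 6) (extChartAt (𝓡 6) m₀.2).symm
      (range (𝓡 6)) y.2 w.2 := by
  have huniv : range (model : ModelWithCorners ℝ _ _) = univ := model.range_eq_univ
  have hu : UniqueMDiffWithinAt 𝓘(ℝ, ℝ × EuclideanSpace ℝ (Fin 6)) (range model) y := by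
    rw [huniv]; exact uniqueMDiffWithinAt_univ _
  have h1 := mfderiv_comp_mfderivWithin (I := 𝓘(ℝ, ℝ × EuclideanSpace ℝ (Fin 6))) (I' := model)
    (I'' := 𝓡 6) (f := (extChartAt model m₀).symm) (g := Prod.snd) y mdifferentiableAt_snd
    (mdifferentiableWithinAt_extChartAt_symm hy) hu
  have h2 := mfderivWithin_comp (I := 𝓘(ℝ, ℝ × EuclideanSpace ℝ (Fin 6)))
    (I' := 𝓘(ℝ, EuclideanSpace ℝ (Fin 6))) (I'' := 𝓡 6) (f := Prod.snd) (s := range model)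
    (u := range (𝓡 6)) (g := (extChartAt (𝓡 6) m₀.2).symm) y
    (mdifferentiableWithinAt_extChartAt_symm (chart_target hy).2)
    differentiableAt_snd.mdifferentiableAt.mdifferentiableWithinAt (by
      rw [(𝓡 6).range_eq_univ]; simp) hu
  have h3 := h1.symm.trans h2
  have h4 := DFunLike.congr_fun h3 w
  rw [mfderiv_snd, mfderivWithin_eq_fderivWithin, huniv, fderivWithin_univ, fderiv_snd] at h4
  rw [huniv]
  exact h4

/-- The chart of an open subset of ℝ is the inclusion, so in a product chart the function t is the
first coordinate; consequently dt has constant coefficients there. -/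
theorem mfderivWithin_chart_symm_fst {m₀ : U × L} {y : ℝ × EuclideanSpace ℝ (Fin 6)}
    (hy : y ∈ (extChartAt model m₀).target) (w : ℝ × EuclideanSpace ℝ (Fin 6)) :
    mvfderiv model (fun m : U × L => (m.1 : ℝ)) ((extChartAt model m₀).symm y)
      (mfderivWithin 𝓘(ℝ, ℝ × EuclideanSpace ℝ (Fin 6)) model (extChartAt model m₀).symm
      (range model) y w) = w.1 := by
  have huniv : range (model : ModelWithCorners ℝ _ _) = univ := model.range_eq_univ
  have hu : UniqueMDiffWithinAt 𝓘(ℝ, ℝ × EuclideanSpace ℝ (Fin 6)) (range model) y := by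
    rw [huniv]; exact uniqueMDiffWithinAt_univ _
  have hc : ContMDiff model 𝓘(ℝ, ℝ) (⊤ : ℕ∞) (fun m : U × L => (m.1 : ℝ)) :=
    contMDiff_subtype_val.comp contMDiff_fst
  have h1 := mfderiv_comp_mfderivWithin (I := 𝓘(ℝ, ℝ × EuclideanSpace ℝ (Fin 6))) (I' := model)
    (I'' := 𝓘(ℝ, ℝ)) (f := (extChartAt model m₀).symm) (g := fun m : U × L => (m.1 : ℝ)) y
    (hc.mdifferentiableAt (by simp))
    (mdifferentiableWithinAt_extChartAt_symm hy) hu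
  have h2 : mfderivWithin 𝓘(ℝ, ℝ × EuclideanSpace ℝ (Fin 6)) 𝓘(ℝ, ℝ)
      ((fun m : U × L => (m.1 : ℝ)) ∘ (extChartAt model m₀).symm) (range model) y =
      ContinuousLinearMap.fst ℝ ℝ (EuclideanSpace ℝ (Fin 6)) := by
    rw [mfderivWithin_eq_fderivWithin, huniv, fderivWithin_univ]
    have hev : ((fun m : U × L => (m.1 : ℝ)) ∘ (extChartAt model m₀).symm) =ᶠ[nhds y]
        Prod.fst := by
      filter_upwards [(isOpen_extChartAt_target m₀).mem_nhds hy] with z hz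
      exact chart_symm_fst hz
    rw [hev.fderiv_eq, fderiv_fst]
  have h4 := DFunLike.congr_fun (h1.symm.trans h2) w
  exact h4

theorem pull_inChart (γ : DForm (𝓡 6) L p) {m₀ : U × L} {y : ℝ × EuclideanSpace ℝ (Fin 6)}
    (hy : y ∈ (extChartAt model m₀).target) :
    DForm.inChart (fun m : U × L => pull m (γ m.2)) m₀ y =
      (γ.inChart m₀.2 y.2).compContinuousLinearMap
        (ContinuousLinearMap.snd ℝ ℝ (EuclideanSpace ℝ (Fin 6))) := by
  ext v
  rw [DForm.inChart_apply]
  refine (pull_eq _ _ _).trans ?_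
  rw [ContinuousAlternatingMap.compContinuousLinearMap_apply, DForm.inChart_apply]
  refine congrArg (γ _) (funext fun i => ?_)
  exact mfderivWithin_chart_symm_snd hy (v i)

theorem dt_inChart {m₀ : U × L} {y : ℝ × EuclideanSpace ℝ (Fin 6)}
    (hy : y ∈ (extChartAt model m₀).target) :
    DForm.inChart (dt : DForm model (U × L) 1) m₀ y =
      ContinuousAlternatingMap.ofSubsingleton ℝ _ ℝ (0 : Fin 1)
        (ContinuousLinearMap.fst ℝ ℝ (EuclideanSpace ℝ (Fin 6))) := by
  ext v
  exact mfderivWithin_chart_symm_fst hy (v 0)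

theorem isSmooth_pull {γ : DForm (𝓡 6) L p} (hγ : γ.IsSmooth) :
    DForm.IsSmooth (fun m : U × L => pull m (γ m.2)) := fun m₀ => by
  refine ContDiffOn.congr ?_ fun y hy => pull_inChart γ hy
  exact contDiffOn_comp (F := fun y : ℝ × EuclideanSpace ℝ (Fin 6) => γ.inChart m₀.2 y.2) _
    ((hγ m₀.2).comp contDiff_snd.contDiffOn fun y hy => (chart_target hy).2)

theorem isSmooth_dt : DForm.IsSmooth (dt : DForm model (U × L) 1) := fun _ =>
  contDiffOn_const.congr fun _ hy => dt_inChart hy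

end Warped

/-! ### Rules for the exterior derivative on manifolds -/

namespace DForm

open ExtAlg

variable {E : Type*} [NormedAddCommGroup E] [NormedSpace ℝ E] {H : Type*} [TopologicalSpace H]
  {I : ModelWithCorners ℝ E H} {M : Type*} [TopologicalSpace M] [ChartedSpace H M] {p q r : ℕ}
  [IsManifold I 1 M]

theorem inChart_self_eq (η : DForm I M p) (x : M) :
    (η x : E [⋀^Fin p]→L[ℝ] ℝ) = η.inChart x (extChartAt I x x) :=
  ContinuousAlternatingMap.ext fun v => (η.inChart_self x v).symm

theorem d_eq [I.Boundaryless] (η : DForm I M p) (x : M) :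
    (η.d x : E [⋀^Fin (p + 1)]→L[ℝ] ℝ) = extDeriv (η.inChart x) (extChartAt I x x) :=
  ContinuousAlternatingMap.ext fun v => η.d_apply x v

theorem d_add [I.Boundaryless] {η ξ : DForm I M p} (hη : η.IsSmooth) (hξ : ξ.IsSmooth) (x : M) :
    DForm.d (fun x => η x + ξ x) x = η.d x + ξ.d x := by
  refine (d_eq (fun x => η x + ξ x) x).trans ?_
  have h : inChart (fun x => η x + ξ x) x = η.inChart x + ξ.inChart x := rfl
  rw [h, extDeriv_add (hη.differentiableAt x) (hξ.differentiableAt x), ← d_eq, ← d_eq]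
  rfl

set_option maxRecDepth 10000 in
/-- `d(ω ∧ ω) = 2 dω ∧ ω` for a 2-form. -/
theorem d_wedge_self [FiniteDimensional ℝ E] [I.Boundaryless] {η : DForm I M 2} (hη : η.IsSmooth)
    (x : M) : DForm.d (fun x => η x ⋏[4] η x) x = (2 : ℝ) • (η.d x ⋏[5] η x) := by
  have h : inChart (fun x => η x ⋏[4] η x) x = fun y => η.inChart x y ⋏[4] η.inChart x y :=
    funext fun y => inChart_wedge _ η η x y
  refine ContinuousAlternatingMap.ext fun v =>
    (d_apply (fun x => η x ⋏[4] η x) x v).trans ?_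
  have h1 := DFunLike.congr_fun (extDeriv_wedge_self (hη.differentiableAt x)) v
  rw [← h] at h1
  refine h1.trans ?_
  rw [← d_eq, ← inChart_self_eq]
  rfl

end DForm

namespace ExtAlg

variable {V : Type*} [AddCommGroup V] [Module ℝ V] [TopologicalSpace V]

theorem wedge_two_wedge_self (θ : V [⋀^Fin 1]→L[ℝ] ℝ) (γ : V [⋀^Fin 2]→L[ℝ] ℝ) :
    θ ⋏[4] (γ ⋏[3] θ) = 0 := by
  ext v
  have hv : v = ![v 0, v 1, v 2, v 3] := by ext i; fin_cases i <;> rfl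
  rw [hv]
  simp only [wedge_one_three_apply, wedge_two_one_apply, ContinuousAlternatingMap.coe_zero,
    Pi.zero_apply]
  ring

theorem wedge_three_wedge_self (θ : V [⋀^Fin 1]→L[ℝ] ℝ) (γ : V [⋀^Fin 3]→L[ℝ] ℝ) :
    θ ⋏[5] (γ ⋏[4] θ) = 0 := by
  ext v
  have hv : v = ![v 0, v 1, v 2, v 3, v 4] := by ext i; fin_cases i <;> rfl
  rw [hv]
  simp only [wedge_one_four_apply, wedge_three_one_apply, ContinuousAlternatingMap.coe_zero,
    Pi.zero_apply]
  ring

theorem ofSubsingleton_smul {E : Type*} [NormedAddCommGroup E] [NormedSpace ℝ E] (c : ℝ)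
    (ℓ : E →L[ℝ] ℝ) : ContinuousAlternatingMap.ofSubsingleton ℝ E ℝ (0 : Fin 1) (c • ℓ) =
      c • ContinuousAlternatingMap.ofSubsingleton ℝ E ℝ (0 : Fin 1) ℓ := rfl

end ExtAlg

/-! ### Exterior derivatives on the product -/

namespace Warped

open ExtAlg

variable {L : Type*} [TopologicalSpace L] [ChartedSpace (EuclideanSpace ℝ (Fin 6)) L]
  {U : TopologicalSpace.Opens ℝ} {p : ℕ}

theorem pull_eq_comp (m : U × L) (γ : (TangentSpace (𝓡 6) m.2) [⋀^Fin p]→L[ℝ] ℝ) :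
    (pull m γ : (ℝ × EuclideanSpace ℝ (Fin 6)) [⋀^Fin p]→L[ℝ] ℝ) =
      ContinuousAlternatingMap.compContinuousLinearMap
        (γ : EuclideanSpace ℝ (Fin 6) [⋀^Fin p]→L[ℝ] ℝ)
        (ContinuousLinearMap.snd ℝ ℝ (EuclideanSpace ℝ (Fin 6))) :=
  ContinuousAlternatingMap.ext fun v => pull_eq m γ v

theorem hasFDerivAt_comp_fst {h : ℝ → ℝ} (hh : ContDiffOn ℝ (⊤ : ℕ∞) h U) (m : U × L) :
    HasFDerivAt (fun y : ℝ × EuclideanSpace ℝ (Fin 6) => h y.1)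
      (deriv h m.1 • ContinuousLinearMap.fst ℝ ℝ (EuclideanSpace ℝ (Fin 6)))
      (extChartAt model m m) := by
  have h1 : HasDerivAt h (deriv h m.1) m.1 :=
    ((hh.contDiffAt (U.isOpen.mem_nhds m.1.2)).differentiableAt (by simp)).hasDerivAt
  exact h1.comp_hasFDerivAt (f := Prod.fst) (extChartAt model m m) hasFDerivAt_fst

variable [IsManifold (𝓡 6) (⊤ : ℕ∞) L]

theorem dt_eq (m : U × L) :
    (dt m : (ℝ × EuclideanSpace ℝ (Fin 6)) [⋀^Fin 1]→L[ℝ] ℝ) =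
      ContinuousAlternatingMap.ofSubsingleton ℝ _ ℝ (0 : Fin 1)
        (ContinuousLinearMap.fst ℝ ℝ (EuclideanSpace ℝ (Fin 6))) :=
  (DForm.inChart_self_eq dt m).trans (dt_inChart (mem_extChartAt_target m))

/-- Only the germ of the chart expression at the point matters, and the chart target is a
neighbourhood of it. -/
theorem inChart_eventuallyEq {η : DForm model (U × L) p} {m : U × L}
    {F : ℝ × EuclideanSpace ℝ (Fin 6) → (ℝ × EuclideanSpace ℝ (Fin 6)) [⋀^Fin p]→L[ℝ] ℝ}
    (h : ∀ y ∈ (extChartAt model m).target, η.inChart m y = F y) :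
    (η.d m : (ℝ × EuclideanSpace ℝ (Fin 6)) [⋀^Fin (p + 1)]→L[ℝ] ℝ) =
      extDeriv F (extChartAt model m m) := by
  rw [DForm.d_eq]
  refine Filter.EventuallyEq.extDeriv_eq ?_
  filter_upwards [extChartAt_target_mem_nhds (I := model) m] with y hy using h y hy

/-- In product charts the projection to L is linear, so this is naturality of the exterior
derivative under a map whose derivative is itself. -/
theorem extDeriv_comp_snd {γ : DForm (𝓡 6) L p} (hγ : γ.IsSmooth) (m : U × L) :
    extDeriv (fun y : ℝ × EuclideanSpace ℝ (Fin 6) => (γ.inChart m.2 y.2).compContinuousLinearMap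
      (ContinuousLinearMap.snd ℝ ℝ (EuclideanSpace ℝ (Fin 6)))) (extChartAt model m m) =
    pull m (γ.d m.2) := by
  have h := extDeriv_pullback (x := extChartAt model m m) (r := 2)
    (ω := γ.inChart m.2) (f := (Prod.snd : ℝ × EuclideanSpace ℝ (Fin 6) → _))
    (hγ.differentiableAt m.2) contDiff_snd.contDiffAt (by simp)
  simp only [fderiv_snd] at h
  rw [h, pull_eq_comp, DForm.d_eq]
  rfl

theorem differentiableAt_comp_snd {γ : DForm (𝓡 6) L p} (hγ : γ.IsSmooth) (m : U × L) :
    DifferentiableAt ℝ (fun y : ℝ × EuclideanSpace ℝ (Fin 6) =>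
      (γ.inChart m.2 y.2).compContinuousLinearMap
      (ContinuousLinearMap.snd ℝ ℝ (EuclideanSpace ℝ (Fin 6)))) (extChartAt model m m) := by
  have h := (isSmooth_pull (U := U) hγ m).congr fun y hy => (pull_inChart γ hy).symm
  exact (h.contDiffAt (extChartAt_target_mem_nhds m)).differentiableAt (by simp)

theorem inChart_smul_pull (h : ℝ → ℝ) (γ : DForm (𝓡 6) L p) (m : U × L)
    {y : ℝ × EuclideanSpace ℝ (Fin 6)} (hy : y ∈ (extChartAt model m).target) :
    DForm.inChart (fun m : U × L => h m.1 • pull m (γ m.2)) m y =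
      h y.1 • (γ.inChart m.2 y.2).compContinuousLinearMap
        (ContinuousLinearMap.snd ℝ ℝ (EuclideanSpace ℝ (Fin 6))) := by
  rw [← pull_inChart γ hy, ← chart_symm_fst hy]
  rfl

theorem inChart_comp_self (γ : DForm (𝓡 6) L p) (m : U × L) :
    (γ.inChart m.2 (extChartAt model m m).2).compContinuousLinearMap
      (ContinuousLinearMap.snd ℝ ℝ (EuclideanSpace ℝ (Fin 6))) = pull m (γ m.2) := by
  rw [pull_eq_comp, DForm.inChart_self_eq γ m.2]
  rfl

theorem d_smul_pull_three {h : ℝ → ℝ} (hh : ContDiffOn ℝ (⊤ : ℕ∞) h U) {γ : DForm (𝓡 6) L 3}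
    (hγ : γ.IsSmooth) (m : U × L) :
    DForm.d (fun m : U × L => h m.1 • pull m (γ m.2)) m =
      deriv h m.1 • (dt m ⋏[4] pull m (γ m.2)) + h m.1 • pull m (γ.d m.2) := by
  have hf := hasFDerivAt_comp_fst hh m
  have key := (inChart_eventuallyEq fun y hy => inChart_smul_pull h γ m hy).trans
    (extDeriv_smul_three hf.differentiableAt (differentiableAt_comp_snd hγ m))
  refine key.trans ?_
  rw [extDeriv_comp_snd hγ, hf.fderiv, ofSubsingleton_smul, wedge_smul_left, ← dt_eq m,
    inChart_comp_self γ m]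
  rfl

set_option maxRecDepth 10000 in
theorem d_smul_pull_four {h : ℝ → ℝ} (hh : ContDiffOn ℝ (⊤ : ℕ∞) h U) {γ : DForm (𝓡 6) L 4}
    (hγ : γ.IsSmooth) (m : U × L) :
    DForm.d (fun m : U × L => h m.1 • pull m (γ m.2)) m =
      deriv h m.1 • (dt m ⋏[5] pull m (γ m.2)) + h m.1 • pull m (γ.d m.2) := by
  have hf := hasFDerivAt_comp_fst hh m
  have key := (inChart_eventuallyEq fun y hy => inChart_smul_pull h γ m hy).trans
    (extDeriv_smul_four hf.differentiableAt (differentiableAt_comp_snd hγ m))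
  refine key.trans ?_
  rw [extDeriv_comp_snd hγ, hf.fderiv, ofSubsingleton_smul, wedge_smul_left, ← dt_eq m,
    inChart_comp_self γ m]
  rfl

theorem inChart_smul_pull_wedge_dt (h : ℝ → ℝ) (γ : DForm (𝓡 6) L p) (m : U × L) {r : ℕ}
    (hr : p + 1 = r) {y : ℝ × EuclideanSpace ℝ (Fin 6)} (hy : y ∈ (extChartAt model m).target) :
    DForm.inChart (fun m : U × L => h m.1 • wedge r (pull m (γ m.2)) (dt m) hr) m y =
      h y.1 • wedge r ((γ.inChart m.2 y.2).compContinuousLinearMap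
        (ContinuousLinearMap.snd ℝ ℝ (EuclideanSpace ℝ (Fin 6))))
        (ContinuousAlternatingMap.ofSubsingleton ℝ _ ℝ (0 : Fin 1)
          (ContinuousLinearMap.fst ℝ ℝ (EuclideanSpace ℝ (Fin 6)))) hr := by
  rw [← pull_inChart γ hy, ← chart_symm_fst hy, ← dt_inChart hy, ← DForm.inChart_wedge]
  rfl

/-- The differential of h is a multiple of dt, and a second dt is already present, so h behaves like
a constant. -/
theorem d_smul_pull_wedge_dt_two {h : ℝ → ℝ} (hh : ContDiffOn ℝ (⊤ : ℕ∞) h U)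
    {γ : DForm (𝓡 6) L 2} (hγ : γ.IsSmooth) (m : U × L) :
    DForm.d (fun m : U × L => h m.1 • (pull m (γ m.2) ⋏[3] dt m)) m =
      h m.1 • (pull m (γ.d m.2) ⋏[4] dt m) := by
  have hf := hasFDerivAt_comp_fst hh m
  have hd := differentiableAt_comp_snd hγ m
  have key := (inChart_eventuallyEq fun y hy => inChart_smul_pull_wedge_dt h γ m (by norm_num : 2 +
    1 = 3) hy).trans
    (extDeriv_smul_three hf.differentiableAt (hasFDerivAt_wedge (by norm_num : 2 + 1 = 3) hd
      (differentiableAt_const _)).1)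
  refine key.trans ?_
  rw [extDeriv_two_wedge_const hd, extDeriv_comp_snd hγ, hf.fderiv, ofSubsingleton_smul,
    wedge_smul_left, wedge_two_wedge_self, smul_zero, zero_add, ← dt_eq m]
  rfl

set_option maxRecDepth 10000 in
theorem d_smul_pull_wedge_dt_three {h : ℝ → ℝ} (hh : ContDiffOn ℝ (⊤ : ℕ∞) h U)
    {γ : DForm (𝓡 6) L 3} (hγ : γ.IsSmooth) (m : U × L) :
    DForm.d (fun m : U × L => h m.1 • (pull m (γ m.2) ⋏[4] dt m)) m =
      h m.1 • (pull m (γ.d m.2) ⋏[5] dt m) := by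
  have hf := hasFDerivAt_comp_fst hh m
  have hd := differentiableAt_comp_snd hγ m
  have key := (inChart_eventuallyEq fun y hy => inChart_smul_pull_wedge_dt h γ m (by norm_num : 3 +
    1 = 4) hy).trans
    (extDeriv_smul_four hf.differentiableAt (hasFDerivAt_wedge (by norm_num : 3 + 1 = 4) hd
      (differentiableAt_const _)).1)
  refine key.trans ?_
  rw [extDeriv_three_wedge_const hd _ (extDeriv_comp_snd hγ m), hf.fderiv, ofSubsingleton_smul,
    wedge_smul_left, wedge_three_wedge_self, smul_zero, zero_add, ← dt_eq m]
  rfl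

end Warped

/-! ### Smoothness of the Hodge star -/

namespace ExtAlg

variable {E X : Type*} [NormedAddCommGroup E] [NormedSpace ℝ E] [NormedAddCommGroup X]
  [NormedSpace ℝ X] {p q n : ℕ} {N : WithTop ℕ∞} {s : Set X}

theorem contDiffOn_det {G : X → Matrix (Fin n) (Fin n) ℝ}
    (hG : ∀ k l, ContDiffOn ℝ N (fun x => G x k l) s) : ContDiffOn ℝ N (fun x => (G x).det) s := by
  simp only [Matrix.det_apply']
  exact ContDiffOn.sum fun σ _ => contDiffOn_const.mul (contDiffOn_prod fun i _ => hG _ _)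

/-- Cramer's rule: the entries of the adjugate are determinants, and the determinant is polynomial
in the entries. -/
theorem contDiffOn_matrix_inv {G : X → Matrix (Fin n) (Fin n) ℝ}
    (hG : ∀ k l, ContDiffOn ℝ N (fun x => G x k l) s) (h0 : ∀ x ∈ s, (G x).det ≠ 0) (k l : Fin n) :
    ContDiffOn ℝ N (fun x => (G x)⁻¹ k l) s := by
  simp only [Matrix.inv_def, Ring.inverse_eq_inv', Matrix.smul_apply, Matrix.adjugate_apply]
  refine ((contDiffOn_det hG).inv h0).smul (contDiffOn_det fun i j => ?_)
  by_cases hi : i = l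
  · subst hi
    simp only [Matrix.updateRow_self]
    exact contDiffOn_const
  · simp only [Matrix.updateRow_ne hi]
    exact hG i j

/-- The Hodge star of a smooth family of metrics, given by their matrices in a fixed basis, is
smooth. -/
theorem contDiffOn_hodge [FiniteDimensional ℝ E] (e : Basis (Fin n) ℝ E) (h : p + q = n)
    {G : X → Matrix (Fin n) (Fin n) ℝ} (hG : ∀ k l, ContDiffOn ℝ N (fun x => G x k l) s)
    {vol : X → E [⋀^Fin n]→L[ℝ] ℝ} (hvol : ContDiffOn ℝ N vol s)
    {γ : X → E [⋀^Fin p]→L[ℝ] ℝ} (hγ : ContDiffOn ℝ N γ s) {F : X → E [⋀^Fin q]→L[ℝ] ℝ}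
    (hF : ∀ x ∈ s, ∃ B : Fin n → E, (e.toMatrix B).transpose * G x * e.toMatrix B = 1 ∧
      F x = hodge B (vol x) q (γ x) h) : ContDiffOn ℝ N F s := by
  have h0 : ∀ x ∈ s, (G x).det ≠ 0 := by
    intro x hx h0
    obtain ⟨B, hB, -⟩ := hF x hx
    have := congrArg Matrix.det hB
    rw [Matrix.det_mul, Matrix.det_mul, h0, mul_zero, zero_mul, Matrix.det_one] at this
    exact zero_ne_one this
  refine contDiffOn_of_apply fun w => ?_
  -- The orthonormal frames B are chosen point by point without any regularity. In the fixed frame e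
  -- the star is polynomial in the entries of G⁻¹ and the components of γ and `vol`, and B no longer
  -- appears.
  refine ContDiffOn.congr (f := fun x => ((p.factorial : ℝ)⁻¹) * ∑ k : Fin p → Fin n,
    ∑ l : Fin p → Fin n, (∏ a, (G x)⁻¹ (k a) (l a)) *
      (γ x (e ∘ k) * vol x (fun m => Fin.append (e ∘ l) w (Fin.cast h.symm m)))) ?_ ?_
  · exact contDiffOn_const.mul (ContDiffOn.sum fun k _ => ContDiffOn.sum fun l _ =>
      (contDiffOn_prod fun a _ => contDiffOn_matrix_inv hG h0 _ _).mul
        ((contDiffOn_apply hγ _).mul (contDiffOn_apply hvol _)))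
  · intro x hx
    obtain ⟨B, hB, hFx⟩ := hF x hx
    -- BᵀGB = 1 rearranges to G⁻¹ = B Bᵀ, the matrix that occurs in `hodge_change_frame`.
    have hinv : (G x)⁻¹ = e.toMatrix B * (e.toMatrix B).transpose := by
      refine Matrix.inv_eq_left_inv ?_
      rw [Matrix.mul_assoc]
      exact mul_eq_one_comm.1 hB
    rw [hFx, hodge_change_frame h (vol x) (γ x) (e.toMatrix B) e B
      fun i => (e.sum_toMatrix_smul_self B i).symm, hinv]
    simp only [Matrix.mul_apply, Matrix.transpose_apply]

/-- The Gram matrix of a family of vectors in terms of the one of a basis. -/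
theorem toMatrix_gram {V : Type*} [AddCommGroup V] [Module ℝ V] [TopologicalSpace V]
    (e : Basis (Fin n) ℝ E) (T : E →L[ℝ] V) (g : V →L[ℝ] V →L[ℝ] ℝ) (B : Fin n → E) :
    (e.toMatrix B).transpose * Matrix.of (fun k l => g (T (e k)) (T (e l))) * e.toMatrix B =
      Matrix.of fun i j => g (T (B i)) (T (B j)) := by
  ext i j
  rw [Matrix.of_apply, ← e.sum_toMatrix_smul_self B i, ← e.sum_toMatrix_smul_self B j]
  simp only [Matrix.mul_apply, Matrix.transpose_apply, Matrix.of_apply, map_sum, map_smul,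
    _root_.sum_apply, _root_.smul_apply, smul_eq_mul, Finset.sum_mul,
    Finset.mul_sum]
  refine Finset.sum_congr rfl fun k _ => Finset.sum_congr rfl fun l _ => ?_
  ring

end ExtAlg

namespace SU3Structure

open ExtAlg

variable {L : Type*} [TopologicalSpace L] [ChartedSpace (EuclideanSpace ℝ (Fin 6)) L]
  [IsManifold (𝓡 6) (⊤ : ℕ∞) L] (S : SU3Structure L)

theorem contMDiffOn_symmL (x₀ : L) (v : EuclideanSpace ℝ (Fin 6)) :
    ContMDiffOn (𝓡 6) ((𝓡 6).prod 𝓘(ℝ, EuclideanSpace ℝ (Fin 6))) (⊤ : ℕ∞)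
      (fun x => Bundle.TotalSpace.mk' (EuclideanSpace ℝ (Fin 6))
        (E := fun x : L => TangentSpace (𝓡 6) x) x
        ((trivializationAt (EuclideanSpace ℝ (Fin 6)) (TangentSpace (𝓡 6)) x₀).symmL ℝ x v))
      (chartAt (EuclideanSpace ℝ (Fin 6)) x₀).source := by
  have hb : (trivializationAt (EuclideanSpace ℝ (Fin 6)) (TangentSpace (𝓡 6)) x₀).baseSet =
    (chartAt (EuclideanSpace ℝ (Fin 6)) x₀).source := rfl
  rw [← hb, Bundle.Trivialization.contMDiffOn_section_baseSet_iff]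
  apply (contMDiffOn_const (c := v)).congr
  intro y hy
  have := congrArg Prod.snd (Bundle.Trivialization.apply_mk_symm
    (trivializationAt (EuclideanSpace ℝ (Fin 6)) (TangentSpace (𝓡 6)) x₀) hy v)
  rwa [← Bundle.Trivialization.symmL_apply (R := ℝ) _ hy] at this

/-- The derivative of the inverse chart is the inverse of the bundle trivialisation at x₀, whose
constant sections are smooth; the smooth metric is evaluated on two of them. -/
theorem contDiffOn_metric (x₀ : L) (v w : EuclideanSpace ℝ (Fin 6)) :
    ContDiffOn ℝ (⊤ : ℕ∞) (fun y => S.g.inner ((extChartAt (𝓡 6) x₀).symm y)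
      (mfderivWithin 𝓘(ℝ, EuclideanSpace ℝ (Fin 6)) (𝓡 6) (extChartAt (𝓡 6) x₀).symm
        (range (𝓡 6)) y v)
      (mfderivWithin 𝓘(ℝ, EuclideanSpace ℝ (Fin 6)) (𝓡 6) (extChartAt (𝓡 6) x₀).symm
        (range (𝓡 6)) y w)) (extChartAt (𝓡 6) x₀).target := by
  have h1 : ContMDiffOn (𝓡 6) ((𝓡 6).prod 𝓘(ℝ, ℝ)) (⊤ : ℕ∞)
      (fun x => Bundle.TotalSpace.mk' ℝ (E := Bundle.Trivial L ℝ) x (S.g.inner x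
        ((trivializationAt (EuclideanSpace ℝ (Fin 6)) (TangentSpace (𝓡 6)) x₀).symmL ℝ x v)
        ((trivializationAt (EuclideanSpace ℝ (Fin 6)) (TangentSpace (𝓡 6)) x₀).symmL ℝ x w)))
      (chartAt (EuclideanSpace ℝ (Fin 6)) x₀).source := by
    apply ContMDiffOn.clm_bundle_apply₂ (F₁ := EuclideanSpace ℝ (Fin 6))
      (F₂ := EuclideanSpace ℝ (Fin 6))
    · exact S.g.contMDiff.contMDiffOn
    · exact contMDiffOn_symmL x₀ v
    · exact contMDiffOn_symmL x₀ w
  have h2 : ContMDiffOn (𝓡 6) 𝓘(ℝ, ℝ) (⊤ : ℕ∞) (fun x => S.g.inner x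
        ((trivializationAt (EuclideanSpace ℝ (Fin 6)) (TangentSpace (𝓡 6)) x₀).symmL ℝ x v)
        ((trivializationAt (EuclideanSpace ℝ (Fin 6)) (TangentSpace (𝓡 6)) x₀).symmL ℝ x w))
      (chartAt (EuclideanSpace ℝ (Fin 6)) x₀).source := by
    intro x hx
    have := h1 x hx
    simp only [Bundle.contMDiffWithinAt_totalSpace] at this
    exact this.2
  refine (contMDiffOn_iff_contDiffOn.1 (h2.comp (contMDiffOn_extChartAt_symm x₀)
    fun y hy => ?_)).congr fun y hy => ?_
  · have := (extChartAt (𝓡 6) x₀).map_target hy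
    rwa [extChartAt_source] at this
  · have hx : (extChartAt (𝓡 6) x₀).symm y ∈ (chartAt (EuclideanSpace ℝ (Fin 6)) x₀).source := by
      have := (extChartAt (𝓡 6) x₀).map_target hy
      rwa [extChartAt_source] at this
    rw [Function.comp_apply, TangentBundle.symmL_trivializationAt hx,
      (extChartAt (𝓡 6) x₀).right_inv hy]
    rfl

theorem isSmooth_vol : S.vol.IsSmooth :=
  DForm.IsSmooth.smul contMDiff_const
    ((S.ω_smooth.wedge S.ω_smooth (by norm_num)).wedge S.ω_smooth (by norm_num))

theorem isSmooth_star {p q : ℕ} (h : p + q = 6) {γ : DForm (𝓡 6) L p} (hγ : γ.IsSmooth) :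
    DForm.IsSmooth (fun x => S.star q (γ x) h) := fun x₀ => by
  let e := (EuclideanSpace.basisFun (Fin 6) ℝ).toBasis
  let T := fun y : EuclideanSpace ℝ (Fin 6) => (mfderivWithin 𝓘(ℝ, EuclideanSpace ℝ (Fin 6)) (𝓡 6)
    (extChartAt (𝓡 6) x₀).symm (range (𝓡 6)) y)
  let G : EuclideanSpace ℝ (Fin 6) → Matrix (Fin 6) (Fin 6) ℝ := fun y => Matrix.of fun k l =>
    S.g.inner ((extChartAt (𝓡 6) x₀).symm y) (T y (e k)) (T y (e l))
  refine contDiffOn_hodge (G := G) e h (fun k l => S.contDiffOn_metric x₀ (e k) (e l))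
    (S.isSmooth_vol x₀) (hγ x₀) fun y hy => ?_
  obtain ⟨A, hA⟩ := isInvertible_mfderivWithin_extChartAt_symm (I := 𝓡 6) hy
  let b := (S.exists_orthonormal ((extChartAt (𝓡 6) x₀).symm y)).choose
  have hb := (S.exists_orthonormal ((extChartAt (𝓡 6) x₀).symm y)).choose_spec
  -- The chosen orthonormal basis, carried back to the chart by the invertible derivative of the
  -- inverse chart.
  let B : Fin 6 → EuclideanSpace ℝ (Fin 6) := fun i => A.symm (b i)
  have hTB : ∀ i, T y (B i) = b i := fun i => by
    change mfderivWithin _ _ _ _ _ _ = _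
    rw [← hA]
    exact A.apply_symm_apply (b i)
  refine ⟨B, ?_, ?_⟩
  · refine (toMatrix_gram e (T y) (S.g.inner ((extChartAt (𝓡 6) x₀).symm y)) B).trans ?_
    ext i j
    change S.g.inner ((extChartAt (𝓡 6) x₀).symm y) (T y (B i)) (T y (B j)) = _
    rw [hTB, hTB, Matrix.one_apply]
    exact hb i j
  · have hc : (T y ∘ B) = b := funext hTB
    have := hodge_compContinuousLinearMap h (T y) B (S.vol _) (γ _)
    rw [hc] at this
    exact this

end SU3Structure

/-! ### Rescaling by f and rotation by α + iβ -/

namespace ExtAlg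

section Linear

variable {V W : Type*} [AddCommGroup V] [Module ℝ V] [TopologicalSpace V]
  [AddCommGroup W] [Module ℝ W] [TopologicalSpace W] {n p q r : ℕ}

theorem comp_add (T : V →L[ℝ] W) (γ γ' : W [⋀^Fin p]→L[ℝ] ℝ) :
    (γ + γ').compContinuousLinearMap T =
      γ.compContinuousLinearMap T + γ'.compContinuousLinearMap T :=
  ContinuousAlternatingMap.ext fun _ => rfl

theorem comp_sub (T : V →L[ℝ] W) (γ γ' : W [⋀^Fin p]→L[ℝ] ℝ) :
    (γ - γ').compContinuousLinearMap T =
      γ.compContinuousLinearMap T - γ'.compContinuousLinearMap T :=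
  ContinuousAlternatingMap.ext fun _ => rfl

theorem comp_smul (T : V →L[ℝ] W) (r : ℝ) (γ : W [⋀^Fin p]→L[ℝ] ℝ) :
    (r • γ).compContinuousLinearMap T = r • γ.compContinuousLinearMap T :=
  ContinuousAlternatingMap.ext fun _ => rfl

end Linear

section Warped

variable {V W : Type*} [AddCommGroup V] [Module ℝ V] [TopologicalSpace V]
  [AddCommGroup W] [Module ℝ W] [TopologicalSpace W]
  {T : V →L[ℝ] W} {θ : V [⋀^Fin 1]→L[ℝ] ℝ} {f α β : ℝ}

theorem torsionOne_warped (hf : f ≠ 0) (f' π₀ σ₀ : ℝ) (ν π : W [⋀^Fin 1]→L[ℝ] ℝ) :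
    torsionOne T θ ((β * π₀ + α * σ₀) / f) (f' / f) ν π =
      (1 / (2 * f) * (π₀ * β + σ₀ * α + 2 * f')) • θ
        + (1 / 6 : ℝ) • ν.compContinuousLinearMap T + (1 / 6 : ℝ) • π.compContinuousLinearMap T :=
          by
  rw [torsionOne]
  congr 3
  field_simp

/-- Rewrites dφ in terms of ω̃ = f²ω and Ψ̃ = f³(α + iβ)Ψ. The pair (π₀, σ₀) turns into ((απ₀ −
βσ₀)/f, (βπ₀ + ασ₀)/f), the forms π₂ and σ₂ are rotated likewise and scaled by f, ν₃ is scaled by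
f², and ν and π are unchanged. The number k is the angular speed of α + iβ. -/
theorem d_form_warped (hf : f ≠ 0) {k α' β' : ℝ} (hα : α' = -β * k) (hβ : β' = α * k)
    (hαβ : α ^ 2 + β ^ 2 = 1) (f' π₀ σ₀ : ℝ) (ω : W [⋀^Fin 2]→L[ℝ] ℝ) (P Q : W [⋀^Fin 3]→L[ℝ] ℝ)
    (ν π : W [⋀^Fin 1]→L[ℝ] ℝ) (π₂ σ₂ : W [⋀^Fin 2]→L[ℝ] ℝ) (ν₃ : W [⋀^Fin 3]→L[ℝ] ℝ) :
    f ^ 2 • (((-(3 / 2) * σ₀) • P + (3 / 2 * π₀) • Q + ν ⋏[3] ω + ν₃).compContinuousLinearMap T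
        ⋏[4] θ)
      + ((3 * f ^ 2 * f' * α + f ^ 3 * α') • (θ ⋏[4] P.compContinuousLinearMap T)
        + (f ^ 3 * α) • (π₀ • (ω ⋏[4] ω) + π ⋏[4] P - π₂ ⋏[4] ω).compContinuousLinearMap T)
      + ((-(3 * f ^ 2 * f' * β + f ^ 3 * β')) • (θ ⋏[4] Q.compContinuousLinearMap T)
        + (-(f ^ 3 * β)) • (σ₀ • (ω ⋏[4] ω) + π ⋏[4] Q - σ₂ ⋏[4] ω).compContinuousLinearMap T) =
    ((-(3 / 2) * ((β * π₀ + α * σ₀) / f)) • (f ^ 3 • (α • P - β • Q))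
        + (3 / 2 * ((α * π₀ - β * σ₀) / f)) • (f ^ 3 • (α • Q + β • P))
        + ν ⋏[3] (f ^ 2 • ω) + f ^ 2 • ν₃).compContinuousLinearMap T ⋏[4] θ
      + (3 * (f' / f)) • (θ ⋏[4] (f ^ 3 • (α • P - β • Q)).compContinuousLinearMap T)
      - k • (θ ⋏[4] (f ^ 3 • (α • Q + β • P)).compContinuousLinearMap T)
      + (((α * π₀ - β * σ₀) / f) • ((f ^ 2 • ω) ⋏[4] (f ^ 2 • ω)) + π ⋏[4] (f ^ 3 • (α • P - β • Q))
        - (f • (α • π₂ - β • σ₂)) ⋏[4] (f ^ 2 • ω)).compContinuousLinearMap T := by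
  simp only [wedge_add_left, wedge_add_right, wedge_sub_left, wedge_sub_right, wedge_smul_left,
    wedge_smul_right, comp_add, comp_sub, comp_smul]
  subst hα hβ
  match_scalars <;> field_simp
  -- The unit-circle relation is needed for P ∧ θ and Q ∧ θ coming from dω, where Ψ is recovered
  -- from Ψ̃ by the inverse rotation.
  · linear_combination σ₀ * hαβ
  · linear_combination -π₀ * hαβ
  all_goals ring

/-- No angular speed appears, since the t-derivative of Im Ψ̃ is multiplied by dt twice. -/
theorem d_dual_warped (hf : f ≠ 0) (hαβ : α ^ 2 + β ^ 2 = 1) (f' π₀ σ₀ : ℝ)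
    (ω : W [⋀^Fin 2]→L[ℝ] ℝ) (P Q : W [⋀^Fin 3]→L[ℝ] ℝ)
    (ν π : W [⋀^Fin 1]→L[ℝ] ℝ) (π₂ σ₂ : W [⋀^Fin 2]→L[ℝ] ℝ) (ν₃ : W [⋀^Fin 3]→L[ℝ] ℝ) :
    ((2 * f ^ 3 * f') • (θ ⋏[5] (ω ⋏[4] ω).compContinuousLinearMap T)
        + (1 / 2 * f ^ 4) • ((2 : ℝ) • (((-(3 / 2) * σ₀) • P + (3 / 2 * π₀) • Q + ν ⋏[3] ω + ν₃)
          ⋏[5] ω)).compContinuousLinearMap T)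
      + (f ^ 3 * α) •
        ((σ₀ • (ω ⋏[4] ω) + π ⋏[4] Q - σ₂ ⋏[4] ω).compContinuousLinearMap T ⋏[5] θ)
      + (f ^ 3 * β) •
        ((π₀ • (ω ⋏[4] ω) + π ⋏[4] P - π₂ ⋏[4] ω).compContinuousLinearMap T ⋏[5] θ) =
    (((-(3 / 2) * ((β * π₀ + α * σ₀) / f)) • (f ^ 3 • (α • P - β • Q))
        + (3 / 2 * ((α * π₀ - β * σ₀) / f)) • (f ^ 3 • (α • Q + β • P))
        + ν ⋏[3] (f ^ 2 • ω) + f ^ 2 • ν₃) ⋏[5] (f ^ 2 • ω)).compContinuousLinearMap T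
      + (2 * (f' / f)) • (θ ⋏[5] ((f ^ 2 • ω) ⋏[4] (f ^ 2 • ω)).compContinuousLinearMap T)
      + (((β * π₀ + α * σ₀) / f) • ((f ^ 2 • ω) ⋏[4] (f ^ 2 • ω)) + π ⋏[4] (f ^ 3 • (α • Q + β • P))
        - (f • (β • π₂ + α • σ₂)) ⋏[4] (f ^ 2 • ω)).compContinuousLinearMap T ⋏[5] θ := by
  simp only [wedge_add_left, wedge_add_right, wedge_sub_left, wedge_sub_right, wedge_smul_left,
    wedge_smul_right, comp_add, comp_sub, comp_smul]
  match_scalars <;> field_simp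
  · linear_combination σ₀ * hαβ
  · linear_combination -π₀ * hαβ
  · ring

variable [IsTopologicalAddGroup W] [ContinuousSMul ℝ W] [T2Space W] {c : Basis (Fin 6) ℝ W}
  {o : Fin 6 → W} {vol : W [⋀^Fin 6]→L[ℝ] ℝ}

/-- For f²g the star is multiplied by f⁻² on 4-forms and by f⁻⁴ on 5-forms. Against the factors f³
of Ψ̃ and f⁴ of ω̃² this leaves f in front of the stars of 4-forms and 1 in front of those of
5-forms. -/
theorem torsionTwo_warped (hf : f ≠ 0)
    (ho : ∀ {p q : ℕ} (h : p + q = 6) (γ : W [⋀^Fin p]→L[ℝ] ℝ),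
      hodge c (frameVol c) q γ h = (f ^ 6 * f⁻¹ ^ (2 * p)) • hodge o vol q γ h)
    (ω : W [⋀^Fin 2]→L[ℝ] ℝ) (P Q : W [⋀^Fin 3]→L[ℝ] ℝ) (ν π : W [⋀^Fin 1]→L[ℝ] ℝ)
    (π₂ σ₂ : W [⋀^Fin 2]→L[ℝ] ℝ) :
    torsionTwo T θ c (f ^ 2 • ω) (f ^ 3 • (α • Q + β • P)) ((1 / 3 : ℝ) • ((2 : ℝ) • ν - π))
      (f • (β • π₂ + α • σ₂)) =
    (-(2 / 3) : ℝ) • ((hodge o vol 1 (ν ⋏[5] (ω ⋏[4] ω))).compContinuousLinearMap T ⋏[2] θ)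
      + (1 / 3 : ℝ) • ((hodge o vol 1 (π ⋏[5] (ω ⋏[4] ω))).compContinuousLinearMap T ⋏[2] θ)
      - (1 / 3 * f * β) • (hodge o vol 2 (π ⋏[4] P)).compContinuousLinearMap T
      - (1 / 3 * f * α) • (hodge o vol 2 (π ⋏[4] Q)).compContinuousLinearMap T
      + (2 / 3 * f * β) • (hodge o vol 2 (ν ⋏[4] P)).compContinuousLinearMap T
      + (2 / 3 * f * α) • (hodge o vol 2 (ν ⋏[4] Q)).compContinuousLinearMap T
      - (f * β) • π₂.compContinuousLinearMap T - (f * α) • σ₂.compContinuousLinearMap T := by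
  have h4 : f ^ 6 * f⁻¹ ^ (2 * 4) = (f ^ 2)⁻¹ := by norm_num; field_simp
  have h5 : f ^ 6 * f⁻¹ ^ (2 * 5) = (f ^ 4)⁻¹ := by norm_num; field_simp
  rw [torsionTwo]
  simp only [ho, h4, h5, wedge_add_left, wedge_add_right, wedge_sub_left, wedge_sub_right,
    wedge_smul_left,
    wedge_smul_right, hodge_add, hodge_sub, hodge_smul, comp_add, comp_sub, comp_smul]
  match_scalars <;> field_simp

/-- The star on 3-forms is unchanged by the rescaling, so those terms carry the f² of ω̃ and of the
rescaled ν₃. Substituting α' = −βk and β' = αk converts the coefficient in k into the stated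
derivatives. -/
theorem torsionThree_warped (hf : f ≠ 0)
    (ho : ∀ {p q : ℕ} (h : p + q = 6) (γ : W [⋀^Fin p]→L[ℝ] ℝ),
      hodge c (frameVol c) q γ h = (f ^ 6 * f⁻¹ ^ (2 * p)) • hodge o vol q γ h)
    {k α' β' : ℝ} (hα : α' = -β * k) (hβ : β' = α * k) (hαβ : α ^ 2 + β ^ 2 = 1) (π₀ σ₀ : ℝ)
    (ω : W [⋀^Fin 2]→L[ℝ] ℝ) (P Q : W [⋀^Fin 3]→L[ℝ] ℝ) (ν π : W [⋀^Fin 1]→L[ℝ] ℝ)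
    (π₂ σ₂ : W [⋀^Fin 2]→L[ℝ] ℝ) (ν₃ : W [⋀^Fin 3]→L[ℝ] ℝ) :
    torsionThree T θ c ((α * π₀ - β * σ₀) / f - 2 * k) (f ^ 2 • ω) (f ^ 3 • (α • P - β • Q))
      ((1 / 2 : ℝ) • (π - ν)) (f • (α • π₂ - β • σ₂)) (f ^ 2 • ν₃) =
    (-(3 / 14) * f ^ 2 * (π₀ * α ^ 2 - σ₀ * α * β - 2 * f * β')) • P.compContinuousLinearMap T
      + (3 / 14 * f ^ 2 * (π₀ * α * β - σ₀ * β ^ 2 + 2 * f * α')) • Q.compContinuousLinearMap T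
      + (2 / 7 * f * (π₀ * α - σ₀ * β - 2 * f * α * β' + 2 * f * β * α')) •
        (ω.compContinuousLinearMap T ⋏[3] θ)
      - (1 / 2 * f ^ 2) • (hodge o vol 3 (ν ⋏[3] ω)).compContinuousLinearMap T
      + (1 / 2 * f ^ 2) • (hodge o vol 3 (π ⋏[3] ω)).compContinuousLinearMap T
      + (1 / 2 * f * α) • ((hodge o vol 2 (π ⋏[4] P)).compContinuousLinearMap T ⋏[3] θ)
      - (1 / 2 * f * β) • ((hodge o vol 2 (π ⋏[4] Q)).compContinuousLinearMap T ⋏[3] θ)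
      - (1 / 2 * f * α) • ((hodge o vol 2 (ν ⋏[4] P)).compContinuousLinearMap T ⋏[3] θ)
      + (1 / 2 * f * β) • ((hodge o vol 2 (ν ⋏[4] Q)).compContinuousLinearMap T ⋏[3] θ)
      + f • ((α • π₂ - β • σ₂).compContinuousLinearMap T ⋏[3] θ)
      - f ^ 2 • (hodge o vol 3 ν₃).compContinuousLinearMap T := by
  have h3 : f ^ 6 * f⁻¹ ^ (2 * 3) = 1 := by norm_num; field_simp
  have h4 : f ^ 6 * f⁻¹ ^ (2 * 4) = (f ^ 2)⁻¹ := by norm_num; field_simp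
  rw [torsionThree]
  simp only [ho, h3, h4, wedge_add_left, wedge_add_right, wedge_sub_left, wedge_sub_right,
    wedge_smul_left,
    wedge_smul_right, hodge_add, hodge_sub, hodge_smul, comp_add, comp_sub, comp_smul]
  subst hα hβ
  match_scalars <;> field_simp
  · ring
  · linear_combination (2 * f * k) * hαβ

end Warped

namespace IsHermitian

variable {W : Type*} [AddCommGroup W] [Module ℝ W] [TopologicalSpace W]
  {g : W →L[ℝ] W →L[ℝ] ℝ} {J : W →L[ℝ] W} {ω : W [⋀^Fin 2]→L[ℝ] ℝ}
  {P Q : W [⋀^Fin 3]→L[ℝ] ℝ}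

theorem wedge_three_comm (P Q : W [⋀^Fin 3]→L[ℝ] ℝ) : Q ⋏[6] P = -(P ⋏[6] Q) := by
  ext v
  have hv : v = ![v 0, v 1, v 2, v 3, v 4, v 5] := by ext i; fin_cases i <;> rfl
  rw [hv]
  simp only [wedge_three_three_apply, ContinuousAlternatingMap.neg_apply]
  ring

theorem wedge_three_self (P : W [⋀^Fin 3]→L[ℝ] ℝ) : P ⋏[6] P = 0 := by
  ext v
  have h := congrArg (fun η => η v) (wedge_three_comm P P)
  simp only [ContinuousAlternatingMap.neg_apply] at h
  simp only [ContinuousAlternatingMap.coe_zero, Pi.zero_apply]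
  linarith

/-- Rescaling of the metric and rotation of the complex volume form. -/
theorem warp [ContinuousSMul ℝ W] (H : IsHermitian g J ω P Q) {f : ℝ} (hf : f ≠ 0) (α β : ℝ) :
    IsHermitian (f ^ 2 • g) J (f ^ 2 • ω) (f ^ 3 • (α • P - β • Q)) (f ^ 3 • (α • Q + β • P)) where
  symm u v := by simp [H.symm u v]
  pos v hv := by
    have := H.pos v hv
    simp only [_root_.smul_apply, smul_eq_mul]
    positivity
  J_sq := H.J_sq
  isometry u v := by simp [H.isometry u v]
  ω_apply u v := by simp [H.ω_apply u v]
  type_re u v w := by simp [H.type_re, H.type_im]; ring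
  type_im u v w := by simp [H.type_re, H.type_im]; ring

/-- P ∧ P and Q ∧ Q vanish, and the mixed terms combine to (α² + β²) P ∧ Q; both sides scale by f⁶.
-/
theorem warp_normalization (hn : (3 / 2 : ℝ) • (P ⋏[6] Q) = (ω ⋏[4] ω) ⋏[6] ω) (f : ℝ) {α β : ℝ}
    (hαβ : α ^ 2 + β ^ 2 = 1) :
    (3 / 2 : ℝ) • ((f ^ 3 • (α • P - β • Q)) ⋏[6] (f ^ 3 • (α • Q + β • P))) =
      ((f ^ 2 • ω) ⋏[4] (f ^ 2 • ω)) ⋏[6] (f ^ 2 • ω) := by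
  simp only [wedge_add_right, wedge_sub_left, wedge_smul_left, wedge_smul_right, ← hn,
    wedge_three_comm P Q, wedge_three_self]
  match_scalars
  linear_combination (3 / 2 * f ^ 6) * hαβ

end IsHermitian

/-- The Hodge star of a rescaled metric. -/
theorem hodge_scaled {W : Type*} [AddCommGroup W] [Module ℝ W] [TopologicalSpace W]
    [IsTopologicalAddGroup W] [ContinuousSMul ℝ W] [T2Space W] {n p q : ℕ} {f : ℝ} (hf : f ≠ 0)
    {g : W →L[ℝ] W →L[ℝ] ℝ} {o c : Basis (Fin n) ℝ W}
    (ho : ∀ i j, g (o i) (o j) = if i = j then 1 else 0)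
    (hc : ∀ i j, (f ^ 2 • g) (c i) (c j) = if i = j then 1 else 0)
    {vol : W [⋀^Fin n]→L[ℝ] ℝ} (hvol : frameVol c = f ^ n • vol) (h : p + q = n)
    (γ : W [⋀^Fin p]→L[ℝ] ℝ) :
    hodge c (frameVol c) q γ h = (f ^ n * f⁻¹ ^ (2 * p)) • hodge o vol q γ h := by
  have hexp : ∀ i, f • c i = ∑ k, (fun k i => g (o k) (f • c i)) k i • o k := by
    intro i
    have hrepr : ∀ w k, g (o k) w = o.repr w k := fun w k => calc
      g (o k) w = g (o k) (∑ j, o.repr w j • o j) := by rw [o.sum_repr]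
      _ = o.repr w k := by
        simp only [map_sum, map_smul, ho, smul_eq_mul]
        simp
    simp only [hrepr]
    exact (o.sum_repr _).symm
  -- The vectors f cᵢ are orthonormal for g, so their matrix in the orthonormal basis o is
  -- orthogonal.
  have hA : (Matrix.of fun k i => g (o k) (f • c i)).transpose *
      (Matrix.of fun k i => g (o k) (f • c i)) = 1 := by
    ext i j
    have h1 : g (f • c i) (f • c j) = if i = j then 1 else 0 := by
      rw [← hc i j]
      simp
      ring
    rw [Matrix.one_apply, ← h1]
    conv_rhs => rw [hexp i, hexp j]
    simp only [Matrix.mul_apply, Matrix.transpose_apply, Matrix.of_apply, map_sum, map_smul,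
      _root_.sum_apply, _root_.smul_apply, ho, smul_eq_mul]
    simp [mul_comm]
  -- Writing c as f⁻¹ times a g-orthonormal frame produces the factor f⁻²ᵖ; the factor fⁿ comes from
  -- the volume form.
  have hcf : (c : Fin n → W) = fun i => f⁻¹ • (f • c i) := by
    ext i
    rw [smul_smul, inv_mul_cancel₀ hf, one_smul]
  rw [hvol]
  conv_lhs => rw [hcf]
  rw [hodge_smul_frame, hodge_eq_of_orthogonal h vol γ
    (Matrix.of fun k i => g (o k) (f • c i)) (mul_eq_one_comm.1 hA) (fun i => f • c i) o hexp]

end ExtAlg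

/-! ### Adapted frames for the warped structure -/

namespace ExtAlg

variable {V W : Type*} [AddCommGroup V] [Module ℝ V] [TopologicalSpace V]
  [AddCommGroup W] [Module ℝ W] [TopologicalSpace W]

/-- T detects the first six coefficients of a relation; the last vector is nonzero because θ takes
the value 1 on it. -/
theorem IsLift.linearIndependent {T : V →L[ℝ] W} {θ : V [⋀^Fin 1]→L[ℝ] ℝ} {c : Basis (Fin 6) ℝ W}
    {v : Fin 7 → V} (h : IsLift T θ c v) : LinearIndependent ℝ v := by
  rw [Fintype.linearIndependent_iff]
  intro a ha
  have h1 := congrArg T ha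
  rw [Fin.sum_univ_seven] at h1
  simp only [map_add, map_smul, h.map_zero', h.map_one', h.map_two', h.map_three', h.map_four',
    h.map_five', h.map_six', smul_zero, add_zero, map_zero] at h1
  have h2 := Fintype.linearIndependent_iff.1 c.linearIndependent
    ![a 0, a 1, a 2, a 3, a 4, a 5] (by rw [Fin.sum_univ_six]; exact h1)
  have e0 : a 0 = 0 := h2 0
  have e1 : a 1 = 0 := h2 1
  have e2 : a 2 = 0 := h2 2
  have e3 : a 3 = 0 := h2 3
  have e4 : a 4 = 0 := h2 4
  have e5 : a 5 = 0 := h2 5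
  rw [Fin.sum_univ_seven] at ha
  simp only [e0, e1, e2, e3, e4, e5, zero_smul, zero_add] at ha
  have e6 : a 6 = 0 := by
    rcases smul_eq_zero.1 ha with h6 | h6
    · exact h6
    · have h7 := h.coord.2.2.2.2.2.2
      rw [h6, θ.map_coord_zero (0 : Fin 1) rfl] at h7
      exact absurd h7 zero_ne_one
  intro i
  fin_cases i <;> assumption

theorem IsLift.exists_basis {T : V →L[ℝ] W} {θ : V [⋀^Fin 1]→L[ℝ] ℝ} {c : Basis (Fin 6) ℝ W}
    {v : Fin 7 → V} (h : IsLift T θ c v) (hV : finrank ℝ V = 7) :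
    ∃ b : Basis (Fin 7) ℝ V, ⇑b = v :=
  ⟨basisOfLinearIndependentOfCardEqFinrank h.linearIndependent (by rw [hV]; rfl), by simp⟩

set_option maxRecDepth 4000 in
/-- Frames adapted to the rescaled and rotated `SU(3)`-structure. -/
theorem IsHermitian.exists_warped_frame [IsTopologicalAddGroup W] [ContinuousSMul ℝ W] [T2Space W]
    {g : W →L[ℝ] W →L[ℝ] ℝ} {J : W →L[ℝ] W} {ω : W [⋀^Fin 2]→L[ℝ] ℝ} {P Q : W [⋀^Fin 3]→L[ℝ] ℝ}
    (H : IsHermitian g J ω P Q) (hW : finrank ℝ W = 6)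
    (hn : (3 / 2 : ℝ) • (P ⋏[6] Q) = (ω ⋏[4] ω) ⋏[6] ω) {o : Basis (Fin 6) ℝ W}
    (ho : ∀ i j, g (o i) (o j) = if i = j then 1 else 0)
    {f α β : ℝ} (hf : f ≠ 0) (hαβ : α ^ 2 + β ^ 2 = 1) :
    ∃ c : Basis (Fin 6) ℝ W,
      IsSU3Frame (f ^ 2 • ω) (f ^ 3 • (α • P - β • Q)) (f ^ 3 • (α • Q + β • P)) c ∧
      (∀ {p q : ℕ} (h : p + q = 6) (γ : W [⋀^Fin p]→L[ℝ] ℝ),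
        hodge c (frameVol c) q γ h = (f ^ 6 * f⁻¹ ^ (2 * p)) •
          hodge o ((1 / 6 : ℝ) • ((ω ⋏[4] ω) ⋏[6] ω)) q γ h) ∧
      (∀ γ : W [⋀^Fin 2]→L[ℝ] ℝ,
        (∀ u v, γ ![J u, J v] = γ ![u, v]) → γ ⋏[6] (ω ⋏[4] ω) = 0 → IsPrimitiveTwo γ c) ∧
      (∀ γ : W [⋀^Fin 3]→L[ℝ] ℝ, γ ⋏[5] ω = 0 → γ ⋏[6] P = 0 → γ ⋏[6] Q = 0 →
        IsPrimitiveThree γ c) := by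
  have H' := H.warp hf α β
  obtain ⟨c, hF, hc, h0, h2, h4⟩ := H'.exists_frame hW (warp_normalization hn f hαβ)
  refine ⟨c, hF, fun h γ => ?_, fun γ hJ hγ => ?_, fun γ hω hP hQ => ?_⟩
  · refine hodge_scaled hf ho hc ?_ h γ
    have h1 := eq_smul_frameVol c (((f ^ 2 • ω) ⋏[4] (f ^ 2 • ω)) ⋏[6] (f ^ 2 • ω))
    have hv : (c : Fin 6 → _) = ![c 0, c 1, c 2, c 3, c 4, c 5] := by
      ext i; fin_cases i <;> rfl
    rw [hv, IsHermitian.ω_pow_three_apply hF] at h1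
    simp only [wedge_smul_left, wedge_smul_right] at h1
    have h2 : frameVol c = (1 / 6 : ℝ) • (6 : ℝ) • frameVol c := by module
    rw [h2, ← h1]
    module
  · refine H'.isPrimitiveTwo hF h0 h2 h4 hJ ?_
    simp only [wedge_smul_left, wedge_smul_right, hγ, smul_zero]
  · refine hF.isPrimitiveThree ?_ ?_ ?_ <;>
    simp only [wedge_smul_left, wedge_smul_right, wedge_add_right, wedge_sub_right, hω, hP, hQ,
      smul_zero, sub_zero, add_zero]

end ExtAlg

namespace SU3Structure

open ExtAlg

variable {L : Type*} [TopologicalSpace L] [ChartedSpace (EuclideanSpace ℝ (Fin 6)) L]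
  [IsManifold (𝓡 6) (⊤ : ℕ∞) L] (S : SU3Structure L)

theorem isHermitian (x : L) :
    IsHermitian (S.g.inner x) (S.J x) (S.ω x) (S.ψp x) (S.ψm x) where
  symm := S.g.symm x
  pos := S.g.pos x
  J_sq := S.J_sq x
  isometry := S.J_isometry x
  ω_apply := S.ω_apply x
  type_re := S.type_re x
  type_im := S.type_im x

set_option maxRecDepth 4000 in
/-- Frames adapted to the rescaled and rotated `SU(3)`-structure. -/
theorem exists_frame (x : L) {f α β : ℝ} (hf : f ≠ 0) (hαβ : α ^ 2 + β ^ 2 = 1) :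
    ∃ c : Basis (Fin 6) ℝ (TangentSpace (𝓡 6) x),
      IsSU3Frame (f ^ 2 • S.ω x) (f ^ 3 • (α • S.ψp x - β • S.ψm x))
        (f ^ 3 • (α • S.ψm x + β • S.ψp x)) c ∧
      (∀ {p q : ℕ} (h : p + q = 6) (γ : (TangentSpace (𝓡 6) x) [⋀^Fin p]→L[ℝ] ℝ),
        hodge c (frameVol c) q γ h = (f ^ 6 * f⁻¹ ^ (2 * p)) • S.star q γ h) ∧
      (∀ γ : (TangentSpace (𝓡 6) x) [⋀^Fin 2]→L[ℝ] ℝ,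
        (∀ u v, γ ![S.J x u, S.J x v] = γ ![u, v]) → γ ⋏[6] S.ωsq x = 0 → IsPrimitiveTwo γ c) ∧
      (∀ γ : (TangentSpace (𝓡 6) x) [⋀^Fin 3]→L[ℝ] ℝ, γ ⋏[5] S.ω x = 0 → γ ⋏[6] S.ψp x = 0 →
        γ ⋏[6] S.ψm x = 0 → IsPrimitiveThree γ c) := by
  have hfr : finrank ℝ (TangentSpace (𝓡 6) x) = 6 :=
    (finrank_euclideanSpace (𝕜 := ℝ) (ι := Fin 6)).trans (Fintype.card_fin 6)
  exact (S.isHermitian x).exists_warped_frame hfr (S.normalization x)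
    (S.exists_orthonormal x).choose_spec hf hαβ

end SU3Structure

namespace Warped

open ExtAlg

variable {L : Type*} [TopologicalSpace L] [ChartedSpace (EuclideanSpace ℝ (Fin 6)) L]
  [IsManifold (𝓡 6) (⊤ : ℕ∞) L] {U : TopologicalSpace.Opens ℝ} {p : ℕ}

theorem exists_lift (m : U × L) (c : Basis (Fin 6) ℝ (TangentSpace (𝓡 6) m.2)) :
    ∃ b : Basis (Fin 7) ℝ (TangentSpace model m),
      IsLift (mfderiv model (𝓡 6) (Prod.snd : U × L → L) m) (dt m) c b := by
  have hfr : finrank ℝ (TangentSpace model m) = 7 := by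
    change finrank ℝ (ℝ × EuclideanSpace ℝ (Fin 6)) = 7
    simp
  -- The frame vectors with zero t-component, completed by ∂_t = (1, 0).
  let v : Fin 7 → TangentSpace model m :=
    ![((0, c 0) : ℝ × EuclideanSpace ℝ (Fin 6)), (0, c 1), (0, c 2), (0, c 3), (0, c 4), (0, c 5),
      (1, 0)]
  have hT : ∀ w : ℝ × EuclideanSpace ℝ (Fin 6),
      mfderiv model (𝓡 6) (Prod.snd : U × L → L) m w = w.2 := fun w => by rw [mfderiv_snd]; rfl
  have hθ : ∀ w : ℝ × EuclideanSpace ℝ (Fin 6), dt m ![w] = w.1 := fun w => by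
    have := DFunLike.congr_fun (dt_eq m) ![w]
    exact this
  have h : IsLift (V := TangentSpace model m) (mfderiv model (𝓡 6) (Prod.snd : U × L → L) m)
      (dt m) c v :=
    ⟨hT _, hT _, hT _, hT _, hT _, hT _, hT _, hθ _, hθ _, hθ _, hθ _, hθ _, hθ _, hθ _⟩
  obtain ⟨b, hb⟩ := h.exists_basis hfr
  exact ⟨b, hb ▸ h⟩

end Warped

/-! ### Uniqueness of the torsion forms -/

namespace ExtAlg

/-- The torsion forms at a point are determined by the structure equations. -/
theorem IsG2Frame.torsion_unique {V : Type*} [AddCommGroup V] [Module ℝ V] [TopologicalSpace V]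
    [IsTopologicalAddGroup V] [ContinuousSMul ℝ V] [T2Space V] {φ : V [⋀^Fin 3]→L[ℝ] ℝ}
    {Φ : V [⋀^Fin 4]→L[ℝ] ℝ} {b : Basis (Fin 7) ℝ V} (hb : IsG2Frame φ Φ b) {τ₀ τ₀' : ℝ}
    {τ₁ τ₁' : V [⋀^Fin 1]→L[ℝ] ℝ} {τ₂ τ₂' : V [⋀^Fin 2]→L[ℝ] ℝ} {τ₃ τ₃' : V [⋀^Fin 3]→L[ℝ] ℝ}
    (h2 : τ₂ ⋏[6] Φ = 0) (h2' : τ₂' ⋏[6] Φ = 0) (h3 : τ₃ ⋏[7] Φ = 0) (h3' : τ₃' ⋏[7] Φ = 0)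
    (h4 : τ₀ • Φ + (3 : ℝ) • (τ₁ ⋏[4] φ) + G2.star φ 4 τ₃ =
      τ₀' • Φ + (3 : ℝ) • (τ₁' ⋏[4] φ) + G2.star φ 4 τ₃')
    (h5 : (4 : ℝ) • (τ₁ ⋏[5] Φ) + τ₂ ⋏[5] φ = (4 : ℝ) • (τ₁' ⋏[5] Φ) + τ₂' ⋏[5] φ) :
    τ₀ = τ₀' ∧ τ₁ = τ₁' ∧ τ₂ = τ₂' ∧ τ₃ = τ₃' := by
  -- The 5-form equation involves only τ₁ and τ₂; once τ₁ = τ₁' is known, its term drops out of the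
  -- 4-form equation.
  obtain ⟨e1, e2⟩ := hb.eq_zero_of_five (τ₁ := τ₁ - τ₁') (τ₂ := τ₂ - τ₂')
    (by rw [wedge_sub_left, h2, h2', sub_zero])
    (by rw [wedge_sub_left, wedge_sub_left, ← sub_eq_zero.2 h5]; module)
  rw [G2.star_eq_hodge hb.isAdapted, G2.star_eq_hodge hb.isAdapted, sub_eq_zero.1 e1] at h4
  obtain ⟨e0, e3⟩ := hb.eq_zero_of_four (τ₀ := τ₀ - τ₀') (τ₃ := τ₃ - τ₃')
    (by rw [wedge_sub_left, h3, h3', sub_zero]) (by norm_num)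
    (by rw [hodge_sub, ← sub_eq_zero.2 h4]; module)
  exact ⟨sub_eq_zero.1 e0, sub_eq_zero.1 e1, sub_eq_zero.1 e2, sub_eq_zero.1 e3⟩

end ExtAlg

namespace G2

open ExtAlg

variable {E : Type*} [NormedAddCommGroup E] [NormedSpace ℝ E] {H : Type*} [TopologicalSpace H]
  {I : ModelWithCorners ℝ E H} {M : Type*} [TopologicalSpace M] [ChartedSpace H M]

/-- The torsion forms of a `G₂`-structure are unique. -/
theorem IsTorsion.unique {φ : DForm I M 3}
    (hφ : ∀ x, ∃ b : Basis (Fin 7) ℝ (TangentSpace I x), IsG2Frame (φ x) (starForm φ x) b)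
    {τ₀ τ₀' : M → ℝ} {τ₁ τ₁' : DForm I M 1} {τ₂ τ₂' : DForm I M 2} {τ₃ τ₃' : DForm I M 3}
    (h : IsTorsion φ τ₀ τ₁ τ₂ τ₃) (h' : IsTorsion φ τ₀' τ₁' τ₂' τ₃') (x : M) :
    τ₀ x = τ₀' x ∧ τ₁ x = τ₁' x ∧ τ₂ x = τ₂' x ∧ τ₃ x = τ₃' x := by
  obtain ⟨b, hb⟩ := hφ x
  exact hb.torsion_unique (h.mem_τ₂ x) (h'.mem_τ₂ x) (h.mem_τ₃ x).2 (h'.mem_τ₃ x).2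
    ((h.d_φ x).symm.trans (h'.d_φ x)) ((h.d_starφ x).symm.trans (h'.d_starφ x))

end G2

/-! ### The warped 3-form, its dual and their derivatives -/

namespace Warped

open ExtAlg

variable {L : Type*} [TopologicalSpace L] [ChartedSpace (EuclideanSpace ℝ (Fin 6)) L]
  [IsManifold (𝓡 6) (⊤ : ℕ∞) L] {U : TopologicalSpace.Opens ℝ} (S : SU3Structure L)
  {f α β : ℝ → ℝ}

theorem form_eq_cylinderForm (m : U × L) :
    form S f α β m = cylinderForm (mfderiv model (𝓡 6) (Prod.snd : U × L → L) m) (dt m)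
      (f m.1 ^ 2 • S.ω m.2) (f m.1 ^ 3 • (α m.1 • S.ψp m.2 - β m.1 • S.ψm m.2)) := by
  rw [cylinderForm, comp_smul, wedge_smul_left]
  rfl

/-- The 4-form `(f⁴ / 2) ω² + f³ (α ψ₋ + β ψ₊) ∧ dt`. -/
def dualForm (S : SU3Structure L) (f α β : ℝ → ℝ) : DForm model (U × L) 4 := fun m =>
  (1 / 2 * f m.1 ^ 4) • pull m (S.ωsq m.2) + (f m.1 ^ 3 * α m.1) • (pull m (S.ψm m.2) ⋏[4] dt m)
    + (f m.1 ^ 3 * β m.1) • (pull m (S.ψp m.2) ⋏[4] dt m)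

theorem dualForm_eq_cylinderDual (m : U × L) :
    dualForm S f α β m = cylinderDual (mfderiv model (𝓡 6) (Prod.snd : U × L → L) m) (dt m)
      (f m.1 ^ 2 • S.ω m.2) (f m.1 ^ 3 • (α m.1 • S.ψm m.2 + β m.1 • S.ψp m.2)) := by
  rw [cylinderDual, dualForm, SU3Structure.ωsq, pull, pull, pull]
  simp only [comp_smul, comp_add, wedge_smul_left, wedge_smul_right, wedge_add_left]
  match_scalars <;> ring

variable {S}

/-- Adapted frames at the points of the warped product. -/
theorem exists_frames {m : U × L} (hf : f m.1 ≠ 0) (hαβ : α m.1 ^ 2 + β m.1 ^ 2 = 1) :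
    ∃ (c : Basis (Fin 6) ℝ (TangentSpace (𝓡 6) m.2)) (b : Basis (Fin 7) ℝ (TangentSpace model m)),
      IsSU3Frame (f m.1 ^ 2 • S.ω m.2) (f m.1 ^ 3 • (α m.1 • S.ψp m.2 - β m.1 • S.ψm m.2))
        (f m.1 ^ 3 • (α m.1 • S.ψm m.2 + β m.1 • S.ψp m.2)) c ∧
      IsLift (mfderiv model (𝓡 6) (Prod.snd : U × L → L) m) (dt m) c b ∧
      IsG2Frame (form S f α β m) (dualForm S f α β m) b ∧
      (∀ {p q : ℕ} (h : p + q = 6) (γ : (TangentSpace (𝓡 6) m.2) [⋀^Fin p]→L[ℝ] ℝ),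
        hodge c (frameVol c) q γ h = (f m.1 ^ 6 * (f m.1)⁻¹ ^ (2 * p)) • S.star q γ h) ∧
      (∀ γ : (TangentSpace (𝓡 6) m.2) [⋀^Fin 2]→L[ℝ] ℝ,
        (∀ u v, γ ![S.J m.2 u, S.J m.2 v] = γ ![u, v]) → γ ⋏[6] S.ωsq m.2 = 0 →
          IsPrimitiveTwo γ c) ∧
      (∀ γ : (TangentSpace (𝓡 6) m.2) [⋀^Fin 3]→L[ℝ] ℝ, γ ⋏[5] S.ω m.2 = 0 →
        γ ⋏[6] S.ψp m.2 = 0 → γ ⋏[6] S.ψm m.2 = 0 → IsPrimitiveThree γ c) := by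
  obtain ⟨c, hF, ho, h2, h3⟩ := S.exists_frame m.2 hf hαβ
  obtain ⟨b, hb⟩ := exists_lift m c
  refine ⟨c, b, hF, hb, ?_, ho, h2, h3⟩
  rw [form_eq_cylinderForm, dualForm_eq_cylinderDual]
  exact isG2Frame_cylinder hF hb

/-- This removes the choice hidden in `G2.star` and leaves a 4-form that can be differentiated term
by term. -/
theorem starForm_form (hf : ∀ t ∈ U, f t ≠ 0) (hαβ : ∀ t ∈ U, α t ^ 2 + β t ^ 2 = 1) :
    G2.starForm (form S f α β : DForm model (U × L) 3) = dualForm S f α β := by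
  funext m
  obtain ⟨c, b, -, -, hb, -⟩ := exists_frames (S := S) (hf m.1 m.1.2) (hαβ m.1 m.1.2)
  exact hb.star_eq (by norm_num)

variable {π₀ σ₀ : L → ℝ} {π₁ ν₁ : DForm (𝓡 6) L 1} {π₂ σ₂ : DForm (𝓡 6) L 2}
  {ν₃ : DForm (𝓡 6) L 3}

theorem isSmooth_smul_pull {p : ℕ} {h : ℝ → ℝ} (hh : ContDiffOn ℝ (⊤ : ℕ∞) h U)
    {γ : DForm (𝓡 6) L p} (hγ : γ.IsSmooth) :
    DForm.IsSmooth (fun m : U × L => h m.1 • pull m (γ m.2)) :=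
  (isSmooth_pull hγ).smul (contMDiff_fst_comp hh)

theorem isSmooth_smul_pull_wedge_dt {p r : ℕ} (hr : p + 1 = r) {h : ℝ → ℝ}
    (hh : ContDiffOn ℝ (⊤ : ℕ∞) h U) {γ : DForm (𝓡 6) L p} (hγ : γ.IsSmooth) :
    DForm.IsSmooth (fun m : U × L => h m.1 • wedge r (pull m (γ m.2)) (dt m) hr) :=
  ((isSmooth_pull hγ).wedge isSmooth_dt hr).smul (contMDiff_fst_comp hh)

/-- Each summand is now a function of t times a pulled-back form, possibly wedged with dt, which is
the shape covered by the derivative and smoothness lemmas. -/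
theorem form_eq_add : (form S f α β : DForm model (U × L) 3) = fun m =>
    f m.1 ^ 2 • (pull m (S.ω m.2) ⋏[3] dt m) + (f m.1 ^ 3 * α m.1) • pull m (S.ψp m.2)
      + (-(f m.1 ^ 3 * β m.1)) • pull m (S.ψm m.2) := by
  funext m
  rw [form]
  module

theorem isSmooth_form (hf : ContDiffOn ℝ (⊤ : ℕ∞) f U) (hα : ContDiffOn ℝ (⊤ : ℕ∞) α U)
    (hβ : ContDiffOn ℝ (⊤ : ℕ∞) β U) : (form S f α β : DForm model (U × L) 3).IsSmooth := by
  rw [form_eq_add]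
  exact ((isSmooth_smul_pull_wedge_dt _ (hf.pow 2) S.ω_smooth).add
    (isSmooth_smul_pull ((hf.pow 3).mul hα) S.ψp_smooth)).add
    (isSmooth_smul_pull ((hf.pow 3).mul hβ).neg S.ψm_smooth)

theorem d_form (hf : ContDiffOn ℝ (⊤ : ℕ∞) f U) (hα : ContDiffOn ℝ (⊤ : ℕ∞) α U)
    (hβ : ContDiffOn ℝ (⊤ : ℕ∞) β U) (m : U × L) :
    (form S f α β : DForm model (U × L) 3).d m =
    f m.1 ^ 2 • (pull m (S.ω.d m.2) ⋏[4] dt m)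
      + ((3 * f m.1 ^ 2 * deriv f m.1 * α m.1 + f m.1 ^ 3 * deriv α m.1) •
          (dt m ⋏[4] pull m (S.ψp m.2)) + (f m.1 ^ 3 * α m.1) • pull m (S.ψp.d m.2))
      + ((-(3 * f m.1 ^ 2 * deriv f m.1 * β m.1 + f m.1 ^ 3 * deriv β m.1)) •
          (dt m ⋏[4] pull m (S.ψm m.2)) + (-(f m.1 ^ 3 * β m.1)) • pull m (S.ψm.d m.2)) := by
  have hd : ∀ {h : ℝ → ℝ}, ContDiffOn ℝ (⊤ : ℕ∞) h U → HasDerivAt h (deriv h m.1) m.1 :=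
    fun hh => ((hh.contDiffAt (U.isOpen.mem_nhds m.1.2)).differentiableAt (by simp)).hasDerivAt
  have s1 := isSmooth_smul_pull_wedge_dt (by norm_num : 2 + 1 = 3) (hf.pow 2) S.ω_smooth
  have s2 := isSmooth_smul_pull ((hf.pow 3).mul hα) S.ψp_smooth
  have s3 := isSmooth_smul_pull ((hf.pow 3).mul hβ).neg S.ψm_smooth
  have e1 := d_smul_pull_wedge_dt_two (hf.pow 2) S.ω_smooth m
  have e2 := d_smul_pull_three ((hf.pow 3).mul hα) S.ψp_smooth m
  have e3 := d_smul_pull_three ((hf.pow 3).mul hβ).neg S.ψm_smooth m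
  have d2 : deriv (fun t => f t ^ 3 * α t) m.1 =
      3 * f m.1 ^ 2 * deriv f m.1 * α m.1 + f m.1 ^ 3 * deriv α m.1 := by
    refine (((hd hf).pow 3).mul (hd hα)).deriv.trans ?_
    simp
  have d3 : deriv (fun t => -(f t ^ 3 * β t)) m.1 =
      -(3 * f m.1 ^ 2 * deriv f m.1 * β m.1 + f m.1 ^ 3 * deriv β m.1) := by
    refine (((hd hf).pow 3).mul (hd hβ)).neg.deriv.trans ?_
    simp
  rw [← d2, ← d3, form_eq_add]
  refine (DForm.d_add (s1.add s2) s3 m).trans ?_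
  exact congrArg₂ (· + ·) ((DForm.d_add s1 s2 m).trans (congrArg₂ (· + ·) e1 e2)) e3

theorem d_dualForm (hf : ContDiffOn ℝ (⊤ : ℕ∞) f U) (hα : ContDiffOn ℝ (⊤ : ℕ∞) α U)
    (hβ : ContDiffOn ℝ (⊤ : ℕ∞) β U) (m : U × L) :
    (dualForm S f α β : DForm model (U × L) 4).d m =
    ((2 * f m.1 ^ 3 * deriv f m.1) • (dt m ⋏[5] pull m (S.ωsq m.2))
        + (1 / 2 * f m.1 ^ 4) • pull m ((2 : ℝ) • (S.ω.d m.2 ⋏[5] S.ω m.2)))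
      + (f m.1 ^ 3 * α m.1) • (pull m (S.ψm.d m.2) ⋏[5] dt m)
      + (f m.1 ^ 3 * β m.1) • (pull m (S.ψp.d m.2) ⋏[5] dt m) := by
  have hd : HasDerivAt f (deriv f m.1) m.1 :=
    ((hf.contDiffAt (U.isOpen.mem_nhds m.1.2)).differentiableAt (by simp)).hasDerivAt
  have hω : S.ωsq.IsSmooth := S.ω_smooth.wedge S.ω_smooth (by norm_num)
  have hc : ContDiffOn ℝ (⊤ : ℕ∞) (fun t => 1 / 2 * f t ^ 4) U := contDiffOn_const.mul (hf.pow 4)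
  have s1 := isSmooth_smul_pull hc hω
  have s2 := isSmooth_smul_pull_wedge_dt (by norm_num : 3 + 1 = 4) ((hf.pow 3).mul hα) S.ψm_smooth
  have s3 := isSmooth_smul_pull_wedge_dt (by norm_num : 3 + 1 = 4) ((hf.pow 3).mul hβ) S.ψp_smooth
  have e1 := d_smul_pull_four hc hω m
  have e2 := d_smul_pull_wedge_dt_three ((hf.pow 3).mul hα) S.ψm_smooth m
  have e3 := d_smul_pull_wedge_dt_three ((hf.pow 3).mul hβ) S.ψp_smooth m
  have d1 : deriv (fun t => 1 / 2 * f t ^ 4) m.1 = 2 * f m.1 ^ 3 * deriv f m.1 := by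
    refine ((hd.pow 4).const_mul (1 / 2)).deriv.trans ?_
    push_cast
    ring
  have d2 : S.ωsq.d m.2 = (2 : ℝ) • (S.ω.d m.2 ⋏[5] S.ω m.2) := DForm.d_wedge_self S.ω_smooth m.2
  rw [← d1, ← d2]
  refine (DForm.d_add (s1.add s2) s3 m).trans ?_
  exact congrArg₂ (· + ·) ((DForm.d_add s1 s2 m).trans (congrArg₂ (· + ·) e1 e2)) e3

end Warped

/-! ### Smoothness of the torsion forms -/

namespace Warped

open ExtAlg

variable {L : Type*} [TopologicalSpace L] [ChartedSpace (EuclideanSpace ℝ (Fin 6)) L]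
  {U : TopologicalSpace.Opens ℝ}

variable [IsManifold (𝓡 6) (⊤ : ℕ∞) L]

variable {S : SU3Structure L} {π₀ σ₀ : L → ℝ} {π₁ ν₁ : DForm (𝓡 6) L 1} {π₂ σ₂ : DForm (𝓡 6) L 2}
  {ν₃ : DForm (𝓡 6) L 3} {f α β : ℝ → ℝ}

theorem contDiffOn_deriv {h : ℝ → ℝ} (hh : ContDiffOn ℝ (⊤ : ℕ∞) h U) :
    ContDiffOn ℝ (⊤ : ℕ∞) (deriv h) U :=
  hh.deriv_of_isOpen U.isOpen (by simp)

theorem contMDiff_torsionZero (hS : S.IsTorsion π₀ σ₀ π₁ ν₁ π₂ σ₂ ν₃)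
    (hf : ContDiffOn ℝ (⊤ : ℕ∞) f U) (hα : ContDiffOn ℝ (⊤ : ℕ∞) α U)
    (hβ : ContDiffOn ℝ (⊤ : ℕ∞) β U) (hf0 : ∀ t ∈ U, f t ≠ 0) :
    ContMDiff model 𝓘(ℝ, ℝ) (⊤ : ℕ∞) (fun m : U × L =>
      4 / (7 * f m.1) * (3 * π₀ m.2 * α m.1 - 3 * σ₀ m.2 * β m.1
        + f m.1 * α m.1 * deriv β m.1 - f m.1 * β m.1 * deriv α m.1)) := by
  have f0 := contMDiff_fst_comp (L := L) hf
  have a0 := contMDiff_fst_comp (L := L) hα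
  have b0 := contMDiff_fst_comp (L := L) hβ
  have a1 := contMDiff_fst_comp (L := L) (contDiffOn_deriv hα)
  have b1 := contMDiff_fst_comp (L := L) (contDiffOn_deriv hβ)
  have fi := contMDiff_fst_comp (L := L) (U := U) (h := fun t => 4 / (7 * f t))
    (contDiffOn_const.div (contDiffOn_const.mul hf) fun t ht =>
      mul_ne_zero (by norm_num) (hf0 t ht))
  have p0 : ContMDiff model 𝓘(ℝ, ℝ) (⊤ : ℕ∞) (fun m : U × L => π₀ m.2) :=
    hS.smooth_π₀.comp contMDiff_snd
  have s0 : ContMDiff model 𝓘(ℝ, ℝ) (⊤ : ℕ∞) (fun m : U × L => σ₀ m.2) :=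
    hS.smooth_σ₀.comp contMDiff_snd
  exact fi.mul (((((contMDiff_const.mul p0).mul a0).sub ((contMDiff_const.mul s0).mul b0)).add
    ((f0.mul a0).mul b1)).sub ((f0.mul b0).mul a1))

theorem isSmooth_torsionOne (hS : S.IsTorsion π₀ σ₀ π₁ ν₁ π₂ σ₂ ν₃)
    (hf : ContDiffOn ℝ (⊤ : ℕ∞) f U) (hα : ContDiffOn ℝ (⊤ : ℕ∞) α U)
    (hβ : ContDiffOn ℝ (⊤ : ℕ∞) β U) (hf0 : ∀ t ∈ U, f t ≠ 0) :
    DForm.IsSmooth (fun m : U × L =>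
      (1 / (2 * f m.1) * (π₀ m.2 * β m.1 + σ₀ m.2 * α m.1 + 2 * deriv f m.1)) • dt m
        + (1 / 6 : ℝ) • pull m (ν₁ m.2) + (1 / 6 : ℝ) • pull m (π₁ m.2)) := by
  have a0 := contMDiff_fst_comp (L := L) hα
  have b0 := contMDiff_fst_comp (L := L) hβ
  have f1 := contMDiff_fst_comp (L := L) (contDiffOn_deriv hf)
  have fi := contMDiff_fst_comp (L := L) (U := U) (h := fun t => 1 / (2 * f t))
    (contDiffOn_const.div (contDiffOn_const.mul hf) fun t ht =>
      mul_ne_zero (by norm_num) (hf0 t ht))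
  have p0 : ContMDiff model 𝓘(ℝ, ℝ) (⊤ : ℕ∞) (fun m : U × L => π₀ m.2) :=
    hS.smooth_π₀.comp contMDiff_snd
  have s0 : ContMDiff model 𝓘(ℝ, ℝ) (⊤ : ℕ∞) (fun m : U × L => σ₀ m.2) :=
    hS.smooth_σ₀.comp contMDiff_snd
  exact ((isSmooth_dt.smul (fi.mul (((p0.mul b0).add (s0.mul a0)).add (contMDiff_const.mul
    f1)))).add
    (isSmooth_smul_pull contDiffOn_const hS.smooth_ν₁)).add
    (isSmooth_smul_pull contDiffOn_const hS.smooth_π₁)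

theorem isSmooth_torsionTwo (hS : S.IsTorsion π₀ σ₀ π₁ ν₁ π₂ σ₂ ν₃)
    (hf : ContDiffOn ℝ (⊤ : ℕ∞) f U) (hα : ContDiffOn ℝ (⊤ : ℕ∞) α U)
    (hβ : ContDiffOn ℝ (⊤ : ℕ∞) β U) :
    DForm.IsSmooth (fun m : U × L =>
      (-(2 / 3) : ℝ) •
          (pull m (S.star 1 (ν₁ m.2 ⋏[5] S.ωsq m.2)) ⋏[2] dt m)
        + (1 / 3 : ℝ) •
          (pull m (S.star 1 (π₁ m.2 ⋏[5] S.ωsq m.2)) ⋏[2] dt m)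
        - (1 / 3 * f m.1 * β m.1) • pull m (S.star 2 (π₁ m.2 ⋏[4] S.ψp m.2))
        - (1 / 3 * f m.1 * α m.1) • pull m (S.star 2 (π₁ m.2 ⋏[4] S.ψm m.2))
        + (2 / 3 * f m.1 * β m.1) • pull m (S.star 2 (ν₁ m.2 ⋏[4] S.ψp m.2))
        + (2 / 3 * f m.1 * α m.1) • pull m (S.star 2 (ν₁ m.2 ⋏[4] S.ψm m.2))
        - (f m.1 * β m.1) • pull m (π₂ m.2)
        - (f m.1 * α m.1) • pull m (σ₂ m.2)) := by
  have hω : S.ωsq.IsSmooth := S.ω_smooth.wedge S.ω_smooth (by norm_num)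
  have w1 {κ : DForm (𝓡 6) L 1} (hκ : κ.IsSmooth) :
      DForm.IsSmooth (fun x => S.star 1 (κ x ⋏[5] S.ωsq x)) :=
    S.isSmooth_star (by norm_num) (hκ.wedge hω (by norm_num))
  have w2 {κ : DForm (𝓡 6) L 1} (hκ : κ.IsSmooth) {ψ : DForm (𝓡 6) L 3} (hψ : ψ.IsSmooth) :
      DForm.IsSmooth (fun x => S.star 2 (κ x ⋏[4] ψ x)) :=
    S.isSmooth_star _ (hκ.wedge hψ _)
  have c1 := (contDiffOn_const (c := (1 / 3 : ℝ)).mul hf).mul hβ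
  have c2 := (contDiffOn_const (c := (1 / 3 : ℝ)).mul hf).mul hα
  have c3 := (contDiffOn_const (c := (2 / 3 : ℝ)).mul hf).mul hβ
  have c4 := (contDiffOn_const (c := (2 / 3 : ℝ)).mul hf).mul hα
  have e : 1 + 1 = 2 := by norm_num
  have t1 := isSmooth_smul_pull_wedge_dt (U := U) e (contDiffOn_const (c := (-(2 / 3) : ℝ)))
    (w1 hS.smooth_ν₁)
  have t2 := isSmooth_smul_pull_wedge_dt (U := U) e (contDiffOn_const (c := (1 / 3 : ℝ)))
    (w1 hS.smooth_π₁)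
  have t3 := isSmooth_smul_pull c1 (w2 hS.smooth_π₁ S.ψp_smooth)
  have t4 := isSmooth_smul_pull c2 (w2 hS.smooth_π₁ S.ψm_smooth)
  have t5 := isSmooth_smul_pull c3 (w2 hS.smooth_ν₁ S.ψp_smooth)
  have t6 := isSmooth_smul_pull c4 (w2 hS.smooth_ν₁ S.ψm_smooth)
  have t7 := isSmooth_smul_pull (hf.mul hβ) hS.smooth_π₂
  have t8 := isSmooth_smul_pull (hf.mul hα) hS.smooth_σ₂
  have hs := ((((((t1.add t2).sub t3).sub t4).add t5).add t6).sub t7).sub t8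
  exact hs

theorem isSmooth_torsionThree (hS : S.IsTorsion π₀ σ₀ π₁ ν₁ π₂ σ₂ ν₃)
    (hf : ContDiffOn ℝ (⊤ : ℕ∞) f U) (hα : ContDiffOn ℝ (⊤ : ℕ∞) α U)
    (hβ : ContDiffOn ℝ (⊤ : ℕ∞) β U) :
    DForm.IsSmooth (fun m : U × L =>
      (-(3 / 14) * f m.1 ^ 2 * (π₀ m.2 * α m.1 ^ 2 - σ₀ m.2 * α m.1 * β m.1 - 2 * f m.1 * deriv β
        m.1)) •
          pull m (S.ψp m.2)
        + (3 / 14 * f m.1 ^ 2 * (π₀ m.2 * α m.1 * β m.1 - σ₀ m.2 * β m.1 ^ 2 + 2 * f m.1 * deriv α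
          m.1)) •
          pull m (S.ψm m.2)
        + (2 / 7 * f m.1 * (π₀ m.2 * α m.1 - σ₀ m.2 * β m.1
            - 2 * f m.1 * α m.1 * deriv β m.1 + 2 * f m.1 * β m.1 * deriv α m.1)) •
          (pull m (S.ω m.2) ⋏[3] dt m)
        - (1 / 2 * f m.1 ^ 2) • pull m (S.star 3 (ν₁ m.2 ⋏[3] S.ω m.2))
        + (1 / 2 * f m.1 ^ 2) • pull m (S.star 3 (π₁ m.2 ⋏[3] S.ω m.2))
        + (1 / 2 * f m.1 * α m.1) •
          (pull m (S.star 2 (π₁ m.2 ⋏[4] S.ψp m.2)) ⋏[3] dt m)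
        - (1 / 2 * f m.1 * β m.1) •
          (pull m (S.star 2 (π₁ m.2 ⋏[4] S.ψm m.2)) ⋏[3] dt m)
        - (1 / 2 * f m.1 * α m.1) •
          (pull m (S.star 2 (ν₁ m.2 ⋏[4] S.ψp m.2)) ⋏[3] dt m)
        + (1 / 2 * f m.1 * β m.1) •
          (pull m (S.star 2 (ν₁ m.2 ⋏[4] S.ψm m.2)) ⋏[3] dt m)
        + f m.1 • (pull m (α m.1 • π₂ m.2 - β m.1 • σ₂ m.2) ⋏[3] dt m)
        - f m.1 ^ 2 • pull m (S.star 3 (ν₃ m.2))) := by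
  have f0 := contMDiff_fst_comp (L := L) hf
  have a0 := contMDiff_fst_comp (L := L) hα
  have b0 := contMDiff_fst_comp (L := L) hβ
  have a1 := contMDiff_fst_comp (L := L) (contDiffOn_deriv hα)
  have b1 := contMDiff_fst_comp (L := L) (contDiffOn_deriv hβ)
  have p0 : ContMDiff model 𝓘(ℝ, ℝ) (⊤ : ℕ∞) (fun m : U × L => π₀ m.2) :=
    hS.smooth_π₀.comp contMDiff_snd
  have s0 : ContMDiff model 𝓘(ℝ, ℝ) (⊤ : ℕ∞) (fun m : U × L => σ₀ m.2) :=
    hS.smooth_σ₀.comp contMDiff_snd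
  have w2 {κ : DForm (𝓡 6) L 1} (hκ : κ.IsSmooth) {ψ : DForm (𝓡 6) L 3} (hψ : ψ.IsSmooth) :
      DForm.IsSmooth (fun x => S.star 2 (κ x ⋏[4] ψ x)) :=
    S.isSmooth_star _ (hκ.wedge hψ _)
  have w3 {κ : DForm (𝓡 6) L 1} (hκ : κ.IsSmooth) :
      DForm.IsSmooth (fun x => S.star 3 (κ x ⋏[3] S.ω x)) :=
    S.isSmooth_star _ (hκ.wedge S.ω_smooth _)
  have c0 := contDiffOn_const (c := (1 / 2 : ℝ)).mul (hf.pow 2)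
  have c1 := (contDiffOn_const (c := (1 / 2 : ℝ)).mul hf).mul hα
  have c2 := (contDiffOn_const (c := (1 / 2 : ℝ)).mul hf).mul hβ
  have k1 : ContMDiff model 𝓘(ℝ, ℝ) (⊤ : ℕ∞) (fun m : U × L => -(3 / 14) * f m.1 ^ 2 *
      (π₀ m.2 * α m.1 ^ 2 - σ₀ m.2 * α m.1 * β m.1 - 2 * f m.1 * deriv β m.1)) :=
    (contMDiff_const.mul (f0.pow 2)).mul
    (((p0.mul (a0.pow 2)).sub ((s0.mul a0).mul b0)).sub ((contMDiff_const.mul f0).mul b1))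
  have k2 : ContMDiff model 𝓘(ℝ, ℝ) (⊤ : ℕ∞) (fun m : U × L => 3 / 14 * f m.1 ^ 2 *
      (π₀ m.2 * α m.1 * β m.1 - σ₀ m.2 * β m.1 ^ 2 + 2 * f m.1 * deriv α m.1)) :=
    (contMDiff_const.mul (f0.pow 2)).mul
    ((((p0.mul a0).mul b0).sub (s0.mul (b0.pow 2))).add ((contMDiff_const.mul f0).mul a1))
  have k3 : ContMDiff model 𝓘(ℝ, ℝ) (⊤ : ℕ∞) (fun m : U × L => 2 / 7 * f m.1 *
      (π₀ m.2 * α m.1 - σ₀ m.2 * β m.1 - 2 * f m.1 * α m.1 * deriv β m.1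
        + 2 * f m.1 * β m.1 * deriv α m.1)) :=
    (contMDiff_const.mul f0).mul ((((p0.mul a0).sub (s0.mul b0)).sub
    (((contMDiff_const.mul f0).mul a0).mul b1)).add (((contMDiff_const.mul f0).mul b0).mul a1))
  have hP := isSmooth_pull (U := U) S.ψp_smooth
  have hQ := isSmooth_pull (U := U) S.ψm_smooth
  have hω := (isSmooth_pull (U := U) S.ω_smooth).wedge isSmooth_dt (by norm_num : 2 + 1 = 3)
  have hab : DForm.IsSmooth (fun m : U × L =>
      pull m (α m.1 • π₂ m.2 - β m.1 • σ₂ m.2)) :=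
    (isSmooth_smul_pull hα hS.smooth_π₂).sub (isSmooth_smul_pull hβ hS.smooth_σ₂)
  have e : 2 + 1 = 3 := by norm_num
  have t1 := hP.smul k1
  have t2 := hQ.smul k2
  have t3 := hω.smul k3
  have t4 := isSmooth_smul_pull c0 (w3 hS.smooth_ν₁)
  have t5 := isSmooth_smul_pull c0 (w3 hS.smooth_π₁)
  have t6 := isSmooth_smul_pull_wedge_dt e c1 (w2 hS.smooth_π₁ S.ψp_smooth)
  have t7 := isSmooth_smul_pull_wedge_dt e c2 (w2 hS.smooth_π₁ S.ψm_smooth)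
  have t8 := isSmooth_smul_pull_wedge_dt e c1 (w2 hS.smooth_ν₁ S.ψp_smooth)
  have t9 := isSmooth_smul_pull_wedge_dt e c2 (w2 hS.smooth_ν₁ S.ψm_smooth)
  have t10 := (hab.wedge isSmooth_dt e).smul f0
  have t11 := isSmooth_smul_pull (hf.pow 2)
    (S.isSmooth_star (by norm_num : 3 + 3 = 6) hS.smooth_ν₃)
  have hs := (((((((((t1.add t2).add t3).sub t4).add t5).add t6).sub t7).sub t8).add t9).add
    t10).sub
    t11
  exact hs

end Warped

/-! ### Structure equations of the warped product -/

namespace ExtAlg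

variable {W : Type*} [AddCommGroup W] [Module ℝ W] [TopologicalSpace W] {c : Fin 6 → W}

theorem IsPrimitiveTwo.smul_add_smul {β γ : W [⋀^Fin 2]→L[ℝ] ℝ} (hβ : IsPrimitiveTwo β c)
    (hγ : IsPrimitiveTwo γ c) (r s : ℝ) : IsPrimitiveTwo (r • β + s • γ) c := by
  constructor <;> simp only [ContinuousAlternatingMap.add_apply,
    ContinuousAlternatingMap.smul_apply, hβ.c13, hβ.c12, hβ.c15, hβ.c14, hβ.c35, hβ.c34, hβ.c45,
    hγ.c13, hγ.c12, hγ.c15, hγ.c14, hγ.c35, hγ.c34, hγ.c45, smul_eq_mul] <;> ring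

theorem IsPrimitiveThree.smul {γ : W [⋀^Fin 3]→L[ℝ] ℝ} (h : IsPrimitiveThree γ c) (r : ℝ) :
    IsPrimitiveThree (r • γ) c := by
  constructor <;> simp only [ContinuousAlternatingMap.smul_apply, h.c045, h.c145, h.c245, h.c345,
    h.c234, h.c235, h.c135, h.c024, smul_eq_mul] <;> ring

end ExtAlg

namespace Warped

open ExtAlg

variable {L : Type*} [TopologicalSpace L] [ChartedSpace (EuclideanSpace ℝ (Fin 6)) L]
  [IsManifold (𝓡 6) (⊤ : ℕ∞) L] {U : TopologicalSpace.Opens ℝ}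
  {S : SU3Structure L} {π₀ σ₀ : L → ℝ} {π₁ ν₁ : DForm (𝓡 6) L 1} {π₂ σ₂ : DForm (𝓡 6) L 2}
  {ν₃ : DForm (𝓡 6) L 3} {f α β : ℝ → ℝ}

/-- A curve in the unit circle is orthogonal to its derivative. -/
theorem mul_deriv_add_mul_deriv (hα : ContDiffOn ℝ (⊤ : ℕ∞) α U) (hβ : ContDiffOn ℝ (⊤ : ℕ∞) β U)
    (hαβ : ∀ t ∈ U, α t ^ 2 + β t ^ 2 = 1) {t : ℝ} (ht : t ∈ U) :
    α t * deriv α t + β t * deriv β t = 0 := by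
  have hd : ∀ {h : ℝ → ℝ}, ContDiffOn ℝ (⊤ : ℕ∞) h U → HasDerivAt h (deriv h t) t :=
    fun hh => ((hh.contDiffAt (U.isOpen.mem_nhds ht)).differentiableAt (by simp)).hasDerivAt
  have h1 := ((hd hα).pow 2).add ((hd hβ).pow 2)
  have h2 : (fun _ => (1 : ℝ)) =ᶠ[nhds t] fun s => α s ^ 2 + β s ^ 2 :=
    Filter.eventually_of_mem (U.isOpen.mem_nhds ht) fun s hs => (hαβ s hs).symm
  have h3 := (h1.congr_of_eventuallyEq h2).unique (hasDerivAt_const t (1 : ℝ))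
  push_cast at h3
  linarith

set_option maxRecDepth 10000 in
/-- The structure equations of the warped product at a point. -/
theorem structure_equations (hS : S.IsTorsion π₀ σ₀ π₁ ν₁ π₂ σ₂ ν₃)
    (hf : ContDiffOn ℝ (⊤ : ℕ∞) f U) (hα : ContDiffOn ℝ (⊤ : ℕ∞) α U)
    (hβ : ContDiffOn ℝ (⊤ : ℕ∞) β U) (hf0 : ∀ t ∈ U, f t ≠ 0)
    (hαβ : ∀ t ∈ U, α t ^ 2 + β t ^ 2 = 1) (m : U × L) {τ₀ : ℝ}
    {τ₁ : (TangentSpace model m) [⋀^Fin 1]→L[ℝ] ℝ} {τ₂ : (TangentSpace model m) [⋀^Fin 2]→L[ℝ] ℝ}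
    {τ₃ : (TangentSpace model m) [⋀^Fin 3]→L[ℝ] ℝ}
    (h0 : τ₀ =
      4 / (7 * f m.1) * (3 * π₀ m.2 * α m.1 - 3 * σ₀ m.2 * β m.1
        + f m.1 * α m.1 * deriv β m.1 - f m.1 * β m.1 * deriv α m.1))
    (h1 : τ₁ =
      (1 / (2 * f m.1) * (π₀ m.2 * β m.1 + σ₀ m.2 * α m.1 + 2 * deriv f m.1)) • dt m
        + (1 / 6 : ℝ) • pull m (ν₁ m.2) + (1 / 6 : ℝ) • pull m (π₁ m.2))
    (h2 : τ₂ =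
      (-(2 / 3) : ℝ) •
          (pull m (S.star 1 (ν₁ m.2 ⋏[5] S.ωsq m.2)) ⋏[2] dt m)
        + (1 / 3 : ℝ) •
          (pull m (S.star 1 (π₁ m.2 ⋏[5] S.ωsq m.2)) ⋏[2] dt m)
        - (1 / 3 * f m.1 * β m.1) • pull m (S.star 2 (π₁ m.2 ⋏[4] S.ψp m.2))
        - (1 / 3 * f m.1 * α m.1) • pull m (S.star 2 (π₁ m.2 ⋏[4] S.ψm m.2))
        + (2 / 3 * f m.1 * β m.1) • pull m (S.star 2 (ν₁ m.2 ⋏[4] S.ψp m.2))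
        + (2 / 3 * f m.1 * α m.1) • pull m (S.star 2 (ν₁ m.2 ⋏[4] S.ψm m.2))
        - (f m.1 * β m.1) • pull m (π₂ m.2)
        - (f m.1 * α m.1) • pull m (σ₂ m.2))
    (h3 : τ₃ =
      (-(3 / 14) * f m.1 ^ 2 * (π₀ m.2 * α m.1 ^ 2 - σ₀ m.2 * α m.1 * β m.1 - 2 * f m.1 * deriv β
        m.1)) •
          pull m (S.ψp m.2)
        + (3 / 14 * f m.1 ^ 2 * (π₀ m.2 * α m.1 * β m.1 - σ₀ m.2 * β m.1 ^ 2 + 2 * f m.1 * deriv α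
          m.1)) •
          pull m (S.ψm m.2)
        + (2 / 7 * f m.1 * (π₀ m.2 * α m.1 - σ₀ m.2 * β m.1
            - 2 * f m.1 * α m.1 * deriv β m.1 + 2 * f m.1 * β m.1 * deriv α m.1)) •
          (pull m (S.ω m.2) ⋏[3] dt m)
        - (1 / 2 * f m.1 ^ 2) • pull m (S.star 3 (ν₁ m.2 ⋏[3] S.ω m.2))
        + (1 / 2 * f m.1 ^ 2) • pull m (S.star 3 (π₁ m.2 ⋏[3] S.ω m.2))
        + (1 / 2 * f m.1 * α m.1) •
          (pull m (S.star 2 (π₁ m.2 ⋏[4] S.ψp m.2)) ⋏[3] dt m)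
        - (1 / 2 * f m.1 * β m.1) •
          (pull m (S.star 2 (π₁ m.2 ⋏[4] S.ψm m.2)) ⋏[3] dt m)
        - (1 / 2 * f m.1 * α m.1) •
          (pull m (S.star 2 (ν₁ m.2 ⋏[4] S.ψp m.2)) ⋏[3] dt m)
        + (1 / 2 * f m.1 * β m.1) •
          (pull m (S.star 2 (ν₁ m.2 ⋏[4] S.ψm m.2)) ⋏[3] dt m)
        + f m.1 • (pull m (α m.1 • π₂ m.2 - β m.1 • σ₂ m.2) ⋏[3] dt m)
        - f m.1 ^ 2 • pull m (S.star 3 (ν₃ m.2))) :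
    τ₂ ⋏[6] dualForm S f α β m = 0 ∧ τ₃ ⋏[6] form S f α β m = 0 ∧
      τ₃ ⋏[7] dualForm S f α β m = 0 ∧
      (form S f α β : DForm model (U × L) 3).d m = τ₀ • dualForm S f α β m
        + (3 : ℝ) • (τ₁ ⋏[4] form S f α β m) + G2.star (form S f α β m) 4 τ₃ ∧
      (dualForm S f α β : DForm model (U × L) 4).d m =
        (4 : ℝ) • (τ₁ ⋏[5] dualForm S f α β m) + τ₂ ⋏[5] form S f α β m := by
  have hfm := hf0 m.1 m.1.2
  have hm := hαβ m.1 m.1.2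
  obtain ⟨c, b, hF, hb, hG, ho, p2, p3⟩ := exists_frames (S := S) hfm hm
  have hod := mul_deriv_add_mul_deriv hα hβ hαβ m.1.2
  -- With α + iβ = e^{iϑ} this is ϑ'. The velocity (α', β') is orthogonal to (α, β), hence equal to
  -- k(−β, α).
  obtain ⟨k, hk⟩ : ∃ k, k = α m.1 * deriv β m.1 - β m.1 * deriv α m.1 := ⟨_, rfl⟩
  have hα' : deriv α m.1 = -β m.1 * k := by
    rw [hk]
    linear_combination (-deriv α m.1) * hm + α m.1 * hod
  have hβ' : deriv β m.1 = α m.1 * k := by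
    rw [hk]
    linear_combination (-deriv β m.1) * hm + β m.1 * hod
  have q2 := p2 _ (hS.mem_π₂ m.2).1 (hS.mem_π₂ m.2).2
  have r2 := p2 _ (hS.mem_σ₂ m.2).1 (hS.mem_σ₂ m.2).2
  have hπ : IsPrimitiveTwo (f m.1 • (α m.1 • π₂ m.2 - β m.1 • σ₂ m.2)) c := by
    have := q2.smul_add_smul r2 (f m.1 * α m.1) (-(f m.1 * β m.1))
    convert this using 1
    module
  have hσ : IsPrimitiveTwo (f m.1 • (β m.1 • π₂ m.2 + α m.1 • σ₂ m.2)) c := by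
    have := q2.smul_add_smul r2 (f m.1 * β m.1) (f m.1 * α m.1)
    convert this using 1
    module
  have hν := (p3 _ (hS.mem_ν₃ m.2).1 (hS.mem_ν₃ m.2).2.1 (hS.mem_ν₃ m.2).2.2).smul (f m.1 ^ 2)
  have e0 : τ₀ = 4 / 7 * (3 * ((α m.1 * π₀ m.2 - β m.1 * σ₀ m.2) / f m.1) + k) := by
    rw [h0, hk]
    field_simp
    ring
  have e1 := h1.trans (torsionOne_warped hfm (deriv f m.1) (π₀ m.2) (σ₀ m.2) (ν₁ m.2) (π₁ m.2)).symm
  have e2 := h2.trans (torsionTwo_warped hfm ho (S.ω m.2) (S.ψp m.2) (S.ψm m.2) (ν₁ m.2) (π₁ m.2)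
    (π₂ m.2) (σ₂ m.2)).symm
  have e3 := h3.trans (torsionThree_warped hfm ho hα' hβ' hm (π₀ m.2) (σ₀ m.2) (S.ω m.2) (S.ψp m.2)
    (S.ψm m.2) (ν₁ m.2) (π₁ m.2) (π₂ m.2) (σ₂ m.2) (ν₃ m.2)).symm
  -- Everything is now expressed through the rescaled SU(3)-structure on one tangent space, so the
  -- five claims become the pointwise lemmas on the cylinder.
  rw [G2.star_eq_hodge hG.isAdapted, d_form hf hα hβ, d_dualForm hf hα hβ, hS.d_ω, hS.d_ψp,
    hS.d_ψm, form_eq_cylinderForm, dualForm_eq_cylinderDual, e0, e1, e2, e3]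
  refine ⟨torsionTwo_wedge_cylinderDual hF hb _ hσ, torsionThree_wedge_cylinderForm hF hb _ _ hπ hν,
    torsionThree_wedge_cylinderDual hF hb _ _ hπ hν, ?_, ?_⟩
  · exact (d_form_warped hfm hα' hβ' hm _ _ _ _ _ _ _ _ _ _ _).trans
      (d_cylinderForm_eq hF hb _ _ _ _ rfl hπ _)
  · exact (d_dual_warped hfm hm _ _ _ _ _ _ _ _ _ _ _).trans
      (d_cylinderDual_eq hF hb _ _ _ rfl hσ hν)

end Warped

theorem G2.IsTorsion.congr {E : Type*} [NormedAddCommGroup E] [NormedSpace ℝ E] {H : Type*}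
    [TopologicalSpace H] {I : ModelWithCorners ℝ E H} {M : Type*} [TopologicalSpace M]
    [ChartedSpace H M] {φ : DForm I M 3} {τ₀ τ₀' : M → ℝ} {τ₁ τ₁' : DForm I M 1}
    {τ₂ τ₂' : DForm I M 2} {τ₃ τ₃' : DForm I M 3} (h : IsTorsion φ τ₀ τ₁ τ₂ τ₃)
    (h0 : ∀ x, τ₀' x = τ₀ x) (h1 : ∀ x, τ₁' x = τ₁ x) (h2 : ∀ x, τ₂' x = τ₂ x)
    (h3 : ∀ x, τ₃' x = τ₃ x) : IsTorsion φ τ₀' τ₁' τ₂' τ₃' := by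
  rwa [funext h0, funext h1, funext h2, funext h3]

/-! ### The torsion forms and the final equivalence -/

namespace Warped

variable {L : Type*} [TopologicalSpace L] [ChartedSpace (EuclideanSpace ℝ (Fin 6)) L]
  [IsManifold (𝓡 6) (⊤ : ℕ∞) L] {U : TopologicalSpace.Opens ℝ}
  {S : SU3Structure L} {π₀ σ₀ : L → ℝ} {π₁ ν₁ : DForm (𝓡 6) L 1} {π₂ σ₂ : DForm (𝓡 6) L 2}
  {ν₃ : DForm (𝓡 6) L 3} {f α β : ℝ → ℝ}

/-- The torsion forms of the warped product. -/
theorem isTorsion_form (hS : S.IsTorsion π₀ σ₀ π₁ ν₁ π₂ σ₂ ν₃)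
    (hf : ContDiffOn ℝ (⊤ : ℕ∞) f U) (hα : ContDiffOn ℝ (⊤ : ℕ∞) α U)
    (hβ : ContDiffOn ℝ (⊤ : ℕ∞) β U) (hf0 : ∀ t ∈ U, f t ≠ 0)
    (hαβ : ∀ t ∈ U, α t ^ 2 + β t ^ 2 = 1) :
    G2.IsTorsion (form S f α β : DForm model (U × L) 3)
      (fun m =>
      4 / (7 * f m.1) * (3 * π₀ m.2 * α m.1 - 3 * σ₀ m.2 * β m.1
        + f m.1 * α m.1 * deriv β m.1 - f m.1 * β m.1 * deriv α m.1))
      (fun m =>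
      (1 / (2 * f m.1) * (π₀ m.2 * β m.1 + σ₀ m.2 * α m.1 + 2 * deriv f m.1)) • dt m
        + (1 / 6 : ℝ) • pull m (ν₁ m.2) + (1 / 6 : ℝ) • pull m (π₁ m.2))
      (fun m =>
      (-(2 / 3) : ℝ) •
          (pull m (S.star 1 (ν₁ m.2 ⋏[5] S.ωsq m.2)) ⋏[2] dt m)
        + (1 / 3 : ℝ) •
          (pull m (S.star 1 (π₁ m.2 ⋏[5] S.ωsq m.2)) ⋏[2] dt m)
        - (1 / 3 * f m.1 * β m.1) • pull m (S.star 2 (π₁ m.2 ⋏[4] S.ψp m.2))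
        - (1 / 3 * f m.1 * α m.1) • pull m (S.star 2 (π₁ m.2 ⋏[4] S.ψm m.2))
        + (2 / 3 * f m.1 * β m.1) • pull m (S.star 2 (ν₁ m.2 ⋏[4] S.ψp m.2))
        + (2 / 3 * f m.1 * α m.1) • pull m (S.star 2 (ν₁ m.2 ⋏[4] S.ψm m.2))
        - (f m.1 * β m.1) • pull m (π₂ m.2)
        - (f m.1 * α m.1) • pull m (σ₂ m.2))
      (fun m =>
      (-(3 / 14) * f m.1 ^ 2 * (π₀ m.2 * α m.1 ^ 2 - σ₀ m.2 * α m.1 * β m.1 - 2 * f m.1 * deriv β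
        m.1)) •
          pull m (S.ψp m.2)
        + (3 / 14 * f m.1 ^ 2 * (π₀ m.2 * α m.1 * β m.1 - σ₀ m.2 * β m.1 ^ 2 + 2 * f m.1 * deriv α
          m.1)) •
          pull m (S.ψm m.2)
        + (2 / 7 * f m.1 * (π₀ m.2 * α m.1 - σ₀ m.2 * β m.1
            - 2 * f m.1 * α m.1 * deriv β m.1 + 2 * f m.1 * β m.1 * deriv α m.1)) •
          (pull m (S.ω m.2) ⋏[3] dt m)
        - (1 / 2 * f m.1 ^ 2) • pull m (S.star 3 (ν₁ m.2 ⋏[3] S.ω m.2))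
        + (1 / 2 * f m.1 ^ 2) • pull m (S.star 3 (π₁ m.2 ⋏[3] S.ω m.2))
        + (1 / 2 * f m.1 * α m.1) •
          (pull m (S.star 2 (π₁ m.2 ⋏[4] S.ψp m.2)) ⋏[3] dt m)
        - (1 / 2 * f m.1 * β m.1) •
          (pull m (S.star 2 (π₁ m.2 ⋏[4] S.ψm m.2)) ⋏[3] dt m)
        - (1 / 2 * f m.1 * α m.1) •
          (pull m (S.star 2 (ν₁ m.2 ⋏[4] S.ψp m.2)) ⋏[3] dt m)
        + (1 / 2 * f m.1 * β m.1) •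
          (pull m (S.star 2 (ν₁ m.2 ⋏[4] S.ψm m.2)) ⋏[3] dt m)
        + f m.1 • (pull m (α m.1 • π₂ m.2 - β m.1 • σ₂ m.2) ⋏[3] dt m)
        - f m.1 ^ 2 • pull m (S.star 3 (ν₃ m.2))) := by
  have key := fun m : U × L => structure_equations hS hf hα hβ hf0 hαβ m rfl rfl rfl rfl
  refine ⟨contMDiff_torsionZero hS hf hα hβ hf0, isSmooth_torsionOne hS hf hα hβ hf0,
    isSmooth_torsionTwo hS hf hα hβ, isSmooth_torsionThree hS hf hα hβ, ?_, ?_, ?_, ?_⟩ <;>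
    rw [starForm_form hf0 hαβ]
  exacts [fun m => (key m).1, fun m => ⟨(key m).2.1, (key m).2.2.1⟩, fun m => (key m).2.2.2.1,
    fun m => (key m).2.2.2.2]

end Warped

end

theorem theorem3p4 {L : Type*} [TopologicalSpace L] [ChartedSpace (EuclideanSpace ℝ (Fin 6)) L]
    [IsManifold (𝓡 6) (⊤ : ℕ∞) L] (S : SU3Structure L)
    (π₀ σ₀ : L → ℝ) (π₁ ν₁ : DForm (𝓡 6) L 1) (π₂ σ₂ : DForm (𝓡 6) L 2) (ν₃ : DForm (𝓡 6) L 3)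
    (hS : S.IsTorsion π₀ σ₀ π₁ ν₁ π₂ σ₂ ν₃)
    (U : TopologicalSpace.Opens ℝ) (f α β : ℝ → ℝ)
    (hf : ContDiffOn ℝ (⊤ : ℕ∞) f U) (hα : ContDiffOn ℝ (⊤ : ℕ∞) α U)
    (hβ : ContDiffOn ℝ (⊤ : ℕ∞) β U)
    (hf0 : ∀ t ∈ U, f t ≠ 0) (hαβ : ∀ t ∈ U, α t ^ 2 + β t ^ 2 = 1) :
    G2.IsG2Structure (Warped.form S f α β : DForm Warped.model (U × L) 3) ∧
    ∀ (τ₀ : U × L → ℝ) (τ₁ : DForm Warped.model (U × L) 1) (τ₂ : DForm Warped.model (U × L) 2)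
      (τ₃ : DForm Warped.model (U × L) 3),
      G2.IsTorsion (Warped.form S f α β) τ₀ τ₁ τ₂ τ₃ ↔
        (∀ (t : U) (x : L), τ₀ (t, x) =
          4 / (7 * f t) * (3 * π₀ x * α t - 3 * σ₀ x * β t
            + f t * α t * deriv β t - f t * β t * deriv α t)) ∧
        (∀ (t : U) (x : L), τ₁ (t, x) =
          (1 / (2 * f t) * (π₀ x * β t + σ₀ x * α t + 2 * deriv f t)) • Warped.dt (t, x)
            + (1 / 6 : ℝ) • Warped.pull (t, x) (ν₁ x) + (1 / 6 : ℝ) • Warped.pull (t, x) (π₁ x)) ∧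
        (∀ (t : U) (x : L), τ₂ (t, x) =
          (-(2 / 3) : ℝ) •
              (Warped.pull (t, x) (S.star 1 (ν₁ x ⋏[5] S.ωsq x)) ⋏[2] Warped.dt (t, x))
            + (1 / 3 : ℝ) •
              (Warped.pull (t, x) (S.star 1 (π₁ x ⋏[5] S.ωsq x)) ⋏[2] Warped.dt (t, x))
            - (1 / 3 * f t * β t) • Warped.pull (t, x) (S.star 2 (π₁ x ⋏[4] S.ψp x))
            - (1 / 3 * f t * α t) • Warped.pull (t, x) (S.star 2 (π₁ x ⋏[4] S.ψm x))
            + (2 / 3 * f t * β t) • Warped.pull (t, x) (S.star 2 (ν₁ x ⋏[4] S.ψp x))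
            + (2 / 3 * f t * α t) • Warped.pull (t, x) (S.star 2 (ν₁ x ⋏[4] S.ψm x))
            - (f t * β t) • Warped.pull (t, x) (π₂ x)
            - (f t * α t) • Warped.pull (t, x) (σ₂ x)) ∧
        (∀ (t : U) (x : L), τ₃ (t, x) =
          (-(3 / 14) * f t ^ 2 * (π₀ x * α t ^ 2 - σ₀ x * α t * β t - 2 * f t * deriv β t)) •
              Warped.pull (t, x) (S.ψp x)
            + (3 / 14 * f t ^ 2 * (π₀ x * α t * β t - σ₀ x * β t ^ 2 + 2 * f t * deriv α t)) •
              Warped.pull (t, x) (S.ψm x)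
            + (2 / 7 * f t * (π₀ x * α t - σ₀ x * β t
                - 2 * f t * α t * deriv β t + 2 * f t * β t * deriv α t)) •
              (Warped.pull (t, x) (S.ω x) ⋏[3] Warped.dt (t, x))
            - (1 / 2 * f t ^ 2) • Warped.pull (t, x) (S.star 3 (ν₁ x ⋏[3] S.ω x))
            + (1 / 2 * f t ^ 2) • Warped.pull (t, x) (S.star 3 (π₁ x ⋏[3] S.ω x))
            + (1 / 2 * f t * α t) •
              (Warped.pull (t, x) (S.star 2 (π₁ x ⋏[4] S.ψp x)) ⋏[3] Warped.dt (t, x))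
            - (1 / 2 * f t * β t) •
              (Warped.pull (t, x) (S.star 2 (π₁ x ⋏[4] S.ψm x)) ⋏[3] Warped.dt (t, x))
            - (1 / 2 * f t * α t) •
              (Warped.pull (t, x) (S.star 2 (ν₁ x ⋏[4] S.ψp x)) ⋏[3] Warped.dt (t, x))
            + (1 / 2 * f t * β t) •
              (Warped.pull (t, x) (S.star 2 (ν₁ x ⋏[4] S.ψm x)) ⋏[3] Warped.dt (t, x))
            + f t • (Warped.pull (t, x) (α t • π₂ x - β t • σ₂ x) ⋏[3] Warped.dt (t, x))
            - f t ^ 2 • Warped.pull (t, x) (S.star 3 (ν₃ x))) := by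
  have hφ (m : U × L) : ∃ b : Basis (Fin 7) ℝ (TangentSpace Warped.model m),
      ExtAlg.IsG2Frame (Warped.form S f α β m) (G2.starForm (Warped.form S f α β) m) b := by
    obtain ⟨c, b, -, -, hb, -⟩ :=
      Warped.exists_frames (S := S) (hf0 m.1 m.1.2) (hαβ m.1 m.1.2)
    rw [Warped.starForm_form hf0 hαβ]
    exact ⟨b, hb⟩
  -- The explicit forms solve the equations; together with pointwise uniqueness this gives both
  -- directions of the equivalence.
  have hτ := Warped.isTorsion_form hS hf hα hβ hf0 hαβ
  refine ⟨⟨Warped.isSmooth_form hf hα hβ, fun m => (hφ m).imp fun b hb => hb.isAdapted⟩,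
    fun τ₀ τ₁ τ₂ τ₃ => ⟨fun h => ?_, fun ⟨h0, h1, h2, h3⟩ => ?_⟩⟩
  · have hu := fun t x => h.unique hφ hτ (t, x)
    dsimp only at hu ⊢
    exact ⟨fun t x => (hu t x).1, fun t x => (hu t x).2.1, fun t x => (hu t x).2.2.1,
      fun t x => (hu t x).2.2.2⟩
  · dsimp only at h0 h1 h2 h3
    refine hτ.congr ?_ ?_ ?_ ?_ <;> rintro ⟨t, x⟩ <;> dsimp only
    exacts [h0 t x, h1 t x, h2 t x, h3 t x]
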